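/- Let $d\ge 1$, $\Omega=(0,2\pi)^d$, and let $\phi_k(x)=(2\pi)^{-d/2}e^{ik\cdot x}$, $k\in\mathbb Z^d$, be the trigonometric basis. Let $V=H^1_p(\Omega)$ be the space of complex $2\pi$-periodic $H^1$ functions with norm $\|v\|^2=\|v\|_{L^2}^2+\|\nabla v\|_{L^2}^2$, and $V^*=H^{-1}_p(\Omega)$ its (conjugate-linear) dual with the dual norm. Let $\nu,\sigma$ be real measurable coefficients with $0<\nu_*\le\nu\le\nu^*$ and $0<\sigma_*\le\sigma\le\sigma^*$ in $\Omega$, and put $$\alpha_*=\min(\nu_*,\sigma_*),\quad \alpha^*=\max(\nu^*,\sigma^*),\quad a(u,v)=\int_\Omega \nu\nabla u\cdot\nabla\bar v+\int_\Omega\sigma u\bar v,\quad |||v|||=\sqrt{a(v,v)} .$$ Given $f\in V^*$, let $u\in V$ be the solution of $a(u,v)=\langle f,v\rangle$ for all $v\in V$. Put $c_k=\sqrt{1+|k|^2}$ ($|\cdot|$ Euclidean), $\hat R_k(r)=\langle r,\phi_k\rangle/c_k$ for $r\in V^*$ (so that $\|r\|^2=\sum_k|\hat R_k(r)|^2$),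 and let $\mathbf A=(a_{\ell,k})$, $a_{\ell,k}=a(\phi_k,\phi_\ell)/(c_\ell c_k)$, be the stiffness matrix. *Algorithm A-ADFOUR* with parameters $\theta\in(0,1)$, $J\in\mathbb N_0$, $tol\ge 0$. Start with $\Lambda_0=\emptyset$, $u_0=0$, $r_0=f$. For $n=0,1,\dots$: choose a finite set $D_n\subset\mathbb Z^d$ of minimal cardinality with $\big(\sum_{k\in D_n}|\hat R_k(r_n)|^2\big)^{1/2}\ge\theta\|r_n\|$ (Dörfler marking); enrich it by setting $\partial\Lambda_n=\{k:\ |k-\ell|\le J\text{ for some }\ell\in D_n\}$; put $\Lambda_{n+1}=\Lambda_n\cup\partial\Lambda_n$; let $u_{n+1}\in V_{\Lambda_{n+1}}=\mathrm{span}\{\phi_k:k\in\Lambda_{n+1}\}$ be the Galerkin solution, $a(u_{n+1},v)=\langle f,v\rangle$ for all $v\in V_{\Lambda_{n+1}}$; let $r_{n+1}=f-a(u_{n+1},\cdot)$; repeat while $\|r_{n+1}\|>tol$. We say that the algorithm *converges with factor* $\rho$ if every step can be carried out; $|||u-u_{n+1}|||\le\rho\,|||u-u_n|||$ at every step of every execution;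 for every $tol>0$ the algorithm terminates after finitely many iterations; and for $tol=0$ either $u_n\to u$ in $V$, or the algorithm stops with the exact solution. *Matrix classes.* A matrix $\mathbf M=(m_{\ell,k})_{\ell,k\in\mathbb Z^d}$ is in $\mathcal D_a(\eta)$ if $|m_{\ell,k}|\le c(1+|\ell-k|)^{-\eta}$, and in $\mathcal D_e(\eta)$ if $|m_{\ell,k}|\le c\,e^{-\eta|\ell-k|}$, for some constant $c>0$ and all $\ell,k$. Let $\mathbf M_J$ have the entries of $\mathbf M$ with $|\ell-k|\le J$, and zeros elsewhere. For a function $g$ on $\mathbb N_0$, a number $C>0$ is called *admissible* for $(\mathbf M,g)$ if $\|\mathbf M-\mathbf M_J\|_{\ell^2\to\ell^2}\le C\,g(J)$ for all $J\ge0$. **Theorem.** Let $$\bar\rho=\bar\rho(\theta)=\Big(\frac{\alpha^*}{\alpha_*}\Big)^{1/2}\sqrt{1-\theta^2},\qquad T=\sqrt{\frac{1-\theta^2}{\alpha_*\alpha^*}} .$$ Then $\bar\rho(\theta)\to0$ as $\theta\to1^-$. For every $\theta\in(0,1)$ there is $\delta\in(0,1]$, depending only on $\theta,\nu_*,\nu^*,\sigma_*,\sigma^*$,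 such that for all $d,\nu,\sigma,f$ as above $\mathbf A$ has a bounded inverse on $\ell^2(\mathbb Z^d)$, and the following holds. (Algebraic case.) If $\mathbf A\in\mathcal D_a(\eta)$ with $\eta>d$, then $\mathbf A^{-1}\in\mathcal D_a(\eta)$, and (i), (ii) below hold with $g(J)=(J+1)^{-(\eta-d)}$. (Exponential case.) If $\mathbf A\in\mathcal D_e(\eta)$ with $\eta>0$, then $\mathbf A^{-1}\in\mathcal D_e(\bar\eta)$ for some $\bar\eta\in(0,\eta]$; and for every $\bar\eta>0$ with $\mathbf A^{-1}\in\mathcal D_e(\bar\eta)$, (i), (ii) below hold with $g(J)=(J+1)^{d-1}e^{-\bar\eta J}$. If moreover $d=1$, $|a_{\ell,k}|\le c\,e^{-\eta|\ell-k|}$ and $a_{\ell,\ell}\ge m>0$ for all $\ell,k$, and $c<\frac12(e^\eta-1)m$, then there is such an $\bar\eta\in(0,\eta]$ for which $z=e^{-\bar\eta}$ is a zero of $$z^2-\frac{e^{2\eta}+2c/m+1}{e^{\eta}(c/m+1)}\,z+1 .$$ Here (i) and (ii) are the following statements, in which admissible refers to $(\mathbf A^{-1},g)$. (i) There is an admissible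 $C$. For every admissible $C$ there is a smallest integer $J\ge0$ with $C\,g(J)\le T$, and, if $2\bar\rho<1$, A-ADFOUR with parameters $\theta$ and this $J$ converges with factor $2\bar\rho$. (ii) For every admissible $C$ there is a smallest integer $J\ge0$ with $C\,g(J)\le\delta\,T$, and, if $\bar\rho<1$, A-ADFOUR with parameters $\theta$ and this $J$ converges with factor $\bar\rho$. -/

import Mathlib

open MeasureTheory Set Filter Topology
open scoped ContDiff ComplexConjugate

noncomputable section

namespace AFG

/-! ### The periodic box, the trigonometric basis and test functions -/

/-- The box `Ω = (0, 2π)^d`. -/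
def box (d : ℕ) : Set (Fin d → ℝ) := Set.univ.pi fun _ => Set.Ioo 0 (2 * Real.pi)

/-- Lebesgue measure on `Ω`. -/
def boxMeasure (d : ℕ) : Measure (Fin d → ℝ) := volume.restrict (box d)

/-- The Lebesgue space `L²(Ω)` of complex-valued functions. -/
abbrev L2 (d : ℕ) := Lp ℂ 2 (boxMeasure d)

/-- Frequencies `k ∈ ℤ^d`. -/
abbrev Freq (d : ℕ) := Fin d → ℤ

/-- The Euclidean norm `|k|` of a frequency. -/
def freqNorm {d : ℕ} (k : Freq d) : ℝ := Real.sqrt (∑ j, (k j : ℝ) ^ 2)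

/-- The normalizing weight `c_k = (1 + |k|²)^{1/2}`. -/
def weight {d : ℕ} (k : Freq d) : ℝ := Real.sqrt (1 + freqNorm k ^ 2)

/-- The basis function `φ_k(x) = (2π)^{-d/2} exp(i k·x)`. -/
def modeFun {d : ℕ} (k : Freq d) (x : Fin d → ℝ) : ℂ :=
  (((2 * Real.pi) ^ (-(d : ℝ) / 2) : ℝ) : ℂ) *
    Complex.exp (Complex.I * ((∑ j, (k j : ℝ) * x j : ℝ) : ℂ))

/-- The partial derivative `∂_j ψ` of a differentiable function on `ℝ^d`. -/
def pderivC {d : ℕ} (j : Fin d) (ψ : (Fin d → ℝ) → ℂ) (x : Fin d → ℝ) : ℂ :=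
  fderiv ℝ ψ x (Pi.single j 1)

/-- Test functions: smooth functions on `ℝ^d` that are `2π`-periodic in each direction. -/
structure IsPeriodicTest {d : ℕ} (ψ : (Fin d → ℝ) → ℂ) : Prop where
  smooth : ContDiff ℝ ∞ ψ
  periodic : ∀ (j : Fin d) (x : Fin d → ℝ), ψ (x + Pi.single j (2 * Real.pi)) = ψ x

/-- `g` is the weak partial derivative `∂_j v` on the torus. -/
def IsWeakPartial {d : ℕ} (j : Fin d) (v g : L2 d) : Prop :=
  ∀ ψ : (Fin d → ℝ) → ℂ, IsPeriodicTest ψ →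
    ∫ x, v x * pderivC j ψ x ∂(boxMeasure d) = - ∫ x, g x * ψ x ∂(boxMeasure d)

instance (d : ℕ) : IsFiniteMeasure (boxMeasure d) := by
  constructor
  rw [boxMeasure, Measure.restrict_apply_univ, box, Real.volume_pi_Ioo]
  exact ENNReal.prod_lt_top fun _ _ => ENNReal.ofReal_lt_top

theorem box_subset_Icc (d : ℕ) :
    box d ⊆ Set.Icc (fun _ => (0 : ℝ)) (fun _ => 2 * Real.pi) := by
  intro x hx
  exact ⟨fun i => (hx i (Set.mem_univ i)).1.le, fun i => (hx i (Set.mem_univ i)).2.le⟩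

theorem measurableSet_box (d : ℕ) : MeasurableSet (box d) :=
  MeasurableSet.univ_pi fun _ => measurableSet_Ioo

theorem memLp_of_continuous {d : ℕ} {ψ : (Fin d → ℝ) → ℂ} (h : Continuous ψ)
    (p : ENNReal) : MemLp ψ p (boxMeasure d) := by
  obtain ⟨C, hC⟩ := (isCompact_Icc (a := fun _ : Fin d => (0 : ℝ))
    (b := fun _ => 2 * Real.pi)).exists_bound_of_continuousOn h.continuousOn
  refine MemLp.of_bound h.aestronglyMeasurable C ?_
  refine (ae_restrict_iff' (measurableSet_box d)).2 (Eventually.of_forall fun x hx => ?_)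
  exact hC x (box_subset_Icc d hx)

theorem integrable_mul_continuous {d : ℕ} (v : L2 d) {ψ : (Fin d → ℝ) → ℂ}
    (h : Continuous ψ) : Integrable (fun x => v x * ψ x) (boxMeasure d) :=
  (Lp.memLp v).integrable_mul (memLp_of_continuous h 2)

theorem IsPeriodicTest.continuous_pderiv {d : ℕ} {ψ : (Fin d → ℝ) → ℂ}
    (h : IsPeriodicTest ψ) (j : Fin d) : Continuous (pderivC j ψ) :=
  (h.smooth.continuous_fderiv (by simp)).clm_apply continuous_const

/-- The integral over `Ω` of a partial derivative of a periodic function vanishes. -/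
theorem integral_pderiv_eq_zero {d : ℕ} {ψ : (Fin d → ℝ) → ℂ} (h : IsPeriodicTest ψ)
    (j : Fin d) : ∫ x, pderivC j ψ x ∂(boxMeasure d) = 0 := by
  cases d with
  | zero => exact j.elim0
  | succ n =>
    have hdiff : Differentiable ℝ ψ := h.smooth.differentiable (by simp)
    have key := integral_divergence_of_hasFDerivAt_off_countable'
      (a := fun _ : Fin (n + 1) => (0 : ℝ)) (b := fun _ => 2 * Real.pi)
      (fun _ => by positivity)
      (fun i x => if i = j then ψ x else 0)
      (fun i x => if i = j then fderiv ℝ ψ x else 0) ∅ Set.countable_empty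
      (fun i => by
        by_cases hi : i = j
        · simpa [hi] using hdiff.continuous.continuousOn
        · simpa [hi] using continuousOn_const)
      (fun x _ i => by
        by_cases hi : i = j
        · simpa [hi] using (hdiff x).hasFDerivAt
        · simpa [hi] using hasFDerivAt_const (0 : ℂ) x)
      (by
        have hc : Continuous (fun x => ∑ i : Fin (n + 1),
            (if i = j then fderiv ℝ ψ x else 0) (Pi.single i 1)) := by
          refine continuous_finsetSum _ fun i _ => ?_
          by_cases hi : i = j
          · subst hi
            simp only [if_true]
            exact h.continuous_pderiv i
          · simpa [hi] using continuous_const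
        exact hc.continuousOn.integrableOn_compact isCompact_Icc)
    have hl : ∀ x, (∑ i : Fin (n + 1),
        (if i = j then fderiv ℝ ψ x else 0) (Pi.single i 1)) = pderivC j ψ x := by
      intro x
      rw [Finset.sum_eq_single j]
      · simp [pderivC]
      · intro b _ hb; simp [hb]
      · simp
    simp only [hl] at key
    have hbox : ∫ x, pderivC j ψ x ∂(boxMeasure (n + 1)) =
        ∫ x in Set.Icc (fun _ : Fin (n + 1) => (0 : ℝ)) (fun _ => 2 * Real.pi),
          pderivC j ψ x := by
      rw [boxMeasure, box, volume_pi]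
      exact setIntegral_congr_set Measure.univ_pi_Ioo_ae_eq_Icc
    rw [hbox, key]
    refine Finset.sum_eq_zero fun i _ => ?_
    by_cases hi : i = j
    · subst hi
      simp only [if_true]
      rw [sub_eq_zero]
      refine integral_congr_ae (Eventually.of_forall fun x => ?_)
      have := h.periodic i (i.insertNth 0 x)
      have e : (i.insertNth (0 : ℝ) x : Fin (n + 1) → ℝ) + Pi.single i (2 * Real.pi) =
          i.insertNth (2 * Real.pi) x := by
        ext m
        refine Fin.succAboveCases i ?_ (fun m => ?_) m
        · simp
        · simp
      rw [e] at this
      exact this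
    · simp [hi]

theorem contDiff_modeFun {d : ℕ} (k : Freq d) : ContDiff ℝ ∞ (modeFun k) := by
  unfold modeFun
  refine contDiff_const.mul (ContDiff.cexp (contDiff_const.mul ?_))
  refine Complex.ofRealCLM.contDiff.comp (g := Complex.ofRealCLM)
    (f := fun x : Fin d → ℝ => ∑ j, (k j : ℝ) * x j) ?_
  exact ContDiff.sum fun j _ => contDiff_const.mul (contDiff_apply ℝ ℝ j)

theorem modeFun_periodic {d : ℕ} (k : Freq d) (j : Fin d) (x : Fin d → ℝ) :
    modeFun k (x + Pi.single j (2 * Real.pi)) = modeFun k x := by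
  unfold modeFun
  congr 1
  have : (∑ i, (k i : ℝ) * (x + Pi.single j (2 * Real.pi) : Fin d → ℝ) i) =
      (∑ i, (k i : ℝ) * x i) + (k j : ℝ) * (2 * Real.pi) := by
    simp only [Pi.add_apply, mul_add, Finset.sum_add_distrib]
    congr 1
    rw [Finset.sum_eq_single j]
    · simp
    · intro b _ hb; simp [hb]
    · simp
  rw [this, Complex.exp_eq_exp_iff_exists_int]
  exact ⟨k j, by push_cast; ring⟩

theorem isPeriodicTest_modeFun {d : ℕ} (k : Freq d) : IsPeriodicTest (modeFun k) :=
  ⟨contDiff_modeFun k, modeFun_periodic k⟩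

theorem pderivC_modeFun {d : ℕ} (k : Freq d) (j : Fin d) (x : Fin d → ℝ) :
    pderivC j (modeFun k) x = Complex.I * (k j : ℂ) * modeFun k x := by
  have h1 : HasFDerivAt (fun x : Fin d → ℝ => ∑ i, (k i : ℝ) * x i)
      (∑ i, (k i : ℝ) • ContinuousLinearMap.proj (R := ℝ) (φ := fun _ : Fin d => ℝ) i) x := by
    refine HasFDerivAt.fun_sum fun i _ => ?_
    exact (hasFDerivAt_apply i x).const_mul _
  have h2 := (((Complex.ofRealCLM.hasFDerivAt.comp x h1).const_mul Complex.I).cexp).const_mul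
    ((((2 * Real.pi) ^ (-(d : ℝ) / 2) : ℝ) : ℂ))
  have h3 : HasFDerivAt (modeFun k) _ x := h2
  rw [pderivC, h3.fderiv]
  have : (∑ i, (k i : ℝ) * (Pi.single j (1 : ℝ) : Fin d → ℝ) i) = (k j : ℝ) := by
    rw [Finset.sum_eq_single j]
    · simp
    · intro b _ hb; simp [hb]
    · simp
  simp [modeFun, Pi.single_apply]
  ring

/-! ### The space `H¹_p(Ω)` and its dual -/

/-- The ambient Hilbert space of pairs (function, gradient). -/
abbrev Pair (d : ℕ) := WithLp 2 (L2 d × PiLp 2 (fun _ : Fin d => L2 d))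

/-- The periodic Sobolev space `H¹_p(Ω)`: the pairs `(v, ∇v)` with `v ∈ L²(Ω)` and `∇v` the weak
gradient in `L²(Ω)^d`, with the norm `‖v‖² = ‖v‖²_{L²} + ∑_j ‖∂_j v‖²_{L²}`. -/
def H1p (d : ℕ) : Submodule ℂ (Pair d) where
  carrier := {p | ∀ j, IsWeakPartial j p.fst (p.snd j)}
  zero_mem' := by
    intro j ψ hψ
    have h0 : ((0 : L2 d) : (Fin d → ℝ) → ℂ) =ᵐ[boxMeasure d] 0 := Lp.coeFn_zero _ _ _
    have e1 : ∫ x, (0 : L2 d) x * pderivC j ψ x ∂(boxMeasure d) = 0 :=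
      integral_eq_zero_of_ae (by filter_upwards [h0] with x hx; rw [hx]; simp)
    have e2 : ∫ x, (0 : L2 d) x * ψ x ∂(boxMeasure d) = 0 :=
      integral_eq_zero_of_ae (by filter_upwards [h0] with x hx; rw [hx]; simp)
    change ∫ x, (0 : L2 d) x * pderivC j ψ x ∂(boxMeasure d) =
      - ∫ x, (0 : L2 d) x * ψ x ∂(boxMeasure d)
    rw [e1, e2, neg_zero]
  add_mem' := by
    intro p q hp hq j ψ hψ
    have split : ∀ (v w : L2 d) (χ : (Fin d → ℝ) → ℂ), Continuous χ →
        ∫ x, (v + w : L2 d) x * χ x ∂(boxMeasure d) =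
          ∫ x, v x * χ x ∂(boxMeasure d) + ∫ x, w x * χ x ∂(boxMeasure d) := by
      intro v w χ hχ
      rw [← integral_add (integrable_mul_continuous v hχ) (integrable_mul_continuous w hχ)]
      refine integral_congr_ae ?_
      filter_upwards [Lp.coeFn_add v w] with x hx
      rw [hx, Pi.add_apply, add_mul]
    change ∫ x, (p.fst + q.fst : L2 d) x * pderivC j ψ x ∂(boxMeasure d) =
      - ∫ x, (p.snd j + q.snd j : L2 d) x * ψ x ∂(boxMeasure d)
    rw [split _ _ _ (hψ.continuous_pderiv j), split _ _ _ hψ.smooth.continuous,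
      hp j ψ hψ, hq j ψ hψ, neg_add]
  smul_mem' := by
    intro c p hp j ψ hψ
    have pull : ∀ (v : L2 d) (χ : (Fin d → ℝ) → ℂ),
        ∫ x, (c • v : L2 d) x * χ x ∂(boxMeasure d) = c * ∫ x, v x * χ x ∂(boxMeasure d) := by
      intro v χ
      rw [← integral_const_mul]
      refine integral_congr_ae ?_
      filter_upwards [Lp.coeFn_smul c v] with x hx
      rw [hx, Pi.smul_apply, smul_eq_mul, mul_assoc]
    change ∫ x, (c • p.fst : L2 d) x * pderivC j ψ x ∂(boxMeasure d) =
      - ∫ x, (c • p.snd j : L2 d) x * ψ x ∂(boxMeasure d)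
    rw [pull, pull, hp j ψ hψ, mul_neg]

/-- The underlying `L²` function of `v ∈ H¹_p(Ω)`. -/
def H1p.toL2 {d : ℕ} (v : H1p d) : L2 d := (v : Pair d).fst

/-- The weak partial derivative `∂_j v` of `v ∈ H¹_p(Ω)`. -/
def H1p.grad {d : ℕ} (v : H1p d) (j : Fin d) : L2 d := (v : Pair d).snd j

/-- The basis function `φ_k` as an element of `L²(Ω)`. -/
def modeL2 {d : ℕ} (k : Freq d) : L2 d :=
  (memLp_of_continuous (contDiff_modeFun k).continuous 2).toLp (modeFun k)

theorem mode_mem {d : ℕ} (k : Freq d) :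
    (WithLp.toLp 2 (modeL2 k, WithLp.toLp 2 fun j => (Complex.I * (k j : ℂ)) • modeL2 k) :
      Pair d) ∈ H1p d := by
  intro j ψ hψ
  have hm : (modeL2 k : (Fin d → ℝ) → ℂ) =ᵐ[boxMeasure d] modeFun k := MemLp.coeFn_toLp _
  change ∫ x, (modeL2 k) x * pderivC j ψ x ∂(boxMeasure d) =
    - ∫ x, ((Complex.I * (k j : ℂ)) • modeL2 k : L2 d) x * ψ x ∂(boxMeasure d)
  have hprod : IsPeriodicTest (fun x => modeFun k x * ψ x) :=
    ⟨(contDiff_modeFun k).mul hψ.smooth, fun i x => by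
      rw [modeFun_periodic, hψ.periodic]⟩
  have h0 := integral_pderiv_eq_zero hprod j
  have hder : ∀ x, pderivC j (fun x => modeFun k x * ψ x) x =
      modeFun k x * pderivC j ψ x + Complex.I * (k j : ℂ) * modeFun k x * ψ x := by
    intro x
    have d1 : DifferentiableAt ℝ (modeFun k) x :=
      (contDiff_modeFun k).differentiable (by simp) x
    have d2 : DifferentiableAt ℝ ψ x := hψ.smooth.differentiable (by simp) x
    rw [← pderivC_modeFun]
    unfold pderivC
    rw [fderiv_fun_mul d1 d2]
    simp
    ring
  simp only [hder] at h0
  have i1 : Integrable (fun x => modeFun k x * pderivC j ψ x) (boxMeasure d) :=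
    memLp_one_iff_integrable.1 (memLp_of_continuous
      ((contDiff_modeFun k).continuous.mul (hψ.continuous_pderiv j)) 1)
  have i2 : Integrable (fun x => Complex.I * (k j : ℂ) * modeFun k x * ψ x) (boxMeasure d) :=
    memLp_one_iff_integrable.1 (memLp_of_continuous
      ((continuous_const.mul (contDiff_modeFun k).continuous).mul hψ.smooth.continuous) 1)
  rw [integral_add i1 i2] at h0
  have e1 : ∫ x, (modeL2 k) x * pderivC j ψ x ∂(boxMeasure d) =
      ∫ x, modeFun k x * pderivC j ψ x ∂(boxMeasure d) :=
    integral_congr_ae (by filter_upwards [hm] with x hx; rw [hx])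
  have e2 : ∫ x, ((Complex.I * (k j : ℂ)) • modeL2 k : L2 d) x * ψ x ∂(boxMeasure d) =
      ∫ x, Complex.I * (k j : ℂ) * modeFun k x * ψ x ∂(boxMeasure d) := by
    refine integral_congr_ae ?_
    filter_upwards [hm, Lp.coeFn_smul (Complex.I * (k j : ℂ)) (modeL2 k)] with x hx hy
    rw [hy, Pi.smul_apply, hx, smul_eq_mul]
  rw [e1, e2]
  exact eq_neg_of_add_eq_zero_left h0

/-- The basis function `φ_k` as an element of `H¹_p(Ω)`. -/
def mode {d : ℕ} (k : Freq d) : H1p d := ⟨_, mode_mem k⟩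

/-- The dual space `H⁻¹_p(Ω)` of conjugate-linear continuous functionals on `H¹_p(Ω)`, with the
dual norm. -/
abbrev Dual (d : ℕ) := H1p d →L⋆[ℂ] ℂ

/-- The normalized coefficient `R̂_k = ⟨r, φ_k⟩ / c_k` of `r ∈ H⁻¹_p(Ω)`. -/
def dualCoeff {d : ℕ} (r : Dual d) (k : Freq d) : ℂ := r (mode k) / (weight k : ℂ)

/-- `‖P_Λ r‖ = (∑_{k ∈ Λ} |R̂_k|²)^{1/2}` for a finite set `Λ` of frequencies. -/
def projNorm {d : ℕ} (r : Dual d) (Λ : Finset (Freq d)) : ℝ :=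
  Real.sqrt (∑ k ∈ Λ, ‖dualCoeff r k‖ ^ 2)

/-- The trial space `V_Λ = span {φ_k : k ∈ Λ}`. -/
def trialSpace {d : ℕ} (Λ : Finset (Freq d)) : Submodule ℂ (H1p d) :=
  Submodule.span ℂ (mode '' (Λ : Set (Freq d)))

/-! ### The elliptic problem -/

/-- Measurable real coefficients with `νl ≤ ν ≤ νu` and `σl ≤ σ ≤ σu` in `Ω`. Only the values
in `Ω` enter the problem. -/
structure IsCoeff {d : ℕ} (νl νu σl σu : ℝ) (ν σ : (Fin d → ℝ) → ℝ) : Prop where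
  meas_ν : Measurable ν
  meas_σ : Measurable σ
  bound_ν : ∀ x ∈ box d, νl ≤ ν x ∧ ν x ≤ νu
  bound_σ : ∀ x ∈ box d, σl ≤ σ x ∧ σ x ≤ σu

/-- `a(u, v) = ∫_Ω ν ∇u · conj ∇v + ∫_Ω σ u conj v`. -/
def form {d : ℕ} (ν σ : (Fin d → ℝ) → ℝ) (u v : H1p d) : ℂ :=
  (∫ x, (ν x : ℂ) * ∑ j, H1p.grad u j x * conj (H1p.grad v j x) ∂(boxMeasure d)) +
    ∫ x, (σ x : ℂ) * (H1p.toL2 u x * conj (H1p.toL2 v x)) ∂(boxMeasure d)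

/-- The energy norm `a(v, v)^{1/2}`. -/
def energy {d : ℕ} (ν σ : (Fin d → ℝ) → ℝ) (v : H1p d) : ℝ := Real.sqrt (form ν σ v v).re

/-- `u` is the solution of `a(u, v) = ⟨f, v⟩` for all `v ∈ H¹_p(Ω)`. -/
def IsWeakSolution {d : ℕ} (ν σ : (Fin d → ℝ) → ℝ) (f : Dual d) (u : H1p d) : Prop :=
  ∀ v, form ν σ u v = f v

/-- `w = GAL(Λ)`. -/
def IsGalerkin {d : ℕ} (ν σ : (Fin d → ℝ) → ℝ) (f : Dual d) (Λ : Finset (Freq d))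
    (w : H1p d) : Prop :=
  w ∈ trialSpace Λ ∧ ∀ v ∈ trialSpace Λ, form ν σ w v = f v

/-- `r = RES(w) = f - L w`. -/
def IsResidual {d : ℕ} (ν σ : (Fin d → ℝ) → ℝ) (f : Dual d) (w : H1p d) (r : Dual d) : Prop :=
  ∀ v, r v = f v - form ν σ w v

/-! ### The adaptive algorithm -/

/-- `D` is an output of `DÖRFLER(r, θ)`: a finite set of minimal cardinality among those with
`‖P_D r‖ ≥ θ ‖r‖`. -/
def IsDorfler {d : ℕ} (r : Dual d) (θ : ℝ) (D : Finset (Freq d)) : Prop :=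
  θ * ‖r‖ ≤ projNorm r D ∧
    ∀ D' : Finset (Freq d), θ * ‖r‖ ≤ projNorm r D' → D.card ≤ D'.card

/-- `ENRICH(D, J)`: all frequencies within distance `J` from `D`. -/
def enrich {d : ℕ} (D : Finset (Freq d)) (J : ℕ) : Set (Freq d) :=
  {k | ∃ l ∈ D, freqNorm (k - l) ≤ J}

/-- The data `(Λ_n, u_n, r_n)` at an iteration. -/
structure State (d : ℕ) where
  Λ : Finset (Freq d)
  u : H1p d
  r : Dual d

/-- One pass through the loop of the aggressive algorithm with parameters `θ` and `J`. -/
def Step {d : ℕ} (ν σ : (Fin d → ℝ) → ℝ) (f : Dual d) (θ : ℝ) (J : ℕ)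
    (s s' : State d) : Prop :=
  (∃ D, IsDorfler s.r θ D ∧ (s'.Λ : Set (Freq d)) = ↑s.Λ ∪ enrich D J) ∧
    IsGalerkin ν σ f s'.Λ s'.u ∧ IsResidual ν σ f s'.u s'.r

/-- `s` describes the first `N` passes (infinitely many if `N = ⊤`) of an execution of the
aggressive algorithm with tolerance `tol`. The first pass is always made, a later one only if the
norm of the current residual exceeds `tol`. -/
structure IsRun {d : ℕ} (ν σ : (Fin d → ℝ) → ℝ) (f : Dual d) (θ : ℝ) (J : ℕ) (tol : ℝ)
    (N : ℕ∞) (s : ℕ → State d) : Prop where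
  init : s 0 = ⟨∅, 0, f⟩
  continue_of_lt : ∀ n : ℕ, (n : ℕ∞) < N → n ≠ 0 → tol < ‖(s n).r‖
  step : ∀ n : ℕ, (n : ℕ∞) < N → Step ν σ f θ J (s n) (s (n + 1))

/-- The convergence assertions with contraction factor `ρ`, for the solution `u`. -/
structure ConvergesWithFactor {d : ℕ} (ν σ : (Fin d → ℝ) → ℝ) (f : Dual d) (u : H1p d)
    (θ : ℝ) (J : ℕ) (ρ : ℝ) : Prop where
  /-- The algorithm never gets stuck. -/
  progress : ∀ s : State d, ∃ s', Step ν σ f θ J s s'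
  contraction : ∀ (tol : ℝ) (N : ℕ∞) (s : ℕ → State d), 0 ≤ tol →
    IsRun ν σ f θ J tol N s → ∀ n : ℕ, (n : ℕ∞) < N →
      energy ν σ (u - (s (n + 1)).u) ≤ ρ * energy ν σ (u - (s n).u)
  /-- For positive tolerance the number of iterations is finite. -/
  termination : ∀ tol : ℝ, 0 < tol → ∃ M : ℕ, ∀ (N : ℕ∞) (s : ℕ → State d),
    IsRun ν σ f θ J tol N s → N ≤ M
  /-- For zero tolerance the iterates converge to `u`. -/
  convergence : ∀ s : ℕ → State d, IsRun ν σ f θ J 0 ⊤ s →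
    Tendsto (fun n => (s n).u) atTop (𝓝 u)
  /-- If the algorithm with zero tolerance stops, it has found `u`. -/
  exact_stop : ∀ (N : ℕ) (s : ℕ → State d), IsRun ν σ f θ J 0 N s → 0 < N →
    ‖(s N).r‖ ≤ 0 → (s N).u = u

/-! ### Bi-infinite matrices -/

/-- The sequence space `ℓ²(ℤ^d)`. -/
abbrev Ell2 (d : ℕ) := lp (fun _ : Freq d => ℂ) 2

/-- Bi-infinite matrices, with rows and columns indexed by frequencies. -/
abbrev BiMatrix (d : ℕ) := Freq d → Freq d → ℂ

/-- The bounded operator `T` on `ℓ²(ℤ^d)` is given by the matrix `M`. -/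
def Represents {d : ℕ} (T : Ell2 d →L[ℂ] Ell2 d) (M : BiMatrix d) : Prop :=
  ∀ l k, T (lp.single 2 k 1) l = M l k

/-- `M` defines a bounded operator on `ℓ²(ℤ^d)` of norm at most `K`. -/
def OpNormLe {d : ℕ} (M : BiMatrix d) (K : ℝ) : Prop :=
  ∃ T : Ell2 d →L[ℂ] Ell2 d, Represents T M ∧ ‖T‖ ≤ K

/-- `B = A⁻¹` as operators on `ℓ²(ℤ^d)`. -/
def IsInverseMatrix {d : ℕ} (A B : BiMatrix d) : Prop :=
  ∃ S T : Ell2 d →L[ℂ] Ell2 d, Represents S A ∧ Represents T B ∧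
    S.comp T = ContinuousLinearMap.id ℂ _ ∧ T.comp S = ContinuousLinearMap.id ℂ _

/-- The stiffness matrix `a_{l,k} = a(φ_k, φ_l) / (c_l c_k)`. -/
def stiffness {d : ℕ} (ν σ : (Fin d → ℝ) → ℝ) : BiMatrix d := fun l k =>
  form ν σ (mode k) (mode l) / ((weight l : ℂ) * (weight k : ℂ))

/-- The truncation `M_J`. -/
def trunc {d : ℕ} (M : BiMatrix d) (J : ℕ) : BiMatrix d := fun l k =>
  open Classical in if freqNorm (l - k) ≤ J then M l k else 0

/-- The algebraic class `𝒟_a(η)`. -/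
def AlgClass {d : ℕ} (η : ℝ) (M : BiMatrix d) : Prop :=
  ∃ c > 0, ∀ l k, ‖M l k‖ ≤ c * (1 + freqNorm (l - k)) ^ (-η)

/-- `|m_{l,k}| ≤ c exp(-η |l - k|)`. -/
def ExpBound {d : ℕ} (η c : ℝ) (M : BiMatrix d) : Prop :=
  ∀ l k, ‖M l k‖ ≤ c * Real.exp (-η * freqNorm (l - k))

/-- The exponential class `𝒟_e(η)`. -/
def ExpClass {d : ℕ} (η : ℝ) (M : BiMatrix d) : Prop := ∃ c > 0, ExpBound η c M

/-- `(J+1)^{-(η-d)}`. -/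
def algRate (d : ℕ) (η : ℝ) (J : ℕ) : ℝ := ((J : ℝ) + 1) ^ (-(η - d))

/-- `(J+1)^{d-1} exp(-η J)`, for `d ≥ 1`. -/
def expRate (d : ℕ) (η : ℝ) (J : ℕ) : ℝ := ((J : ℝ) + 1) ^ (d - 1) * Real.exp (-η * J)

/-- `C` is an admissible constant `C_M` in `‖M - M_J‖ ≤ ψ_M(J) = C_M g(J)` for all `J ≥ 0`. -/
def IsTruncConst {d : ℕ} (M : BiMatrix d) (g : ℕ → ℝ) (C : ℝ) : Prop :=
  0 < C ∧ ∀ J, OpNormLe (M - trunc M J) (C * g J)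

/-- The contraction factor `ρ̄ = (α^*/α_*)^{1/2} (1-θ²)^{1/2}`. -/
def rhoBar (αl αu θ : ℝ) : ℝ := Real.sqrt (αu / αl) * Real.sqrt (1 - θ ^ 2)

/-- The threshold `((1-θ²)/(α_* α^*))^{1/2}` for `ψ_{A⁻¹}(J)`. -/
def threshold (αl αu θ : ℝ) : ℝ := Real.sqrt ((1 - θ ^ 2) / (αl * αu))

/-- With `J` the smallest integer such that `ψ(J) = C g(J) ≤ τ`, where `C` is any admissible
constant in the truncation estimate for `B = A⁻¹` (there is one), the aggressive algorithm has
the convergence properties with factor `ρ`, if `ρ < 1`. -/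
def AggressiveConvergence {d : ℕ} (ν σ : (Fin d → ℝ) → ℝ) (f : Dual d) (u : H1p d)
    (θ : ℝ) (B : BiMatrix d) (g : ℕ → ℝ) (τ ρ : ℝ) : Prop :=
  (∃ C, IsTruncConst B g C) ∧
    ∀ C, IsTruncConst B g C →
      ∃ J : ℕ, IsLeast {J : ℕ | C * g J ≤ τ} J ∧
        (ρ < 1 → ConvergesWithFactor ν σ f u θ J ρ)

end AFG

end

noncomputable section

namespace AFG

/-! ### Lattice sums -/

/-! The functions φ_k/c_k form an orthonormal basis of V, so the problem can be moved to ℓ²(ℤ^d).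
There the form is a symmetric operator A with α_* ≤ A ≤ α^*, the error e has residual r = A e, and
Dörfler marking splits r = p + q with p supported in D and ‖q‖² ≤ (1-θ²)‖r‖². Put X = A⁻¹ and w =
X_J p. Then w lives on the enriched set, so adding it to the current iterate gives a competitor for
the next Galerkin solution, with error e - w = X q + (X - X_J) p. In the energy norm the spectral
bounds give at most ρ̄|||e||| for the first term and at most α^*‖X - X_J‖ |||e||| for the second.
Since α^* T = ρ̄, the factor 2ρ̄ follows (`exists_correction`, `Step.energy_le`).

For the factor ρ̄ itself, observe that equality in the bound of X q would force q to be a top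
eigenvector of X, r a bottom eigenvector, and ⟨r,q⟩ = ‖q‖² to be nonzero. Eigenvectors for distinct
eigenvalues are orthogonal, so this is impossible when α_* < α^*.
`IsBetween.re_inner_le_improvement` turns this into a gain that depends only on the spectral bounds
and θ, and the truncation error is allowed to use up exactly that gain; this fixes δ. When α_* =
α^*, A is a multiple of the identity and its inverse has nothing to truncate.

For the decay of A⁻¹, take t > 0 with ‖Q‖ < 1 for Q = 1 - tA, so that A⁻¹ = t ∑ Qⁿ. The entries of
Qⁿ have to be small in n and in |l-k| at once. In the exponential class this is an interpolation
between an off-diagonal bound growing like Kⁿ and the operator norm bound (`expClass_inverse`). In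
the algebraic class a doubling argument lowers the growth rate of the constants until it is below 1
(`exists_algBound_pow`). The sharp rate for d = 1 comes from a second-order difference inequality
(`decay_of_convolution_bound`). Lattice sums over shells (`card_shell_le`) and the Schur test
convert entry decay into the rates g(J). -/

theorem freqNorm_eq_norm {d : ℕ} (k : Freq d) :
    freqNorm k = ‖(WithLp.toLp 2 (fun j => (k j : ℝ)) : EuclideanSpace ℝ (Fin d))‖ := by
  simp [freqNorm, EuclideanSpace.norm_eq]

theorem freqNorm_nonneg {d : ℕ} (k : Freq d) : 0 ≤ freqNorm k := Real.sqrt_nonneg _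

theorem freqNorm_add_le {d : ℕ} (k l : Freq d) : freqNorm (k + l) ≤ freqNorm k + freqNorm l := by
  simp only [freqNorm_eq_norm]
  refine le_trans (le_of_eq ?_) (norm_add_le _ _)
  congr 1
  ext j
  simp

@[simp]
theorem freqNorm_zero {d : ℕ} : freqNorm (0 : Freq d) = 0 := by
  simp [freqNorm]

theorem freqNorm_sub_le {d : ℕ} (k m l : Freq d) :
    freqNorm (k - l) ≤ freqNorm (k - m) + freqNorm (m - l) := by
  have := freqNorm_add_le (k - m) (m - l)
  rwa [sub_add_sub_cancel] at this

theorem freqNorm_sq {d : ℕ} (k : Freq d) : freqNorm k ^ 2 = ((∑ j, k j ^ 2 : ℤ) : ℝ) := by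
  rw [freqNorm, Real.sq_sqrt (Finset.sum_nonneg fun j _ => sq_nonneg _)]
  push_cast
  rfl

theorem abs_le_freqNorm {d : ℕ} (k : Freq d) (j : Fin d) : |(k j : ℝ)| ≤ freqNorm k := by
  rw [freqNorm]
  refine Real.abs_le_sqrt ?_
  exact Finset.single_le_sum (f := fun j => (k j : ℝ) ^ 2) (fun i _ => sq_nonneg _)
    (Finset.mem_univ j)

theorem eq_zero_of_freqNorm_eq_zero {d : ℕ} {k : Freq d} (h : freqNorm k = 0) : k = 0 := by
  ext j
  have := abs_le_freqNorm k j
  rw [h] at this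
  have h1 : |(k j : ℝ)| = 0 := le_antisymm this (abs_nonneg _)
  simpa using h1

/-- The lattice points of the cube of half side `N`. -/
def cube (d N : ℕ) : Finset (Freq d) := Fintype.piFinset fun _ => Finset.Icc (-(N : ℤ)) N

theorem card_cube (d N : ℕ) : (cube d N).card = (2 * N + 1) ^ d := by
  rw [cube, Fintype.card_piFinset]
  simp only [Int.card_Icc, Finset.prod_const, Finset.card_univ, Fintype.card_fin]
  congr 1
  omega

theorem mem_cube_of_freqNorm_le {d N : ℕ} {k : Freq d} (h : freqNorm k ≤ N) : k ∈ cube d N := by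
  rw [cube, Fintype.mem_piFinset]
  intro j
  have := (abs_le_freqNorm k j).trans h
  rw [abs_le] at this
  rw [Finset.mem_Icc]
  exact ⟨by exact_mod_cast this.1, by exact_mod_cast this.2⟩

theorem finite_ball {d : ℕ} (R : ℝ) : {k : Freq d | freqNorm k ≤ R}.Finite := by
  obtain ⟨N, hN⟩ := exists_nat_ge R
  exact (cube d N).finite_toSet.subset fun k hk => mem_cube_of_freqNorm_le (le_trans hk hN)

/-- Points in a spherical shell with a large `j`-th coordinate are determined by the sign and the
residue mod `d` of that coordinate and by the other coordinates. -/
theorem card_shell_le {d : ℕ} (hd : 1 ≤ d) (n : ℕ) (s : Finset (Freq d))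
    (hs : ∀ k ∈ s, (n : ℝ) < freqNorm k ∧ freqNorm k ≤ n + 1) :
    (s.card : ℝ) ≤ 2 * d ^ 2 * 3 ^ (d - 1) * ((n : ℝ) + 1) ^ (d - 1) := by
  classical
  have hdpos : (0 : ℤ) < d := by exact_mod_cast hd
  have hsq : ∀ k ∈ s, (n : ℤ) ^ 2 + 1 ≤ ∑ j, k j ^ 2 ∧ ∑ j, k j ^ 2 ≤ ((n : ℤ) + 1) ^ 2 := by
    intro k hk
    obtain ⟨h1, h2⟩ := hs k hk
    have e := freqNorm_sq k
    constructor
    · have : (n : ℝ) ^ 2 < freqNorm k ^ 2 := by gcongr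
      rw [e] at this
      have : (n : ℤ) ^ 2 < ∑ j, k j ^ 2 := by exact_mod_cast this
      omega
    · have : freqNorm k ^ 2 ≤ ((n : ℝ) + 1) ^ 2 := by
        gcongr
        exact freqNorm_nonneg k
      rw [e] at this
      exact_mod_cast this
  have hmax : ∀ k : Freq d, ∃ j, ∀ i, k i ^ 2 ≤ k j ^ 2 := by
    intro k
    have : Nonempty (Fin d) := ⟨⟨0, hd⟩⟩
    obtain ⟨j, hj⟩ := Finite.exists_max fun i => k i ^ 2
    exact ⟨j, hj⟩
  choose J hJ using hmax
  -- The largest coordinate carries at least a fraction 1/d of |k|² > n². This lower bound is what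
  -- separates two candidates for that coordinate below.
  have hbig : ∀ k ∈ s, (n : ℤ) + 1 ≤ d * |k (J k)| := by
    intro k hk
    have h1 : ∑ j, k j ^ 2 ≤ d * k (J k) ^ 2 := by
      have := Finset.sum_le_card_nsmul Finset.univ (fun j => k j ^ 2) _ fun i _ => hJ k i
      simpa using this
    have h2 := (hsq k hk).1
    by_contra hlt
    push Not at hlt
    have h3 : (d : ℤ) * |k (J k)| ≤ n := by omega
    have h4 : ((d : ℤ) * |k (J k)|) ^ 2 ≤ n ^ 2 := by gcongr
    rw [mul_pow, sq_abs] at h4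
    have hd1 : (1 : ℤ) ≤ d := hdpos
    nlinarith [sq_nonneg (k (J k))]
  let T : Finset ((_ : Fin d) × Bool × ℤ × Freq d) :=
    Finset.univ.sigma fun j => Finset.univ ×ˢ (Finset.Ico 0 (d : ℤ) ×ˢ
      Fintype.piFinset fun i => if i = j then {0} else Finset.Icc (-((n : ℤ) + 1)) (n + 1))
  have hcoord : ∀ k ∈ s, ∀ i, k i ∈ Finset.Icc (-((n : ℤ) + 1)) (n + 1) := by
    intro k hk i
    have h1 := (hsq k hk).2
    have h2 : k i ^ 2 ≤ ∑ j, k j ^ 2 :=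
      Finset.single_le_sum (f := fun j => k j ^ 2) (fun i _ => sq_nonneg _) (Finset.mem_univ i)
    have h3 := abs_le_of_sq_le_sq (h2.trans h1) (by positivity)
    rw [Finset.mem_Icc]
    exact abs_le.1 h3
  have hT : s.card ≤ T.card := by
    refine Finset.card_le_card_of_injOn
      (fun k => ⟨J k, decide (0 < k (J k)), k (J k) % d, Function.update k (J k) 0⟩) ?_ ?_
    · intro k hk
      simp only [T, Finset.coe_sigma, Finset.mem_coe, Finset.mem_univ, true_and,
        Finset.mem_product, Finset.mem_Ico, Fintype.mem_piFinset, Set.mem_sigma_iff]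
      refine ⟨⟨Int.emod_nonneg _ hdpos.ne', Int.emod_lt_of_pos _ hdpos⟩, fun i => ?_⟩
      by_cases hi : i = J k
      · simp [hi]
      · simpa [hi] using hcoord k hk i
    · intro k hk k' hk' heq
      have hk := Finset.mem_coe.1 hk
      have hk' := Finset.mem_coe.1 hk'
      simp only [Sigma.mk.injEq, heq_eq_eq, Prod.mk.injEq] at heq
      obtain ⟨e1, e2, e3, e4⟩ := heq
      rw [← e1] at e2 e3 e4
      have hb := hbig k hk
      have hb' := hbig k' hk'
      rw [← e1] at hb'
      have hother : ∀ i, i ≠ J k → k i = k' i := by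
        intro i hi
        have := congrFun e4 i
        simpa [hi] using this
      have hsum : ∀ q : Freq d, ∑ j, q j ^ 2 = q (J k) ^ 2 +
          ∑ j ∈ Finset.univ.erase (J k), q j ^ 2 := fun q =>
        (Finset.add_sum_erase _ _ (Finset.mem_univ _)).symm
      have hsame : ∑ j ∈ Finset.univ.erase (J k), k j ^ 2 =
          ∑ j ∈ Finset.univ.erase (J k), k' j ^ 2 :=
        Finset.sum_congr rfl fun j hj => by rw [hother j (Finset.ne_of_mem_erase hj)]
      have a1 := hsq k hk
      have a2 := hsq k' hk'
      rw [hsum] at a1 a2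
      rw [hsame] at a1
      -- With the other coordinates equal, the squares of the large coordinates differ by at most
      -- (n+1)² - (n²+1) = 2n. If the coordinates were distinct, of the same sign and congruent mod
      -- d, the squares would differ by at least d · 2(n+1)/d > 2n.
      have hdvd : (d : ℤ) ∣ k (J k) - k' (J k) :=
        Int.dvd_of_emod_eq_zero (Int.emod_eq_emod_iff_emod_sub_eq_zero.1 e3)
      have hjj : k (J k) = k' (J k) := by
        obtain ⟨c, hc⟩ := hdvd
        have hc0 : c = 0 := by
          by_contra hc0
          have hcabs : 1 ≤ |c| := Int.one_le_abs hc0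
          have hsgn : (0 < k (J k)) ↔ (0 < k' (J k)) := by simpa using e2
          have habs : |k (J k) ^ 2 - k' (J k) ^ 2| ≤ 2 * n := by
            rw [abs_le]; constructor <;> nlinarith
          have hfac : |k (J k) ^ 2 - k' (J k) ^ 2| =
              |k (J k) - k' (J k)| * (|k (J k)| + |k' (J k)|) := by
            have : |k (J k)| + |k' (J k)| = |k (J k) + k' (J k)| := by
              by_cases h0 : 0 < k (J k)
              · have h1 := hsgn.1 h0
                rw [abs_of_pos h0, abs_of_pos h1, abs_of_pos (by omega)]
              · have h1 : ¬ 0 < k' (J k) := fun h => h0 (hsgn.2 h)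
                rw [abs_of_nonpos (by omega), abs_of_nonpos (by omega),
                  abs_of_nonpos (by omega)]
                ring
            rw [this, ← abs_mul]
            congr 1
            ring
          rw [hfac, hc, abs_mul, abs_of_pos hdpos] at habs
          nlinarith [abs_nonneg (k (J k)), abs_nonneg (k' (J k))]
        rw [hc0] at hc
        omega
      ext i
      by_cases hi : i = J k
      · rw [hi, hjj]
      · exact hother i hi
  have hTcard : T.card = 2 * d ^ 2 * (2 * n + 3) ^ (d - 1) := by
    simp only [T, Finset.card_sigma, Finset.card_product, Fintype.card_piFinset]
    have : ∀ j : Fin d, ∏ i : Fin d,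
        (if i = j then ({0} : Finset ℤ) else Finset.Icc (-((n : ℤ) + 1)) (n + 1)).card =
          (2 * n + 3) ^ (d - 1) := by
      intro j
      rw [← Finset.mul_prod_erase _ _ (Finset.mem_univ j)]
      rw [Finset.prod_congr rfl (g := fun _ => 2 * n + 3)]
      · simp
      · intro i hi
        rw [if_neg (Finset.ne_of_mem_erase hi), Int.card_Icc]
        omega
    simp only [this, Finset.sum_const, Finset.card_univ, Fintype.card_fin, Fintype.card_bool,
      Int.card_Ico]
    simp
    ring
  have h1 : (s.card : ℝ) ≤ 2 * d ^ 2 * (2 * n + 3) ^ (d - 1) := by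
    rw [hTcard] at hT
    exact_mod_cast hT
  refine h1.trans ?_
  rw [mul_assoc (2 * (d : ℝ) ^ 2), ← mul_pow]
  gcongr
  linarith

/-- Sums over the lattice points outside of a ball, by spherical shells. -/
theorem sum_tail_le {d : ℕ} (hd : 1 ≤ d) (F : Freq d → ℝ) (φ : ℕ → ℝ) (hφ : ∀ n, 0 ≤ φ n)
    (hF : ∀ (n : ℕ) k, (n : ℝ) < freqNorm k → F k ≤ φ n) (J : ℕ) (S : ℝ)
    (hS : ∀ N, ∑ i ∈ Finset.range N, ((J + i : ℕ) + 1 : ℝ) ^ (d - 1) * φ (J + i) ≤ S)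
    (s : Finset (Freq d)) (hs : ∀ k ∈ s, (J : ℝ) < freqNorm k) :
    ∑ k ∈ s, F k ≤ 2 * d ^ 2 * 3 ^ (d - 1) * S := by
  classical
  -- Shells are open inside and closed outside, so the ceiling minus one is the inner radius. The
  -- subtraction does not truncate, since |k| > J.
  let g : Freq d → ℕ := fun k => ⌈freqNorm k⌉₊ - 1 - J
  have hg : ∀ k ∈ s, ((J + g k : ℕ) : ℝ) < freqNorm k ∧ freqNorm k ≤ ((J + g k : ℕ) : ℝ) + 1 := by
    intro k hk
    have h0 := hs k hk
    have h1 : J < ⌈freqNorm k⌉₊ := Nat.lt_ceil.2 h0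
    have e : J + g k + 1 = ⌈freqNorm k⌉₊ := by simp only [g]; omega
    constructor
    · exact Nat.lt_ceil.1 (by omega)
    · have : freqNorm k ≤ ((J + g k + 1 : ℕ) : ℝ) := by rw [e]; exact Nat.le_ceil _
      simpa using this
  obtain ⟨N, hN⟩ : ∃ N, ∀ k ∈ s, g k < N := by
    refine ⟨s.sup g + 1, fun k hk => ?_⟩
    exact Nat.lt_succ_of_le (Finset.le_sup hk)
  rw [← Finset.sum_fiberwise_of_maps_to (t := Finset.range N) (g := g)
    (fun k hk => Finset.mem_range.2 (hN k hk))]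
  refine le_trans ?_ (mul_le_mul_of_nonneg_left (hS N) (by positivity))
  rw [Finset.mul_sum]
  refine Finset.sum_le_sum fun i _ => ?_
  have hc := card_shell_le hd (J + i) (s.filter fun k => g k = i) (by
    intro k hk
    rw [Finset.mem_filter] at hk
    have := hg k hk.1
    rwa [hk.2] at this)
  have h2 : ∑ k ∈ s with g k = i, F k ≤ (s.filter fun k => g k = i).card • φ (J + i) := by
    refine Finset.sum_le_card_nsmul _ _ _ fun k hk => ?_
    rw [Finset.mem_filter] at hk
    have := hg k hk.1
    rw [hk.2] at this
    exact hF _ _ this.1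
  refine h2.trans ?_
  rw [nsmul_eq_mul, ← mul_assoc]
  exact mul_le_mul_of_nonneg_right hc (hφ _)

/-- A discrete form of comparing the sum with the integral of x^{-p-1}: the right side telescopes.
It follows from exp y ≥ 1 + y and log y ≤ y - 1. -/
theorem rpow_neg_sub_rpow_neg {p x : ℝ} (hp : 0 < p) (hx : 0 < x) :
    p * (x + 1) ^ (-p - 1) ≤ x ^ (-p) - (x + 1) ^ (-p) := by
  have hx1 : 0 < x + 1 := by linarith
  have h1 : 1 + p / (x + 1) ≤ (x / (x + 1)) ^ (-p) := by
    have h0 : 0 < x / (x + 1) := by positivity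
    rw [Real.rpow_def_of_pos h0]
    have h2 := Real.log_le_sub_one_of_pos h0
    have h3 := Real.add_one_le_exp (Real.log (x / (x + 1)) * -p)
    have h4 : x / (x + 1) = 1 - 1 / (x + 1) := by field_simp; ring
    have h5 : p / (x + 1) = p * (1 / (x + 1)) := by ring
    rw [h4] at h2 h3 ⊢
    rw [h5]
    nlinarith
  have h2 : x ^ (-p) = (x / (x + 1)) ^ (-p) * (x + 1) ^ (-p) := by
    rw [← Real.mul_rpow (by positivity) hx1.le, div_mul_cancel₀ _ hx1.ne']
  rw [h2, Real.rpow_sub_one hx1.ne']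
  have h3 : 0 < (x + 1) ^ (-p) := Real.rpow_pos_of_pos hx1 _
  have h4 := mul_le_mul_of_nonneg_right h1 h3.le
  have : p * ((x + 1) ^ (-p) / (x + 1)) = p / (x + 1) * (x + 1) ^ (-p) := by ring
  rw [this]
  linarith

theorem sum_rpow_tail_le {p : ℝ} (hp : 0 < p) (J N : ℕ) :
    ∑ i ∈ Finset.range N, ((J + i : ℕ) + 1 : ℝ) ^ (-p - 1) ≤
      (1 + 1 / p) * ((J : ℝ) + 1) ^ (-p) := by
  -- The subtracted remainder makes the induction telescope. In the constant 1 + 1/p the 1 pays for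
  -- the first term, the 1/p for all the later ones.
  have key : ∀ N, ∑ i ∈ Finset.range (N + 1), ((J + i : ℕ) + 1 : ℝ) ^ (-p - 1) ≤
      (1 + 1 / p) * ((J : ℝ) + 1) ^ (-p) - 1 / p * ((J + N : ℕ) + 1 : ℝ) ^ (-p) := by
    intro N
    induction N with
    | zero =>
      simp only [zero_add, Finset.range_one, Finset.sum_singleton, add_zero]
      have : ((J : ℝ) + 1) ^ (-p - 1) ≤ ((J : ℝ) + 1) ^ (-p) := by
        apply Real.rpow_le_rpow_of_exponent_le
        · linarith [Nat.cast_nonneg (α := ℝ) J]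
        · linarith
      linarith
    | succ N ih =>
      rw [Finset.sum_range_succ]
      have h := rpow_neg_sub_rpow_neg hp (x := ((J + N : ℕ) : ℝ) + 1) (by positivity)
      have e : ((J + (N + 1) : ℕ) : ℝ) = ((J + N : ℕ) : ℝ) + 1 := by push_cast; ring
      rw [e]
      have h' : (((J + N : ℕ) : ℝ) + 1 + 1) ^ (-p - 1) ≤
          1 / p * ((((J + N : ℕ) : ℝ) + 1) ^ (-p) - (((J + N : ℕ) : ℝ) + 1 + 1) ^ (-p)) := by
        rw [one_div, ← div_eq_inv_mul, le_div_iff₀ hp]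
        linarith
      linarith
  have hpos : ∀ N : ℕ, 0 ≤ 1 / p * ((J + N : ℕ) + 1 : ℝ) ^ (-p) := fun N => by positivity
  cases N with
  | zero => simp; positivity
  | succ N => linarith [key N, hpos N]

theorem exists_sum_alg_tail {d : ℕ} (hd : 1 ≤ d) {η : ℝ} (hη : (d : ℝ) < η) :
    ∃ C > 0, ∀ (J : ℕ) (s : Finset (Freq d)), (∀ k ∈ s, (J : ℝ) < freqNorm k) →
      ∑ k ∈ s, (1 + freqNorm k) ^ (-η) ≤ C * algRate d η J := by
  have hp : 0 < η - d := by linarith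
  have hd0 : (0 : ℝ) < d := by exact_mod_cast hd
  refine ⟨2 * d ^ 2 * 3 ^ (d - 1) * (1 + 1 / (η - d)), by positivity, fun J s hs => ?_⟩
  rw [algRate, mul_assoc]
  refine sum_tail_le hd _ (fun n => ((n : ℝ) + 1) ^ (-η)) (fun n => by positivity) ?_ J _ ?_ s hs
  · intro n k hk
    refine Real.rpow_le_rpow_of_nonpos (by positivity) (by linarith) (by linarith)
  · intro N
    refine le_trans (le_of_eq ?_) (sum_rpow_tail_le hp J N)
    refine Finset.sum_congr rfl fun i _ => ?_
    rw [← Real.rpow_natCast, ← Real.rpow_add (by positivity), Nat.cast_sub hd]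
    congr 1
    push_cast
    ring

theorem exists_sum_alg {d : ℕ} (hd : 1 ≤ d) {η : ℝ} (hη : (d : ℝ) < η) :
    ∃ C > 0, ∀ s : Finset (Freq d), ∑ k ∈ s, (1 + freqNorm k) ^ (-η) ≤ C := by
  classical
  obtain ⟨C, hC, h⟩ := exists_sum_alg_tail hd hη
  refine ⟨C + 1, by positivity, fun s => ?_⟩
  rw [← Finset.sum_filter_add_sum_filter_not s fun k => (0 : ℝ) < freqNorm k]
  refine add_le_add ?_ ?_
  · have := h 0 (s.filter fun k => (0 : ℝ) < freqNorm k) (fun k hk => by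
      simpa using (Finset.mem_filter.1 hk).2)
    simpa [algRate] using this
  · have hsub : s.filter (fun k => ¬ (0 : ℝ) < freqNorm k) ⊆ {0} := by
      intro k hk
      have := (Finset.mem_filter.1 hk).2
      rw [Finset.mem_singleton]
      exact eq_zero_of_freqNorm_eq_zero (le_antisymm (not_lt.1 this) (freqNorm_nonneg k))
    refine (Finset.sum_le_sum_of_subset_of_nonneg hsub fun k _ _ =>
      Real.rpow_nonneg (by linarith [freqNorm_nonneg k]) _).trans ?_
    simp

theorem summable_expRate (d : ℕ) {η : ℝ} (hη : 0 < η) : Summable (expRate d η) := by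
  have h1 : ‖Real.exp (-η)‖ < 1 := by
    rw [Real.norm_eq_abs, Real.abs_exp, Real.exp_lt_one_iff]
    linarith
  have h2 : Summable fun n : ℕ => (n : ℝ) ^ (d - 1) * Real.exp (-η) ^ n :=
    summable_pow_mul_geometric_of_norm_lt_one (d - 1) h1
  have h3 : Summable fun n : ℕ => ((n + 1 : ℕ) : ℝ) ^ (d - 1) * Real.exp (-η) ^ (n + 1) :=
    h2.comp_injective (add_left_injective 1)
  have h4 : expRate d η = fun n : ℕ =>
      Real.exp η * (((n + 1 : ℕ) : ℝ) ^ (d - 1) * Real.exp (-η) ^ (n + 1)) := by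
    funext i
    have : Real.exp (-η * i) = Real.exp η * Real.exp ((i + 1 : ℕ) * -η) := by
      rw [← Real.exp_add]; congr 1; push_cast; ring
    rw [expRate, ← Real.exp_nat_mul, this]
    push_cast
    ring
  rw [h4]
  exact h3.mul_left _

theorem exists_sum_exp_tail {d : ℕ} (hd : 1 ≤ d) {η : ℝ} (hη : 0 < η) :
    ∃ C > 0, ∀ (J : ℕ) (s : Finset (Freq d)), (∀ k ∈ s, (J : ℝ) < freqNorm k) →
      ∑ k ∈ s, Real.exp (-η * freqNorm k) ≤ C * expRate d η J := by
  have hsum : Summable fun i : ℕ => ((i : ℝ) + 1) ^ (d - 1) * Real.exp (-η * i) :=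
    summable_expRate d hη
  have hd0 : (0 : ℝ) < d := by exact_mod_cast hd
  have hS : 0 ≤ ∑' i : ℕ, ((i : ℝ) + 1) ^ (d - 1) * Real.exp (-η * i) :=
    tsum_nonneg fun i => by positivity
  refine ⟨2 * d ^ 2 * 3 ^ (d - 1) *
    (∑' i : ℕ, ((i : ℝ) + 1) ^ (d - 1) * Real.exp (-η * i) + 1), by positivity,
    fun J s hs => ?_⟩
  rw [mul_assoc]
  refine sum_tail_le hd _ (fun n => Real.exp (-η * n)) (fun n => by positivity) ?_ J _ ?_ s hs
  · intro n k hk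
    refine Real.exp_le_exp.2 ?_
    nlinarith
  · intro N
    have hle : ∑ i ∈ Finset.range N, ((i : ℝ) + 1) ^ (d - 1) * Real.exp (-η * i) ≤
        ∑' i : ℕ, ((i : ℝ) + 1) ^ (d - 1) * Real.exp (-η * i) + 1 := by
      have := hsum.sum_le_tsum (Finset.range N) fun i _ => by positivity
      linarith
    refine le_trans ?_ (mul_le_mul_of_nonneg_right hle (?_ : 0 ≤ expRate d η J))
    · rw [Finset.sum_mul]
      refine Finset.sum_le_sum fun i _ => ?_
      have e : Real.exp (-η * (J + i : ℕ)) = Real.exp (-η * i) * Real.exp (-η * J) := by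
        rw [← Real.exp_add]; congr 1; push_cast; ring
      -- From J + i + 1 ≤ (i+1)(J+1) the polynomial factor splits, so the tail is the rate at J
      -- times a full convergent series.
      have h1 : ((J + i : ℕ) + 1 : ℝ) ^ (d - 1) ≤
          ((i : ℝ) + 1) ^ (d - 1) * ((J : ℝ) + 1) ^ (d - 1) := by
        rw [← mul_pow]
        gcongr
        push_cast
        nlinarith [mul_nonneg (Nat.cast_nonneg (α := ℝ) i) (Nat.cast_nonneg (α := ℝ) J)]
      rw [e, expRate]
      calc _ ≤ ((i : ℝ) + 1) ^ (d - 1) * ((J : ℝ) + 1) ^ (d - 1) *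
          (Real.exp (-η * i) * Real.exp (-η * J)) := by gcongr
        _ = _ := by ring
    · rw [expRate]; positivity

theorem exists_sum_exp {d : ℕ} (hd : 1 ≤ d) {η : ℝ} (hη : 0 < η) :
    ∃ C > 0, ∀ s : Finset (Freq d), ∑ k ∈ s, Real.exp (-η * freqNorm k) ≤ C := by
  classical
  obtain ⟨C, hC, h⟩ := exists_sum_exp_tail hd hη
  refine ⟨C + 1, by positivity, fun s => ?_⟩
  rw [← Finset.sum_filter_add_sum_filter_not s fun k => (0 : ℝ) < freqNorm k]
  refine add_le_add ?_ ?_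
  · have := h 0 (s.filter fun k => (0 : ℝ) < freqNorm k) (fun k hk => by
      simpa using (Finset.mem_filter.1 hk).2)
    simpa [expRate] using this
  · have hsub : s.filter (fun k => ¬ (0 : ℝ) < freqNorm k) ⊆ {0} := by
      intro k hk
      have := (Finset.mem_filter.1 hk).2
      rw [Finset.mem_singleton]
      exact eq_zero_of_freqNorm_eq_zero (le_antisymm (not_lt.1 this) (freqNorm_nonneg k))
    refine (Finset.sum_le_sum_of_subset_of_nonneg hsub fun k _ _ => (Real.exp_pos _).le).trans ?_
    simp

theorem tendsto_algRate {d : ℕ} {η : ℝ} (hη : (d : ℝ) < η) :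
    Tendsto (algRate d η) atTop (𝓝 0) := by
  have h1 : Tendsto (fun J : ℕ => (J : ℝ) + 1) atTop atTop :=
    tendsto_atTop_add_const_right _ _ tendsto_natCast_atTop_atTop
  exact (tendsto_rpow_neg_atTop (by linarith : 0 < η - d)).comp h1

end AFG

end

noncomputable section

namespace AFG

/-! ### Matrices of bounded operators on `ℓ²` -/

variable {d : ℕ}

/-- The entries of the matrix of a bounded operator on `ℓ²(ℤ^d)`. -/
def ent (T : Ell2 d →L[ℂ] Ell2 d) : BiMatrix d := fun l k => T (lp.single 2 k 1) l

theorem represents_iff {T : Ell2 d →L[ℂ] Ell2 d} {M : BiMatrix d} :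
    Represents T M ↔ ent T = M :=
  ⟨fun h => funext fun l => funext fun k => h l k, fun h l k => congrFun (congrFun h l) k⟩

theorem represents_ent (T : Ell2 d →L[ℂ] Ell2 d) : Represents T (ent T) := fun _ _ => rfl

theorem apply_eq_inner (x : Ell2 d) (l : Freq d) :
    x l = inner ℂ (lp.single 2 l (1 : ℂ) : Ell2 d) x := by
  rw [lp.inner_single_left]
  simp

theorem norm_coord_le (x : Ell2 d) (l : Freq d) : ‖x l‖ ≤ ‖x‖ :=
  lp.norm_apply_le_norm (by norm_num) x l

theorem norm_single_one (k : Freq d) : ‖(lp.single 2 k (1 : ℂ) : Ell2 d)‖ = 1 := by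
  rw [lp.norm_single (by norm_num)]
  simp

theorem hasSum_norm_sq (x : Ell2 d) : HasSum (fun k => ‖x k‖ ^ 2) (‖x‖ ^ 2) := by
  have := lp.hasSum_norm (p := 2) (by norm_num) x
  simpa using this

theorem norm_ent_le (T : Ell2 d →L[ℂ] Ell2 d) (l k : Freq d) : ‖ent T l k‖ ≤ ‖T‖ := by
  refine (norm_coord_le _ l).trans ((T.le_opNorm _).trans ?_)
  rw [norm_single_one, mul_one]

theorem hasSum_ent_mul (T : Ell2 d →L[ℂ] Ell2 d) (x : Ell2 d) (l : Freq d) :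
    HasSum (fun k => ent T l k * x k) (T x l) := by
  have h1 := lp.hasSum_single (p := 2) (by norm_num) x
  have h2 := ((innerSL ℂ (lp.single 2 l (1 : ℂ) : Ell2 d)).comp T).hasSum h1
  rw [apply_eq_inner]
  have h3 : ∀ k, ((innerSL ℂ (lp.single 2 l (1 : ℂ) : Ell2 d)).comp T) (lp.single 2 k (x k)) =
      ent T l k * x k := by
    intro k
    have h4 : (lp.single 2 k (x k) : Ell2 d) = x k • lp.single 2 k (1 : ℂ) := by
      rw [← lp.single_smul, smul_eq_mul, mul_one]
    rw [ContinuousLinearMap.comp_apply, innerSL_apply_apply, ← apply_eq_inner, h4, map_smul,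
      lp.coeFn_smul, Pi.smul_apply, smul_eq_mul, mul_comm]
    rfl
  simp only [h3] at h2
  exact h2

theorem ent_one (l k : Freq d) : ent (1 : Ell2 d →L[ℂ] Ell2 d) l k = if l = k then 1 else 0 := by
  simp [ent, Pi.single_apply]

theorem ent_add (S T : Ell2 d →L[ℂ] Ell2 d) (l k : Freq d) :
    ent (S + T) l k = ent S l k + ent T l k := by
  simp [ent]

theorem ent_sub (S T : Ell2 d →L[ℂ] Ell2 d) (l k : Freq d) :
    ent (S - T) l k = ent S l k - ent T l k := by
  simp [ent]

theorem ent_smul (c : ℂ) (T : Ell2 d →L[ℂ] Ell2 d) (l k : Freq d) :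
    ent (c • T) l k = c * ent T l k := by
  simp [ent]

theorem ent_sum {ι : Type*} (s : Finset ι) (T : ι → Ell2 d →L[ℂ] Ell2 d) (l k : Freq d) :
    ent (∑ i ∈ s, T i) l k = ∑ i ∈ s, ent (T i) l k := by
  classical
  induction s using Finset.induction_on with
  | empty => simp [ent]
  | insert i s hi ih => rw [Finset.sum_insert hi, Finset.sum_insert hi, ent_add, ih]

theorem hasSum_ent_comp (S T : Ell2 d →L[ℂ] Ell2 d) (l k : Freq d) :
    HasSum (fun m => ent S l m * ent T m k) (ent (S * T) l k) :=
  hasSum_ent_mul S (T (lp.single 2 k 1)) l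

theorem ent_injective : Function.Injective (ent (d := d)) := by
  intro S T h
  ext x l
  have h1 := hasSum_ent_mul S x l
  rw [h] at h1
  exact h1.unique (hasSum_ent_mul T x l)

/-- A bound on absolutely convergent sums, from bounds on the terms. -/
theorem norm_le_of_hasSum_of_sum_le {ι : Type*} {f : ι → ℂ} {a : ℂ} {g : ι → ℝ} {C : ℝ}
    (hf : HasSum f a) (hfg : ∀ i, ‖f i‖ ≤ g i) (hg : ∀ s : Finset ι, ∑ i ∈ s, g i ≤ C) :
    ‖a‖ ≤ C := by
  refine le_of_tendsto hf.norm (Eventually.of_forall fun s => ?_)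
  exact (norm_sum_le_of_le s fun i _ => hfg i).trans (hg s)

/-- The Schur test. -/
theorem exists_represents_of_schur (M : BiMatrix d) {s : ℝ} (hs : 0 ≤ s)
    (hrow : ∀ l (F : Finset (Freq d)), ∑ k ∈ F, ‖M l k‖ ≤ s)
    (hcol : ∀ k (F : Finset (Freq d)), ∑ l ∈ F, ‖M l k‖ ≤ s) :
    ∃ T : Ell2 d →L[ℂ] Ell2 d, Represents T M ∧ ‖T‖ ≤ s := by
  have hsum : ∀ (x : Ell2 d) l, Summable fun k => M l k * x k := by
    intro x l
    have h1 : Summable fun k => ‖M l k‖ :=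
      summable_of_sum_le (fun _ => norm_nonneg _) (hrow l)
    refine Summable.of_norm_bounded (h1.mul_right ‖x‖) fun k => ?_
    rw [norm_mul]
    gcongr
    exact norm_coord_le x k
  have hfin : ∀ (x : Ell2 d) (F : Finset (Freq d)),
      ∑ l ∈ F, ‖∑' k, M l k * x k‖ ^ 2 ≤ (s * ‖x‖) ^ 2 := by
    intro x F
    -- The estimate is made for finitely many rows and columns, where sums can be exchanged freely,
    -- and then passed to the limit in the columns.
    have hlim : Tendsto (fun K : Finset (Freq d) => ∑ l ∈ F, ‖∑ k ∈ K, M l k * x k‖ ^ 2) atTop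
        (𝓝 (∑ l ∈ F, ‖∑' k, M l k * x k‖ ^ 2)) :=
      tendsto_finsetSum _ fun l _ => ((hsum x l).hasSum.norm).pow 2
    refine le_of_tendsto hlim (Eventually.of_forall fun K => ?_)
    have h1 : ∀ l, ‖∑ k ∈ K, M l k * x k‖ ^ 2 ≤ s * ∑ k ∈ K, ‖M l k‖ * ‖x k‖ ^ 2 := by
      intro l
      have h2 : ‖∑ k ∈ K, M l k * x k‖ ≤ ∑ k ∈ K, ‖M l k‖ * ‖x k‖ :=
        norm_sum_le_of_le K fun k _ => (norm_mul _ _).le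
      -- Cauchy–Schwarz with weights ‖M l k‖: one factor is controlled by row sums, the other by
      -- column sums after exchanging.
      have h3 : (∑ k ∈ K, ‖M l k‖ * ‖x k‖) ^ 2 ≤
          (∑ k ∈ K, ‖M l k‖) * ∑ k ∈ K, ‖M l k‖ * ‖x k‖ ^ 2 :=
        Finset.sum_sq_le_sum_mul_sum_of_sq_le_mul K (fun _ _ => norm_nonneg _)
          (fun _ _ => by positivity) fun k _ => le_of_eq (by ring)
      calc _ ≤ (∑ k ∈ K, ‖M l k‖ * ‖x k‖) ^ 2 := by gcongr
        _ ≤ _ := h3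
        _ ≤ _ := by
          gcongr
          exact hrow l K
    calc _ ≤ ∑ l ∈ F, s * ∑ k ∈ K, ‖M l k‖ * ‖x k‖ ^ 2 := Finset.sum_le_sum fun l _ => h1 l
      _ = s * ∑ k ∈ K, (∑ l ∈ F, ‖M l k‖) * ‖x k‖ ^ 2 := by
        rw [← Finset.mul_sum, Finset.sum_comm]
        simp only [Finset.sum_mul]
      _ ≤ s * ∑ k ∈ K, s * ‖x k‖ ^ 2 := by
        gcongr with k _
        exact hcol k F
      _ = s * s * ∑ k ∈ K, ‖x k‖ ^ 2 := by rw [← Finset.mul_sum, mul_assoc]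
      _ ≤ s * s * ‖x‖ ^ 2 := by
        gcongr
        exact sum_le_hasSum K (fun i _ => by positivity) (hasSum_norm_sq x)
      _ = _ := by ring
  have hmem : ∀ x : Ell2 d, Memℓp (fun l => ∑' k, M l k * x k) 2 := by
    intro x
    refine memℓp_gen' (C := (s * ‖x‖) ^ 2) fun F => ?_
    simpa using hfin x F
  let T₀ : Ell2 d →ₗ[ℂ] Ell2 d :=
    { toFun := fun x => ⟨_, hmem x⟩
      map_add' := fun x y => by
        ext l
        simp only [lp.coeFn_add, Pi.add_apply, mul_add]
        exact (hsum x l).tsum_add (hsum y l)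
      map_smul' := fun c x => by
        ext l
        simp only [lp.coeFn_smul, Pi.smul_apply, smul_eq_mul, RingHom.id_apply]
        rw [← tsum_mul_left]
        exact tsum_congr fun k => by ring }
  have hbound : ∀ x, ‖T₀ x‖ ≤ s * ‖x‖ := by
    intro x
    refine lp.norm_le_of_forall_sum_le (p := 2) (by norm_num) (by positivity) fun F => ?_
    have : ∀ l, (T₀ x : Freq d → ℂ) l = ∑' k, M l k * x k := fun _ => rfl
    simpa [this] using hfin x F
  refine ⟨T₀.mkContinuous s hbound, fun l k => ?_, T₀.mkContinuous_norm_le hs hbound⟩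
  change ∑' m, M l m * (lp.single 2 k (1 : ℂ) : Ell2 d) m = M l k
  rw [tsum_eq_single k]
  · simp
  · intro m hm
    simp [hm]

theorem norm_pow_mul_le (Q X : Ell2 d →L[ℂ] Ell2 d) (N : ℕ) :
    ‖Q ^ N * X‖ ≤ ‖Q‖ ^ N * ‖X‖ := by
  induction N with
  | zero => simp
  | succ N ih =>
    rw [pow_succ', mul_assoc, pow_succ', mul_assoc]
    exact (norm_mul_le _ _).trans (by gcongr)

/-- The Neumann series, entrywise. -/
theorem norm_ent_le_of_pow {Q X : Ell2 d →L[ℂ] Ell2 d} (hQ : ‖Q‖ < 1) (hX : (1 - Q) * X = 1)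
    {l k : Freq d} {b : ℕ → ℝ} {C : ℝ} (hb : ∀ n, ‖ent (Q ^ n) l k‖ ≤ b n)
    (hC : ∀ N, ∑ n ∈ Finset.range N, b n ≤ C) : ‖ent X l k‖ ≤ C := by
  have key : ∀ N : ℕ, ‖ent X l k‖ ≤ C + ‖Q‖ ^ N * ‖X‖ := by
    intro N
    -- The finite Neumann sum with its exact remainder avoids any convergence statement for the
    -- series in operator norm.
    have h1 : X = ∑ n ∈ Finset.range N, Q ^ n + Q ^ N * X := by
      have h2 := geom_sum_mul_neg Q N
      have h3 : (∑ n ∈ Finset.range N, Q ^ n) * ((1 - Q) * X) = (1 - Q ^ N) * X := by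
        rw [← mul_assoc, h2]
      rw [hX, mul_one, sub_mul, one_mul] at h3
      rw [h3, sub_add_cancel]
    rw [h1, ent_add, ent_sum]
    refine (norm_add_le _ _).trans (add_le_add ?_ ?_)
    · exact (norm_sum_le_of_le _ fun n _ => hb n).trans (hC N)
    · rw [← h1]
      exact (norm_ent_le _ _ _).trans (norm_pow_mul_le _ _ _)
  have hlim : Tendsto (fun N : ℕ => C + ‖Q‖ ^ N * ‖X‖) atTop (𝓝 (C + 0 * ‖X‖)) :=
    ((tendsto_pow_atTop_nhds_zero_of_lt_one (norm_nonneg _) hQ).mul_const _).const_add _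
  have := ge_of_tendsto' hlim key
  simpa using this

end AFG

end

noncomputable section

namespace AFG

/-! ### Inverse closedness of the decay classes -/

/-- Algebraic decay of the entries with rate `η` and constant `a`. -/
def AlgBound {d : ℕ} (η a : ℝ) (M : BiMatrix d) : Prop :=
  ∀ l k, ‖M l k‖ ≤ a * (1 + freqNorm (l - k)) ^ (-η)

theorem one_add_freqNorm_pos {d : ℕ} (k : Freq d) : 0 < 1 + freqNorm k := by
  linarith [freqNorm_nonneg k]

theorem AlgBound.mono {d : ℕ} {η a b : ℝ} {M : BiMatrix d} (h : AlgBound η a M) (hab : a ≤ b) :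
    AlgBound η b M := fun l k =>
  (h l k).trans (mul_le_mul_of_nonneg_right hab (Real.rpow_nonneg (one_add_freqNorm_pos _).le _))

theorem algBound_one {d : ℕ} (η : ℝ) : AlgBound η 1 (ent (1 : Ell2 d →L[ℂ] Ell2 d)) := by
  intro l k
  rw [ent_one, one_mul]
  split_ifs with h
  · simp [h]
  · rw [norm_zero]
    exact Real.rpow_nonneg (one_add_freqNorm_pos _).le _

theorem algWeight_le {η x y : ℝ} (hη : 0 ≤ η) (hx : 0 ≤ x) (hxy : x ≤ 2 * y) :
    (1 + y) ^ (-η) ≤ 2 ^ η * (1 + x) ^ (-η) := by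
  have h1 : (2 * (1 + y)) ^ (-η) ≤ (1 + x) ^ (-η) :=
    Real.rpow_le_rpow_of_nonpos (by linarith) (by linarith) (by linarith)
  rw [Real.mul_rpow (by norm_num) (by linarith), Real.rpow_neg (by norm_num)] at h1
  have h2 : (0 : ℝ) < 2 ^ η := by positivity
  calc (1 + y) ^ (-η) = 2 ^ η * ((2 ^ η)⁻¹ * (1 + y) ^ (-η)) := by field_simp
    _ ≤ _ := by gcongr

/-- For every m, one of |l-m|, |m-k| is at least |l-k|/2, so one of the two factors supplies the
decay and the other is summed. The sums s and t are kept separate from the decay constants because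
for powers of a contraction they are much smaller than those constants suggest. -/
theorem AlgBound.mul {d : ℕ} {η a b s t : ℝ} {S T : Ell2 d →L[ℂ] Ell2 d} (hη : 0 ≤ η)
    (ha : 0 ≤ a) (hb : 0 ≤ b) (hS : AlgBound η a (ent S)) (hT : AlgBound η b (ent T))
    (hrow : ∀ l (F : Finset (Freq d)), ∑ m ∈ F, ‖ent S l m‖ ≤ s)
    (hcol : ∀ k (F : Finset (Freq d)), ∑ m ∈ F, ‖ent T m k‖ ≤ t) :
    AlgBound η (2 ^ η * (a * t + b * s)) (ent (S * T)) := by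
  intro l k
  set w := (1 + freqNorm (l - k)) ^ (-η) with hw
  have hw0 : 0 ≤ w := Real.rpow_nonneg (one_add_freqNorm_pos _).le _
  refine norm_le_of_hasSum_of_sum_le (hasSum_ent_comp S T l k)
    (g := fun m => 2 ^ η * w * (a * ‖ent T m k‖ + b * ‖ent S l m‖)) ?_ ?_
  · intro m
    rw [norm_mul]
    have h2 : (0 : ℝ) < 2 ^ η := by positivity
    rcases le_total (freqNorm (l - k)) (2 * freqNorm (l - m)) with h | h
    · have h1 := (hS l m).trans
        (mul_le_mul_of_nonneg_left (algWeight_le hη (freqNorm_nonneg _) h) ha)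
      calc ‖ent S l m‖ * ‖ent T m k‖ ≤ a * (2 ^ η * w) * ‖ent T m k‖ := by gcongr
        _ = 2 ^ η * w * (a * ‖ent T m k‖ + 0) := by ring
        _ ≤ _ := by gcongr; positivity
    · have h' : freqNorm (l - k) ≤ 2 * freqNorm (m - k) := by
        linarith [freqNorm_sub_le l m k]
      have h1 := (hT m k).trans
        (mul_le_mul_of_nonneg_left (algWeight_le hη (freqNorm_nonneg _) h') hb)
      calc ‖ent S l m‖ * ‖ent T m k‖ ≤ ‖ent S l m‖ * (b * (2 ^ η * w)) := by gcongr
        _ = 2 ^ η * w * (0 + b * ‖ent S l m‖) := by ring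
        _ ≤ _ := by gcongr; positivity
  · intro F
    rw [← Finset.mul_sum, Finset.sum_add_distrib, ← Finset.mul_sum, ← Finset.mul_sum]
    calc _ ≤ 2 ^ η * w * (a * t + b * s) := by
          gcongr
          · exact hcol k F
          · exact hrow l F
      _ = _ := by ring

theorem sum_shift_left {d : ℕ} (f : Freq d → ℝ) (l : Freq d) (F : Finset (Freq d)) :
    ∑ m ∈ F, f (l - m) = ∑ m ∈ F.map (Equiv.subLeft l).toEmbedding, f m := by
  simp

theorem sum_shift_right {d : ℕ} (f : Freq d → ℝ) (k : Freq d) (F : Finset (Freq d)) :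
    ∑ m ∈ F, f (m - k) = ∑ m ∈ F.map (Equiv.subRight k).toEmbedding, f m := by
  simp

/-- Row and column sums of a matrix with decay, in terms of bounds on the sums of the decay
function. -/
theorem rowSum_le {d : ℕ} {M : BiMatrix d} {f : Freq d → ℝ} {s : ℝ}
    (h : ∀ l k, ‖M l k‖ ≤ f (l - k)) (hf : ∀ F : Finset (Freq d), ∑ m ∈ F, f m ≤ s)
    (l : Freq d) (F : Finset (Freq d)) : ∑ m ∈ F, ‖M l m‖ ≤ s :=
  (Finset.sum_le_sum fun m _ => h l m).trans ((sum_shift_left f l F).le.trans (hf _))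

theorem colSum_le {d : ℕ} {M : BiMatrix d} {f : Freq d → ℝ} {s : ℝ}
    (h : ∀ l k, ‖M l k‖ ≤ f (l - k)) (hf : ∀ F : Finset (Freq d), ∑ m ∈ F, f m ≤ s)
    (k : Freq d) (F : Finset (Freq d)) : ∑ m ∈ F, ‖M m k‖ ≤ s :=
  (Finset.sum_le_sum fun m _ => h m k).trans ((sum_shift_right f k F).le.trans (hf _))

/-- Combines the two bounds on the entries: a uniform bound τ (later an operator norm) in the ball
of radius N, the decay outside. The radius is free, to be optimized. -/
theorem sum_min_le {d : ℕ} {η C : ℝ}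
    (hC : ∀ (J : ℕ) (s : Finset (Freq d)), (∀ k ∈ s, (J : ℝ) < freqNorm k) →
      ∑ k ∈ s, (1 + freqNorm k) ^ (-η) ≤ C * algRate d η J)
    {τ a : ℝ} (hτ : 0 ≤ τ) (ha : 0 ≤ a) (N : ℕ) (F : Finset (Freq d)) :
    ∑ m ∈ F, min τ (a * (1 + freqNorm m) ^ (-η)) ≤
      (2 * N + 1) ^ d * τ + a * (C * algRate d η N) := by
  classical
  rw [← Finset.sum_filter_add_sum_filter_not F fun k => freqNorm k ≤ N]
  refine add_le_add ?_ ?_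
  · calc _ ≤ ∑ m ∈ F with freqNorm m ≤ N, τ := Finset.sum_le_sum fun m _ => min_le_left _ _
      _ ≤ ∑ m ∈ cube d N, τ := by
        refine Finset.sum_le_sum_of_subset_of_nonneg (fun m hm => ?_) fun _ _ _ => hτ
        exact mem_cube_of_freqNorm_le (Finset.mem_filter.1 hm).2
      _ = _ := by rw [Finset.sum_const, card_cube, nsmul_eq_mul]; push_cast; rfl
  · calc _ ≤ ∑ m ∈ F with ¬ freqNorm m ≤ N, a * (1 + freqNorm m) ^ (-η) :=
        Finset.sum_le_sum fun m _ => min_le_right _ _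
      _ ≤ _ := by
        rw [← Finset.mul_sum]
        gcongr
        exact hC N _ fun k hk => not_le.1 (Finset.mem_filter.1 hk).2

theorem norm_pow_le_pow {d : ℕ} (Q : Ell2 d →L[ℂ] Ell2 d) (n : ℕ) : ‖Q ^ n‖ ≤ ‖Q‖ ^ n := by
  have h := norm_pow_mul_le Q 1 n
  rw [mul_one] at h
  refine h.trans ?_
  have : ‖(1 : Ell2 d →L[ℂ] Ell2 d)‖ ≤ 1 := ContinuousLinearMap.norm_id_le
  exact mul_le_of_le_one_right (by positivity) this

theorem exists_one_lt_pow_mul_lt (d : ℕ) {r : ℝ} (hr : r < 1) : ∃ x : ℝ, 1 < x ∧ x ^ d * r < 1 := by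
  have hc : Tendsto (fun x : ℝ => x ^ d * r) (𝓝[>] 1) (𝓝 (1 ^ d * r)) :=
    ((continuous_pow d).mul continuous_const).continuousWithinAt
  rw [one_pow, one_mul] at hc
  obtain ⟨x, hx, hx1⟩ := ((hc.eventually_lt_const hr).and self_mem_nhdsWithin).exists
  exact ⟨x, hx1, hx⟩

/-- The powers of a contraction with algebraic off-diagonal decay have decay with geometrically
decreasing constants. -/
theorem exists_algBound_pow {d : ℕ} (hd : 1 ≤ d) {η a : ℝ} (hη : (d : ℝ) < η) (ha : 0 < a)
    {Q : Ell2 d →L[ℂ] Ell2 d} (hQ : ‖Q‖ < 1) (h : AlgBound η a (ent Q)) :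
    ∃ K μ : ℝ, 0 ≤ K ∧ 0 < μ ∧ μ < 1 ∧ ∀ n, AlgBound η (K * μ ^ n) (ent (Q ^ n)) := by
  have hη0 : 0 ≤ η := (Nat.cast_nonneg d).trans hη.le
  obtain ⟨C₀, hC₀, hsum⟩ := exists_sum_alg hd hη
  obtain ⟨C, hC, htail⟩ := exists_sum_alg_tail hd hη
  -- At the n-th power the ball will have radius about xⁿ. Its volume x^{dn} must be beaten by ‖Q‖ⁿ,
  -- while x > 1 makes the tail beyond it decrease like κⁿ.
  obtain ⟨x, hx1, hxq⟩ := exists_one_lt_pow_mul_lt d hQ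
  have hx0 : 0 < x := by linarith
  set κ := x ^ (-(η - d)) with hκ
  have hκ0 : 0 < κ := Real.rpow_pos_of_pos hx0 _
  have hκ1 : κ < 1 := Real.rpow_lt_one_of_one_lt_of_neg hx1 (by linarith)
  -- The square root enters because the gain at n is used for the power 2n: (t²)ⁿ = t^{2n}.
  set t := Real.sqrt (max (x ^ d * ‖Q‖) κ) with ht
  have hmax : 0 < max (x ^ d * ‖Q‖) κ := lt_max_of_lt_right hκ0
  have ht0 : 0 < t := Real.sqrt_pos.2 hmax
  have ht1 : t < 1 := by
    rw [ht, Real.sqrt_lt' one_pos, one_pow]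
    exact max_lt hxq hκ1
  have htsq : t ^ 2 = max (x ^ d * ‖Q‖) κ := Real.sq_sqrt hmax.le
  set Cm := 2 ^ η * (2 * C₀) with hCm
  have hCm0 : 0 < Cm := by positivity
  have hmulQ : ∀ {b : ℝ} {S : Ell2 d →L[ℂ] Ell2 d}, 0 ≤ b → AlgBound η b (ent S) →
      AlgBound η (Cm * a * b) (ent (S * Q)) := by
    intro b S hb hS
    have hs : ∀ c : ℝ, 0 ≤ c → ∀ F : Finset (Freq d),
        ∑ m ∈ F, c * (1 + freqNorm m) ^ (-η) ≤ c * C₀ := by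
      intro c hc F
      rw [← Finset.mul_sum]
      exact mul_le_mul_of_nonneg_left (hsum F) hc
    have := AlgBound.mul hη0 hb ha.le hS h
      (rowSum_le (f := fun m => b * (1 + freqNorm m) ^ (-η)) hS (hs b hb))
      (colSum_le (f := fun m => a * (1 + freqNorm m) ^ (-η)) h (hs a ha.le))
    refine this.mono (le_of_eq ?_)
    rw [hCm]; ring
  have hstart : ∀ n, AlgBound η (1 * max 1 (Cm * a) ^ n) (ent (Q ^ n)) := by
    intro n
    induction n with
    | zero => simpa using algBound_one (d := d) η
    | succ n ih =>
      rw [pow_succ Q]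
      refine (hmulQ (by positivity) ih).mono ?_
      rw [pow_succ, one_mul, one_mul, mul_comm]
      gcongr
      exact le_max_right _ _
  -- Bootstrap: squaring Qⁿ costs μ²ⁿ in the constants, but the row and column sums, mixing operator
  -- norm and decay, save t²ⁿ. The condition 1 ≤ μ lets the ball term, which carries no μ, be
  -- absorbed.
  have hstep : ∀ μ : ℝ, 1 ≤ μ → (∃ K, 0 ≤ K ∧ ∀ n, AlgBound η (K * μ ^ n) (ent (Q ^ n))) →
      ∃ K, 0 ≤ K ∧ ∀ n, AlgBound η (K * (μ * t) ^ n) (ent (Q ^ n)) := by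
    rintro μ hμ ⟨K, hK, hKn⟩
    have hμ0 : 0 < μ := by linarith
    set K₁ := 2 ^ η * (2 * K * (5 ^ d + K * C)) with hK₁
    have hK₁0 : 0 ≤ K₁ := by positivity
    have heven : ∀ n, AlgBound η (K₁ * (μ * t) ^ (2 * n)) (ent (Q ^ (2 * n))) := by
      intro n
      set N := ⌈x ^ n⌉₊ with hN
      have hxn : 1 ≤ x ^ n := one_le_pow₀ hx1.le
      have hcount : (2 * (N : ℝ) + 1) ^ d * ‖Q ^ n‖ ≤ 5 ^ d * (t ^ 2) ^ n := by
        have h1 : (N : ℝ) < x ^ n + 1 := Nat.ceil_lt_add_one (by positivity)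
        calc (2 * (N : ℝ) + 1) ^ d * ‖Q ^ n‖ ≤ (5 * x ^ n) ^ d * ‖Q‖ ^ n := by
              gcongr
              · linarith
              · exact norm_pow_le_pow Q n
          _ = 5 ^ d * (x ^ d * ‖Q‖) ^ n := by ring
          _ ≤ _ := by
            rw [htsq]
            gcongr
            exact le_max_left _ _
      have hrate : algRate d η N ≤ (t ^ 2) ^ n := by
        have h1 : x ^ n ≤ (N : ℝ) + 1 := (Nat.le_ceil _).trans (by linarith)
        calc algRate d η N ≤ (x ^ n) ^ (-(η - d)) :=
              Real.rpow_le_rpow_of_nonpos (by positivity) h1 (by linarith)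
          _ = κ ^ n := by
            rw [hκ, ← Real.rpow_natCast, ← Real.rpow_natCast, ← Real.rpow_mul hx0.le,
              ← Real.rpow_mul hx0.le, mul_comm]
          _ ≤ _ := by
            rw [htsq]
            gcongr
            exact le_max_right _ _
      have hs : ∀ F : Finset (Freq d),
          ∑ m ∈ F, min ‖Q ^ n‖ (K * μ ^ n * (1 + freqNorm m) ^ (-η)) ≤
            (5 ^ d + K * C) * μ ^ n * (t ^ 2) ^ n := by
        intro F
        refine (sum_min_le htail (norm_nonneg _) (by positivity) N F).trans ?_
        calc _ ≤ 5 ^ d * (t ^ 2) ^ n + K * μ ^ n * (C * (t ^ 2) ^ n) := by gcongr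
          _ = (5 ^ d * 1 + K * C * μ ^ n) * (t ^ 2) ^ n := by ring
          _ ≤ (5 ^ d * μ ^ n + K * C * μ ^ n) * (t ^ 2) ^ n := by
            gcongr
            exact one_le_pow₀ hμ
          _ = _ := by ring
      have hb : ∀ l k, ‖ent (Q ^ n) l k‖ ≤
          min ‖Q ^ n‖ (K * μ ^ n * (1 + freqNorm (l - k)) ^ (-η)) :=
        fun l k => le_min (norm_ent_le _ _ _) (hKn n l k)
      have := AlgBound.mul hη0 (by positivity) (by positivity) (hKn n) (hKn n)
        (rowSum_le (f := fun m => min ‖Q ^ n‖ (K * μ ^ n * (1 + freqNorm m) ^ (-η))) hb hs)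
        (colSum_le (f := fun m => min ‖Q ^ n‖ (K * μ ^ n * (1 + freqNorm m) ^ (-η))) hb hs)
      have e : Q ^ (2 * n) = Q ^ n * Q ^ n := by rw [two_mul, pow_add]
      rw [e]
      refine this.mono (le_of_eq ?_)
      rw [hK₁]
      ring
    -- Odd powers come from even ones by one more factor Q, hence the second candidate for the
    -- constant.
    refine ⟨max K₁ (Cm * a * K₁ / (μ * t)), le_max_of_le_left hK₁0, fun n => ?_⟩
    rcases Nat.even_or_odd' n with ⟨m, rfl | rfl⟩
    · refine (heven m).mono ?_
      gcongr
      exact le_max_left _ _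
    · rw [pow_succ Q]
      refine (hmulQ (by positivity) (heven m)).mono ?_
      calc _ = Cm * a * K₁ / (μ * t) * (μ * t) ^ (2 * m + 1) := by
            rw [pow_succ]
            field_simp
        _ ≤ _ := by
          gcongr
          exact le_max_right _ _
  set μ₀ := max 1 (Cm * a) with hμ₀
  have hμ₀0 : 0 < μ₀ := by positivity
  -- The least such j is used: before it, all rates are at least 1, which is what the bootstrap
  -- requires.
  have hex : ∃ j : ℕ, μ₀ * t ^ j < 1 := by
    have : Tendsto (fun j : ℕ => μ₀ * t ^ j) atTop (𝓝 (μ₀ * 0)) :=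
      (tendsto_pow_atTop_nhds_zero_of_lt_one ht0.le ht1).const_mul _
    rw [mul_zero] at this
    exact (this.eventually_lt_const one_pos).exists
  classical
  have hiter : ∀ j ≤ Nat.find hex, ∃ K, 0 ≤ K ∧
      ∀ n, AlgBound η (K * (μ₀ * t ^ j) ^ n) (ent (Q ^ n)) := by
    intro j
    induction j with
    | zero => exact fun _ => ⟨1, zero_le_one, by simpa using hstart⟩
    | succ j ih =>
      intro hj
      have := hstep (μ₀ * t ^ j) (not_lt.1 (Nat.find_min hex (by omega))) (ih (by omega))
      rwa [mul_assoc, ← pow_succ] at this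
  obtain ⟨K, hK, hKn⟩ := hiter _ le_rfl
  exact ⟨K, _, hK, by positivity, Nat.find_spec hex, hKn⟩

theorem one_sub_smul_mul {d : ℕ} {A X : Ell2 d →L[ℂ] Ell2 d} (hAX : A * X = 1) {t : ℝ}
    (ht : 0 < t) : (1 - (1 - (t : ℂ) • A)) * (((t⁻¹ : ℝ) : ℂ) • X) = 1 := by
  have h : (t : ℂ) ≠ 0 := by exact_mod_cast ht.ne'
  rw [sub_sub_cancel, smul_mul_smul_comm, hAX, Complex.ofReal_inv, mul_inv_cancel₀ h, one_smul]

theorem norm_ent_inverse {d : ℕ} (X : Ell2 d →L[ℂ] Ell2 d) {t : ℝ} (ht : 0 < t) (l k : Freq d) :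
    ‖ent X l k‖ = t * ‖ent (((t⁻¹ : ℝ) : ℂ) • X) l k‖ := by
  rw [ent_smul, norm_mul, Complex.norm_real, norm_inv, Real.norm_of_nonneg ht.le,
    mul_inv_cancel_left₀ ht.ne']

theorem norm_ent_one_sub_smul_le {d : ℕ} (A : Ell2 d →L[ℂ] Ell2 d) {t : ℝ} (ht : 0 < t)
    (l k : Freq d) : ‖ent (1 - (t : ℂ) • A) l k‖ ≤
      ‖ent (1 : Ell2 d →L[ℂ] Ell2 d) l k‖ + t * ‖ent A l k‖ := by
  rw [ent_sub, ent_smul]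
  refine (norm_sub_le _ _).trans ?_
  rw [norm_mul, Complex.norm_real, Real.norm_of_nonneg ht.le]

theorem algClass_inverse {d : ℕ} (hd : 1 ≤ d) {η : ℝ} (hη : (d : ℝ) < η)
    {A X : Ell2 d →L[ℂ] Ell2 d} (hAX : A * X = 1) {t : ℝ} (ht : 0 < t)
    (hQ : ‖1 - (t : ℂ) • A‖ < 1) (hA : AlgClass η (ent A)) : AlgClass η (ent X) := by
  obtain ⟨c, hc, hA⟩ := hA
  have hQA : AlgBound η (1 + t * c) (ent (1 - (t : ℂ) • A)) := by
    intro l k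
    refine (norm_ent_one_sub_smul_le A ht l k).trans ?_
    rw [add_mul, mul_assoc]
    exact add_le_add (algBound_one η l k) (mul_le_mul_of_nonneg_left (hA l k) ht.le)
  obtain ⟨K, μ, hK, hμ0, hμ1, hpow⟩ := exists_algBound_pow hd hη (by positivity) hQ hQA
  have hμ : 0 < 1 - μ := by linarith
  refine ⟨t * (K * (1 - μ)⁻¹) + 1, by positivity, fun l k => ?_⟩
  set w := (1 + freqNorm (l - k)) ^ (-η) with hw
  have hw0 : 0 ≤ w := Real.rpow_nonneg (one_add_freqNorm_pos _).le _
  have := norm_ent_le_of_pow hQ (one_sub_smul_mul hAX ht) (l := l) (k := k)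
    (b := fun n => K * μ ^ n * w) (C := K * (1 - μ)⁻¹ * w) (fun n => hpow n l k) fun N => by
      rw [← Finset.sum_mul, ← Finset.mul_sum]
      gcongr
      rw [← tsum_geometric_of_lt_one hμ0.le hμ1]
      exact (summable_geometric_of_lt_one hμ0.le hμ1).sum_le_tsum _ fun i _ => by positivity
  rw [norm_ent_inverse X ht]
  calc _ ≤ t * (K * (1 - μ)⁻¹ * w) := by gcongr
    _ ≤ _ := by nlinarith

theorem exists_rpow_mul_rpow_lt_one {K r : ℝ} (hK : 0 < K) (hr0 : 0 < r) (hr : r < 1) :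
    ∃ s : ℝ, 0 < s ∧ s < 1 ∧ K ^ s * r ^ (1 - s) < 1 := by
  have hc : ContinuousAt (fun s : ℝ => K ^ s * r ^ (1 - s)) 0 :=
    (Real.continuousAt_const_rpow hK.ne').mul
      ((Real.continuousAt_const_rpow hr0.ne').comp (by fun_prop))
  have h0 : Tendsto (fun s : ℝ => K ^ s * r ^ (1 - s)) (𝓝[>] 0) (𝓝 r) := by
    have := hc.continuousWithinAt (s := Set.Ioi 0)
    simpa [ContinuousWithinAt] using this
  obtain ⟨s, h1, h2⟩ := ((h0.eventually_lt_const hr).and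
    (Ioo_mem_nhdsGT (zero_lt_one' ℝ))).exists
  exact ⟨s, h2.1, h2.2, h1⟩

/-- Each entry of Qⁿ satisfies both a bound Kⁿ exp(-(η/2)|l-k|) and a bound rⁿ with r < 1. Their
weighted geometric mean with a small weight s on the first is summable in n and keeps the rate sη/2.
-/
theorem expClass_inverse {d : ℕ} (hd : 1 ≤ d) {η : ℝ} (hη : 0 < η)
    {A X : Ell2 d →L[ℂ] Ell2 d} (hAX : A * X = 1) {t : ℝ} (ht : 0 < t)
    (hQ : ‖1 - (t : ℂ) • A‖ < 1) (hA : ExpClass η (ent A)) :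
    ∃ η', 0 < η' ∧ η' ≤ η ∧ ExpClass η' (ent X) := by
  obtain ⟨c, hc, hA⟩ := hA
  set Q := 1 - (t : ℂ) • A with hQdef
  have hQA : ExpBound η (1 + t * c) (ent Q) := by
    intro l k
    refine (norm_ent_one_sub_smul_le A ht l k).trans ?_
    rw [add_mul, mul_assoc]
    refine add_le_add ?_ (mul_le_mul_of_nonneg_left (hA l k) ht.le)
    rw [ent_one, one_mul]
    split_ifs with h
    · simp [h]
    · rw [norm_zero]; positivity
  obtain ⟨C, hC, hsum⟩ := exists_sum_exp hd (half_pos hη)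
  set K := (1 + t * c) * C with hK
  have hK0 : 0 < K := by positivity
  have hpow : ∀ n l k, ‖ent (Q ^ n) l k‖ ≤ K ^ n * Real.exp (-(η / 2) * freqNorm (l - k)) := by
    intro n
    induction n with
    | zero =>
      intro l k
      rw [pow_zero, pow_zero, ent_one, one_mul]
      split_ifs with h
      · simp [h]
      · rw [norm_zero]; positivity
    | succ n ih =>
      intro l k
      rw [pow_succ Q]
      refine norm_le_of_hasSum_of_sum_le (hasSum_ent_comp (Q ^ n) Q l k)
        (g := fun m => K ^ n * (1 + t * c) * Real.exp (-(η / 2) * freqNorm (l - k)) *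
          Real.exp (-(η / 2) * freqNorm (m - k))) ?_ ?_
      · intro m
        rw [norm_mul]
        calc _ ≤ K ^ n * Real.exp (-(η / 2) * freqNorm (l - m)) *
              ((1 + t * c) * Real.exp (-η * freqNorm (m - k))) :=
              mul_le_mul (ih l m) (hQA m k) (norm_nonneg _) (by positivity)
          _ = K ^ n * (1 + t * c) * (Real.exp (-(η / 2) * freqNorm (l - m)) *
              Real.exp (-η * freqNorm (m - k))) := by ring
          _ ≤ K ^ n * (1 + t * c) * (Real.exp (-(η / 2) * freqNorm (l - k)) *
              Real.exp (-(η / 2) * freqNorm (m - k))) := by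
            gcongr ?_ * ?_
            rw [← Real.exp_add, ← Real.exp_add, Real.exp_le_exp]
            -- Only half of the rate η is propagated through the triangle inequality; the other half
            -- makes the sum over m converge.
            nlinarith [freqNorm_sub_le l m k]
          _ = _ := by ring
      · intro F
        rw [← Finset.mul_sum]
        calc _ ≤ K ^ n * (1 + t * c) * Real.exp (-(η / 2) * freqNorm (l - k)) * C := by
              gcongr
              exact (sum_shift_right (fun m => Real.exp (-(η / 2) * freqNorm m)) k F).le.trans
                (hsum _)
          _ = _ := by rw [hK]; ring
  -- Used in place of ‖Q‖, which may vanish, so that real powers of r are continuous in the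
  -- exponent.
  set r := (1 + ‖Q‖) / 2 with hr
  have hr0 : 0 < r := by positivity
  have hr1 : r < 1 := by linarith
  have hQr : ‖Q‖ ≤ r := by linarith
  obtain ⟨s, hs0, hs1, hν⟩ := exists_rpow_mul_rpow_lt_one hK0 hr0 hr1
  set ν := K ^ s * r ^ (1 - s) with hνdef
  have hν0 : 0 < ν := by positivity
  have hν' : 0 < 1 - ν := by linarith
  refine ⟨s * (η / 2), by positivity, by nlinarith, t * (1 - ν)⁻¹, by positivity, fun l k => ?_⟩
  set E := Real.exp (-(η / 2) * freqNorm (l - k)) with hE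
  have hEs : E ^ s = Real.exp (-(s * (η / 2)) * freqNorm (l - k)) := by
    rw [hE, ← Real.exp_mul]; congr 1; ring
  have := norm_ent_le_of_pow hQ (one_sub_smul_mul hAX ht) (l := l) (k := k)
    (b := fun n => ν ^ n * E ^ s) (C := (1 - ν)⁻¹ * E ^ s) (fun n => by
      set v := ‖ent (Q ^ n) l k‖ with hv
      have hv0 : 0 ≤ v := norm_nonneg _
      have h1 : v ≤ K ^ n * E := hpow n l k
      have h2 : v ≤ r ^ n := (norm_ent_le _ _ _).trans
        ((norm_pow_le_pow Q n).trans (by gcongr))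
      calc v = v ^ s * v ^ (1 - s) := by
            rw [← Real.rpow_add_of_nonneg hv0 hs0.le (by linarith)]; simp
        _ ≤ (K ^ n * E) ^ s * (r ^ n) ^ (1 - s) := by gcongr
        _ = ν ^ n * E ^ s := by
          rw [Real.mul_rpow (by positivity) (by positivity), hνdef, mul_pow (K ^ s),
            Real.rpow_pow_comm hK0.le, Real.rpow_pow_comm hr0.le]
          ring) fun N => by
      rw [← Finset.sum_mul]
      gcongr
      rw [← tsum_geometric_of_lt_one hν0.le hν]
      exact (summable_geometric_of_lt_one hν0.le hν).sum_le_tsum _ fun i _ => by positivity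
  rw [norm_ent_inverse X ht, ← hEs, mul_assoc]
  gcongr

end AFG

end

noncomputable section

namespace AFG

/-! ### Truncation of matrices -/

theorem opNormLe_sub_trunc {d : ℕ} {M : BiMatrix d} {f : Freq d → ℝ} {s : ℝ} (hs : 0 ≤ s)
    (h : ∀ l k, ‖M l k‖ ≤ f (l - k)) (J : ℕ)
    (hf : ∀ F : Finset (Freq d), (∀ k ∈ F, (J : ℝ) < freqNorm k) → ∑ m ∈ F, f m ≤ s) :
    OpNormLe (M - trunc M J) s := by
  classical
  have h1 : ∀ l k, ‖(M - trunc M J) l k‖ ≤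
      (fun m => if freqNorm m ≤ J then 0 else f m) (l - k) := by
    intro l k
    simp only [Pi.sub_apply, trunc]
    split_ifs with hlk
    · simp
    · simpa using h l k
  have h2 : ∀ F : Finset (Freq d), ∑ m ∈ F, (fun m => if freqNorm m ≤ J then 0 else f m) m ≤ s := by
    intro F
    rw [Finset.sum_ite]
    simp only [Finset.sum_const_zero, zero_add]
    exact hf _ fun k hk => not_le.1 (Finset.mem_filter.1 hk).2
  exact exists_represents_of_schur _ hs (rowSum_le h1 h2) (colSum_le h1 h2)

theorem AlgClass.exists_isTruncConst {d : ℕ} (hd : 1 ≤ d) {η : ℝ} (hη : (d : ℝ) < η)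
    {M : BiMatrix d} (hM : AlgClass η M) : ∃ C, IsTruncConst M (algRate d η) C := by
  obtain ⟨c, hc, hM⟩ := hM
  obtain ⟨C, hC, hsum⟩ := exists_sum_alg_tail hd hη
  refine ⟨c * C, by positivity, fun J => ?_⟩
  refine opNormLe_sub_trunc (f := fun m => c * (1 + freqNorm m) ^ (-η))
    (by unfold algRate; positivity) hM J fun F hF => ?_
  rw [← Finset.mul_sum, mul_assoc]
  exact mul_le_mul_of_nonneg_left (hsum J F hF) hc.le

theorem ExpClass.exists_isTruncConst {d : ℕ} (hd : 1 ≤ d) {η : ℝ} (hη : 0 < η)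
    {M : BiMatrix d} (hM : ExpClass η M) : ∃ C, IsTruncConst M (expRate d η) C := by
  obtain ⟨c, hc, hM⟩ := hM
  obtain ⟨C, hC, hsum⟩ := exists_sum_exp_tail hd hη
  refine ⟨c * C, by positivity, fun J => ?_⟩
  refine opNormLe_sub_trunc (f := fun m => c * Real.exp (-η * freqNorm m))
    (by unfold expRate; positivity) hM J fun F hF => ?_
  rw [← Finset.mul_sum, mul_assoc]
  exact mul_le_mul_of_nonneg_left (hsum J F hF) hc.le

/-! ### The sharp exponential rate in one dimension -/

/-- A bounded subsolution of the difference equation with characteristic roots `z` and `1/z`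
decays like `z^n`. -/
theorem le_mul_pow_of_subsolution {p : ℕ → ℝ} {z P : ℝ} (hz : 0 < z) (hz1 : z < 1)
    (hp : ∀ n, 0 ≤ p n) (hP : ∀ n, p n ≤ P)
    (h : ∀ n, (z + z⁻¹) * p (n + 1) ≤ p (n + 2) + p n) (n : ℕ) : p n ≤ p 0 * z ^ n := by
  have hstep : ∀ n, p (n + 1) ≤ z * p n := by
    intro n
    by_contra hlt
    push Not at hlt
    -- The difference inequality factors: the defect p(n+1) - z p(n) is multiplied by at least 1/z
    -- at each step. A positive defect would therefore grow without bound.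
    have hgrow : ∀ j : ℕ, (p (n + 1) - z * p n) * z⁻¹ ^ j ≤ p (n + j + 1) - z * p (n + j) := by
      intro j
      induction j with
      | zero => simp
      | succ j ih =>
        have h1 := h (n + j)
        have h2 : (p (n + 1) - z * p n) * z⁻¹ ^ (j + 1) ≤
            (p (n + j + 1) - z * p (n + j)) * z⁻¹ := by
          rw [pow_succ, ← mul_assoc]
          gcongr
        have h3 : (p (n + j + 1) - z * p (n + j)) * z⁻¹ = z⁻¹ * p (n + j + 1) - p (n + j) := by
          field_simp
        rw [h3] at h2
        have e : n + (j + 1) = n + j + 1 := rfl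
        rw [e]
        linarith
    have hinv : 1 < z⁻¹ := (one_lt_inv₀ hz).2 hz1
    have hlim : Tendsto (fun j : ℕ => (p (n + 1) - z * p n) * z⁻¹ ^ j) atTop atTop :=
      (tendsto_pow_atTop_atTop_of_one_lt hinv).const_mul_atTop (by linarith)
    obtain ⟨j, hj⟩ := (hlim.eventually_gt_atTop P).exists
    have := hgrow j
    nlinarith [hP (n + j + 1), hp (n + j)]
  induction n with
  | zero => simp
  | succ n ih =>
    calc p (n + 1) ≤ z * p n := hstep n
      _ ≤ z * (p 0 * z ^ n) := by gcongr
      _ = _ := by ring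

theorem summable_pow_natAbs {w : ℝ} (hw : 0 < w) (hw1 : w < 1) :
    Summable fun j : ℤ => w ^ j.natAbs := by
  have h := summable_geometric_of_lt_one hw.le hw1
  refine Summable.of_nat_of_neg ?_ ?_ <;> simpa using h

/-- The two-sided geometric sequence is, up to a factor, the Green's function of a second-order
difference operator. This is how a convolution inequality becomes a local one. -/
theorem pow_natAbs_recurrence {w : ℝ} (hw : 0 < w) (j : ℤ) :
    w ^ (j + 1).natAbs + w ^ (j - 1).natAbs =
      (w + w⁻¹) * w ^ j.natAbs - if j = 0 then w⁻¹ - w else 0 := by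
  rcases lt_trichotomy j 0 with h | h | h
  · obtain ⟨n, rfl⟩ : ∃ n : ℕ, j = -((n : ℤ) + 1) := ⟨(-j - 1).toNat, by omega⟩
    have e1 : (-((n : ℤ) + 1) + 1).natAbs = n := by omega
    have e2 : (-((n : ℤ) + 1) - 1).natAbs = n + 2 := by omega
    have e3 : (-((n : ℤ) + 1)).natAbs = n + 1 := by omega
    rw [e1, e2, e3, if_neg h.ne]
    field_simp
    ring
  · subst h
    simp
    ring
  · obtain ⟨n, rfl⟩ : ∃ n : ℕ, j = (n : ℤ) + 1 := ⟨(j - 1).toNat, by omega⟩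
    have e1 : ((n : ℤ) + 1 + 1).natAbs = n + 2 := by omega
    have e2 : ((n : ℤ) + 1 - 1).natAbs = n := by omega
    have e3 : ((n : ℤ) + 1).natAbs = n + 1 := by omega
    rw [e1, e2, e3, if_neg h.ne']
    field_simp
    ring

theorem hasSum_pow_natAbs_sub {w : ℝ} (hw : 0 < w) (hw1 : w < 1) (l : ℤ) :
    HasSum (fun m : ℤ => w ^ (l - m).natAbs) (∑' j : ℤ, w ^ j.natAbs) :=
  (Equiv.hasSum_iff (f := fun j : ℤ => w ^ j.natAbs) (Equiv.subLeft l)).2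
    (summable_pow_natAbs hw hw1).hasSum

theorem summable_convolution {y : ℤ → ℝ} {w Y : ℝ} (hw : 0 < w) (hw1 : w < 1)
    (hy : ∀ j, 0 ≤ y j) (hY : ∀ j, y j ≤ Y) (l : ℤ) :
    Summable fun m : ℤ => w ^ (l - m).natAbs * y m := by
  refine Summable.of_nonneg_of_le (fun m => mul_nonneg (by positivity) (hy m)) (fun m => ?_)
    ((hasSum_pow_natAbs_sub hw hw1 l).summable.mul_right Y)
  gcongr
  exact hY m

/-- Exponential decay of a bounded sequence that is dominated off the origin by its convolution
with `γ w^{|j|}`. -/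
theorem decay_of_convolution_bound {y : ℤ → ℝ} {w z γ Y W : ℝ} (hw : 0 < w) (hw1 : w < 1)
    (hz : 0 < z) (hz1 : z < 1) (hγ : 0 ≤ γ) (hy : ∀ j, 0 ≤ y j) (hY : ∀ j, y j ≤ Y)
    (hW : ∑' j : ℤ, w ^ j.natAbs ≤ W)
    (hroot : z + z⁻¹ ≤ w + w⁻¹ - (w⁻¹ - w) * γ)
    (h : ∀ l : ℤ, l ≠ 0 → y l ≤ γ * ∑' m : ℤ, w ^ (l - m).natAbs * y m) (l : ℤ) (hl : l ≠ 0) :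
    y l ≤ γ * (W * Y) * z ^ l.natAbs := by
  have hY0 : 0 ≤ Y := (hy 0).trans (hY 0)
  have hswl := hasSum_pow_natAbs_sub hw hw1
  have hsp := summable_convolution hw hw1 hy hY
  set p : ℤ → ℝ := fun l => ∑' m : ℤ, w ^ (l - m).natAbs * y m with hp
  have hp0 : ∀ l, 0 ≤ p l := fun l => tsum_nonneg fun m => mul_nonneg (by positivity) (hy m)
  have hpW : ∀ l, p l ≤ W * Y := by
    intro l
    calc p l ≤ ∑' m : ℤ, w ^ (l - m).natAbs * Y := by
          refine (hsp l).tsum_le_tsum (fun m => ?_) ((hswl l).summable.mul_right Y)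
          gcongr
          exact hY m
      _ = (∑' j : ℤ, w ^ j.natAbs) * Y := by rw [tsum_mul_right, (hswl l).tsum_eq]
      _ ≤ W * Y := by gcongr
  have hrec : ∀ l, p (l + 1) + p (l - 1) = (w + w⁻¹) * p l - (w⁻¹ - w) * y l := by
    intro l
    have h1 := (hsp (l + 1)).hasSum.add (hsp (l - 1)).hasSum
    have h2 := ((hsp l).hasSum.mul_left (w + w⁻¹)).sub
      (hasSum_ite_eq l ((w⁻¹ - w) * y l))
    have h3 : (fun m : ℤ => w ^ (l + 1 - m).natAbs * y m + w ^ (l - 1 - m).natAbs * y m) =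
        fun m : ℤ => (w + w⁻¹) * (w ^ (l - m).natAbs * y m) -
          if m = l then (w⁻¹ - w) * y l else 0 := by
      funext m
      have h4 := pow_natAbs_recurrence hw (l - m)
      have e1 : l - m + 1 = l + 1 - m := by ring
      have e2 : l - m - 1 = l - 1 - m := by ring
      rw [e1, e2] at h4
      rw [← add_mul, h4]
      by_cases hm : m = l
      · subst hm
        simp
        ring
      · rw [if_neg (by omega), if_neg hm]
        ring
    rw [h3] at h1
    exact h1.unique h2
  -- Inserting y ≤ γp into the recurrence lowers its coefficient from w + 1/w to one that dominates
  -- z + 1/z. Away from the origin p is thus a bounded subsolution in each direction.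
  have hsub : ∀ l : ℤ, l ≠ 0 → (z + z⁻¹) * p l ≤ p (l + 1) + p (l - 1) := by
    intro l hl
    have hinv : 0 ≤ w⁻¹ - w := by
      have := (one_lt_inv₀ hw).2 hw1
      linarith
    rw [hrec]
    have h1 := mul_le_mul_of_nonneg_left (h l hl) hinv
    have h2 := mul_le_mul_of_nonneg_right hroot (hp0 l)
    change (w⁻¹ - w) * y l ≤ (w⁻¹ - w) * (γ * p l) at h1
    linarith
  have hmain : p l ≤ W * Y * z ^ l.natAbs := by
    have hz0 : (0 : ℝ) ≤ z ^ l.natAbs := by positivity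
    rcases le_total 0 l with h0 | h0
    · have := le_mul_pow_of_subsolution (p := fun n : ℕ => p n) hz hz1 (fun n => hp0 _)
        (fun n => hpW _) (fun n => by
          have := hsub (n + 1) (by omega)
          push_cast
          rwa [add_assoc, one_add_one_eq_two, add_sub_cancel_right] at this) l.natAbs
      simp only [Int.natCast_natAbs, abs_of_nonneg h0] at this
      exact this.trans (mul_le_mul_of_nonneg_right (hpW _) hz0)
    · have := le_mul_pow_of_subsolution (p := fun n : ℕ => p (-n)) hz hz1 (fun n => hp0 _)
        (fun n => hpW _) (fun n => by
          have := hsub (-(n + 1)) (by omega)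
          have e1 : -((n : ℤ) + 1) + 1 = -n := by ring
          have e2 : -((n : ℤ) + 1) - 1 = -(n + 2) := by ring
          rw [e1, e2] at this
          push_cast
          linarith) l.natAbs
      simp only [Int.natCast_natAbs, abs_of_nonpos h0, neg_neg] at this
      exact this.trans (mul_le_mul_of_nonneg_right (hpW _) hz0)
  calc y l ≤ γ * p l := h l hl
    _ ≤ γ * (W * Y * z ^ l.natAbs) := by gcongr
    _ = _ := by ring

theorem freqNorm_one (k : Freq 1) : freqNorm k = (k 0).natAbs := by
  rw [freqNorm]
  simp [Real.sqrt_sq_eq_abs]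

/-- The quadratic is positive at exp(-η) and negative at 1, so it has a root between them.
Negativity at 1 means (E-1)² > 2γ(E-1) with E = exp η, which is the smallness condition on γ. -/
theorem exists_root_sharp {η γ : ℝ} (hη : 0 < η) (hγ : 0 < γ) (hγη : γ < (Real.exp η - 1) / 2) :
    ∃ η', 0 < η' ∧ η' ≤ η ∧ Real.exp (-η') ^ 2 -
      (Real.exp (2 * η) + 2 * γ + 1) / (Real.exp η * (γ + 1)) * Real.exp (-η') + 1 = 0 := by
  set E := Real.exp η with hE
  have hE1 : 1 < E := Real.one_lt_exp_iff.2 hη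
  have hE0 : 0 < E := by linarith
  have hE2 : Real.exp (2 * η) = E ^ 2 := by rw [hE, ← Real.exp_nat_mul]; norm_num
  rw [hE2]
  set S := (E ^ 2 + 2 * γ + 1) / (E * (γ + 1)) with hS
  let q : ℝ → ℝ := fun x => x ^ 2 - S * x + 1
  have hq1 : q 1 < 0 := by
    have : 2 < S := by
      rw [hS, lt_div_iff₀ (by positivity)]
      nlinarith
    simp only [q]
    linarith
  have hqw : 0 < q E⁻¹ := by
    have : q E⁻¹ = γ * (1 - E⁻¹ ^ 2) / (γ + 1) := by
      simp only [q, hS]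
      field_simp
      ring
    rw [this]
    have : E⁻¹ < 1 := inv_lt_one_of_one_lt₀ hE1
    have h2 : E⁻¹ ^ 2 < 1 := pow_lt_one₀ (by positivity) this two_ne_zero
    have : 0 < 1 - E⁻¹ ^ 2 := by linarith
    positivity
  have hcont : ContinuousOn q (Set.Icc E⁻¹ 1) := by fun_prop
  obtain ⟨z, hz, hqz⟩ := intermediate_value_Icc' (inv_le_one_of_one_le₀ hE1.le) hcont
    (show (0 : ℝ) ∈ Set.Icc (q 1) (q E⁻¹) from ⟨hq1.le, hqw.le⟩)
  have hz0 : 0 < z := lt_of_lt_of_le (by positivity) hz.1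
  have hz1 : z < 1 := lt_of_le_of_ne hz.2 fun h => by
    rw [h] at hqz
    linarith
  refine ⟨-Real.log z, ?_, ?_, ?_⟩
  · linarith [Real.log_neg hz0 hz1]
  · have := Real.log_le_log (by positivity) hz.1
    rw [Real.log_inv, hE, Real.log_exp] at this
    linarith
  · rw [neg_neg, Real.exp_log hz0]
    exact hqz

/-- In a fixed column k of X, row l ≠ k of A X = 1 expresses the diagonal term through the others,
so m y_l ≤ c ∑_{j≠l} w^{|l-j|} y_j for the moduli y of the entries. Adding c y_l to both sides gives
a full convolution with factor γ = c/(m+c), and for this γ the characteristic equation is the stated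
quadratic. -/
theorem expClass_inverse_one {η c m : ℝ} (hη : 0 < η) (hm : 0 < m)
    {A X : Ell2 1 →L[ℂ] Ell2 1} (hAX : A * X = 1) (hdiag : ∀ l, m ≤ (ent A l l).re)
    (hA : ExpBound η c (ent A)) (hc : c < (Real.exp η - 1) / 2 * m) :
    ∃ η', 0 < η' ∧ η' ≤ η ∧ Real.exp (-η') ^ 2 -
      (Real.exp (2 * η) + 2 * (c / m) + 1) / (Real.exp η * (c / m + 1)) * Real.exp (-η') + 1 = 0 ∧
      ExpClass η' (ent X) := by
  have hcm : m ≤ c := by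
    have h1 := (hdiag 0).trans ((Complex.re_le_norm _).trans (hA 0 0))
    simpa using h1
  have hc0 : 0 < c := by linarith
  obtain ⟨η', h0, h1, hroot⟩ := exists_root_sharp hη (div_pos hc0 hm)
    (by rw [div_lt_iff₀ hm]; exact hc)
  refine ⟨η', h0, h1, hroot, ?_⟩
  set z := Real.exp (-η') with hz
  set w := Real.exp (-η) with hw
  have hw0 : 0 < w := Real.exp_pos _
  have hw1 : w < 1 := Real.exp_lt_one_iff.2 (by linarith)
  have hz0 : 0 < z := Real.exp_pos _
  have hz1 : z < 1 := Real.exp_lt_one_iff.2 (by linarith)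
  have hexp : ∀ (a : ℝ) (k : Freq 1), Real.exp (-a * freqNorm k) = Real.exp (-a) ^ (k 0).natAbs := by
    intro a k
    rw [freqNorm_one, ← Real.exp_nat_mul, mul_comm]
  set W := ∑' j : ℤ, w ^ j.natAbs with hW
  have hW0 : 0 ≤ W := tsum_nonneg fun j => by positivity
  set γ := c / (m + c) with hγ
  have hroot' : z + z⁻¹ ≤ w + w⁻¹ - (w⁻¹ - w) * γ := by
    have hE : Real.exp η = w⁻¹ := by rw [hw, ← Real.exp_neg, neg_neg]
    have hE2 : Real.exp (2 * η) = w⁻¹ ^ 2 := by rw [← hE, ← Real.exp_nat_mul]; norm_num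
    rw [hE, hE2] at hroot
    have h2 : z + z⁻¹ = (w⁻¹ ^ 2 + 2 * (c / m) + 1) / (w⁻¹ * (c / m + 1)) := by
      set S := (w⁻¹ ^ 2 + 2 * (c / m) + 1) / (w⁻¹ * (c / m + 1))
      have : z * (z + z⁻¹) = z * S := by
        rw [mul_add, mul_inv_cancel₀ hz0.ne']
        linarith
      exact mul_left_cancel₀ hz0.ne' this
    rw [h2, hγ]
    apply le_of_eq
    field_simp
    ring
  have key : ∀ (k : Freq 1) (j : ℤ), j ≠ 0 →
      ‖ent X (k + fun _ => j) k‖ ≤ γ * (W * ‖X‖) * z ^ j.natAbs := by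
    intro k
    refine decay_of_convolution_bound (y := fun j : ℤ => ‖ent X (k + fun _ => j) k‖) hw0 hw1 hz0
      hz1 (by positivity) (fun j => norm_nonneg _) (fun j => norm_ent_le X _ _) le_rfl hroot' ?_
    intro l hl
    let e : ℤ ≃ Freq 1 := (Equiv.funUnique (Fin 1) ℤ).symm.trans (Equiv.addLeft k)
    have he : ∀ j, e j = k + fun _ => j := fun j => rfl
    have hs := (Equiv.hasSum_iff e).2 (hasSum_ent_comp A X (e l) k)
    rw [hAX, ent_one, if_neg (by
      rw [he]
      intro h
      have := congrFun h 0
      simp at this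
      exact hl this)] at hs
    have h2 := hs.sub (hasSum_ite_eq l (ent A (e l) (e l) * ent X (e l) k))
    have h3 := ((summable_convolution hw0 hw1 (fun j => norm_nonneg (ent X (e j) k))
      (fun j => norm_ent_le X _ _) l).hasSum.mul_left c).sub
        (hasSum_ite_eq l (c * ‖ent X (e l) k‖))
    have h4 := h2.norm_le_of_bounded h3 fun j => by
      by_cases hj : j = l
      · subst hj
        simp
      · simp only [Function.comp_apply, if_neg hj, sub_zero]
        rw [norm_mul, ← mul_assoc]
        refine mul_le_mul_of_nonneg_right ((hA _ _).trans (le_of_eq ?_)) (norm_nonneg _)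
        rw [hexp, he, he, ← hw]
        simp
    rw [zero_sub, norm_neg, norm_mul] at h4
    have h5 : m * ‖ent X (e l) k‖ ≤ ‖ent A (e l) (e l)‖ * ‖ent X (e l) k‖ := by
      gcongr
      exact (hdiag _).trans (Complex.re_le_norm _)
    change ‖ent X (e l) k‖ ≤ γ * ∑' m : ℤ, w ^ (l - m).natAbs * ‖ent X (e m) k‖
    rw [hγ, div_mul_eq_mul_div, le_div_iff₀ (by positivity)]
    linarith
  refine ⟨‖X‖ + γ * (W * ‖X‖) + 1, by positivity, fun l k => ?_⟩
  rw [hexp]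
  have hzp : 0 ≤ z ^ ((l - k) 0).natAbs := by positivity
  by_cases hlk : (l - k) 0 = 0
  · rw [hlk]
    simp only [Int.natAbs_zero, pow_zero, mul_one]
    have : 0 ≤ γ * (W * ‖X‖) := by positivity
    linarith [norm_ent_le X l k]
  · have e : (k + fun _ => (l - k) 0) = l := by
      funext i
      fin_cases i
      simp
    have := key k _ hlk
    rw [e] at this
    refine this.trans ?_
    gcongr
    linarith [norm_nonneg X]

end AFG

end

noncomputable section

namespace AFG

/-! ### Completeness of the trigonometric system -/

/-- Haar probability measure on the torus `(ℝ/ℤ)^d`. -/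
def torusMeasure (d : ℕ) : Measure (UnitAddTorus (Fin d)) :=
  Measure.pi fun _ => AddCircle.haarAddCircle

/-- The covering map from `ℝ^d` to `(ℝ/ℤ)^d` with periods `2π`. -/
def toTorus (d : ℕ) (x : Fin d → ℝ) : UnitAddTorus (Fin d) :=
  fun i => ((x i / (2 * Real.pi) : ℝ) : UnitAddCircle)

theorem boxMeasure_eq_pi (d : ℕ) :
    boxMeasure d = Measure.pi fun _ => volume.restrict (Set.Ioo 0 (2 * Real.pi)) := by
  rw [boxMeasure, box, volume_pi, Measure.restrict_pi_pi]

theorem map_div_two_pi :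
    (volume.restrict (Set.Ioo 0 (2 * Real.pi))).map
      (fun x : ℝ => ((x / (2 * Real.pi) : ℝ) : UnitAddCircle)) =
      ENNReal.ofReal (2 * Real.pi) • AddCircle.haarAddCircle := by
  have hc : (0 : ℝ) < 2 * Real.pi := by positivity
  have h1 : (volume.restrict (Set.Ioo 0 (2 * Real.pi))).map (fun x : ℝ => x / (2 * Real.pi)) =
      ENNReal.ofReal (2 * Real.pi) • (volume.restrict (Set.Ioo 0 1) : Measure ℝ) := by
    have h2 : Set.Ioo 0 (2 * Real.pi) =
        (fun x : ℝ => x / (2 * Real.pi)) ⁻¹' Set.Ioo 0 1 := by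
      ext x
      simp only [Set.mem_Ioo, Set.mem_preimage, div_lt_one hc]
      refine and_congr_left fun _ => ?_
      constructor
      · intro h; positivity
      · intro h; exact (div_pos_iff_of_pos_right hc).1 h
    rw [h2, ← Measure.restrict_map (by fun_prop) measurableSet_Ioo]
    have h3 := Real.map_volume_mul_right (a := (2 * Real.pi)⁻¹) (by positivity)
    simp only [inv_inv, abs_of_pos hc] at h3
    simp only [div_eq_mul_inv]
    rw [h3, Measure.restrict_smul]
  have h4 := AddCircle.measurePreserving_mk (1 : ℝ) 0
  have h5 : (volume.restrict (Set.Ioo (0 : ℝ) 1)).map (fun x : ℝ => (x : UnitAddCircle)) =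
      AddCircle.haarAddCircle := by
    have := h4.map_eq
    rw [zero_add, restrict_Ioo_eq_restrict_Ioc.symm] at this
    rw [this, AddCircle.volume_eq_smul_haarAddCircle]
    simp
  rw [← h5, ← Measure.map_smul, ← h1, Measure.map_map AddCircle.measurable_mk' (by fun_prop)]
  rfl

theorem measurable_toTorus (d : ℕ) : Measurable (toTorus d) := by
  refine measurable_pi_lambda _ fun i => ?_
  exact AddCircle.measurable_mk'.comp ((measurable_pi_apply i).div_const _)

/-- The covering map identifies the box with the torus up to the factor (2π)^d, which allows
completeness to be imported from Fourier series on the unit torus. -/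
theorem map_toTorus (d : ℕ) :
    (boxMeasure d).map (toTorus d) = ENNReal.ofReal (2 * Real.pi) ^ d • torusMeasure d := by
  have h1 : (boxMeasure d).map (toTorus d) =
      Measure.pi fun _ : Fin d => ENNReal.ofReal (2 * Real.pi) • AddCircle.haarAddCircle := by
    rw [boxMeasure_eq_pi, ← map_div_two_pi]
    exact Measure.pi_map_pi fun _ =>
      (AddCircle.measurable_mk'.comp (measurable_id.div_const _)).aemeasurable
  rw [h1]
  have : IsFiniteMeasure (ENNReal.ofReal (2 * Real.pi) • (AddCircle.haarAddCircle (T := 1))) :=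
    Measure.smul_finite _ ENNReal.ofReal_ne_top
  refine Measure.pi_eq fun s _ => ?_
  rw [torusMeasure, Measure.smul_apply, Measure.pi_pi]
  simp [Finset.prod_mul_distrib]

theorem mFourier_toTorus {d : ℕ} (k : Freq d) (x : Fin d → ℝ) :
    UnitAddTorus.mFourier k (toTorus d x) =
      (((2 * Real.pi) ^ ((d : ℝ) / 2) : ℝ) : ℂ) * modeFun k x := by
  have h1 : (((2 * Real.pi) ^ ((d : ℝ) / 2) : ℝ) : ℂ) *
      (((2 * Real.pi) ^ (-(d : ℝ) / 2) : ℝ) : ℂ) = 1 := by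
    rw [← Complex.ofReal_mul, ← Real.rpow_add (by positivity), ← add_div, add_neg_cancel]
    simp
  rw [modeFun, ← mul_assoc, h1, one_mul]
  simp only [UnitAddTorus.mFourier, ContinuousMap.coe_mk, toTorus, fourier_coe_apply]
  rw [← Complex.exp_sum]
  congr 1
  rw [Complex.ofReal_sum, Finset.mul_sum]
  refine Finset.sum_congr rfl fun j _ => ?_
  have : (Real.pi : ℂ) ≠ 0 := by exact_mod_cast Real.pi_ne_zero
  push_cast
  field_simp

/-- The lift of a function on the box to the torus. -/
def torusLift {d : ℕ} (v : (Fin d → ℝ) → ℂ) (y : UnitAddTorus (Fin d)) : ℂ :=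
  v fun i => 2 * Real.pi * (UnitAddTorus.measurableEquivPiIoc (fun _ => (0 : ℝ)) y).1 i

theorem torusLift_toTorus {d : ℕ} (v : (Fin d → ℝ) → ℂ) {x : Fin d → ℝ} (hx : x ∈ box d) :
    torusLift v (toTorus d x) = v x := by
  have hc : (0 : ℝ) < 2 * Real.pi := by positivity
  have h1 : ∀ i, x i / (2 * Real.pi) ∈ Set.Ioc (0 : ℝ) (0 + 1) := by
    intro i
    have := hx i (Set.mem_univ i)
    rw [zero_add]
    exact ⟨div_pos this.1 hc, ((div_lt_one hc).2 this.2).le⟩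
  have h2 : UnitAddTorus.measurableEquivPiIoc (fun _ => (0 : ℝ)) (toTorus d x) =
      ⟨fun i => x i / (2 * Real.pi), h1⟩ := by
    exact (UnitAddTorus.measurableEquivPiIoc (fun _ : Fin d => (0 : ℝ))).apply_symm_apply
      ⟨fun i => x i / (2 * Real.pi), h1⟩
  rw [torusLift, h2]
  congr 1
  funext i
  simp only
  field_simp

theorem measurable_torusLift {d : ℕ} {v : (Fin d → ℝ) → ℂ} (hv : Measurable v) :
    Measurable (torusLift v) := by
  refine hv.comp (measurable_pi_lambda _ fun i => ?_)
  exact (((measurable_pi_apply i).comp measurable_subtype_coe).comp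
    (UnitAddTorus.measurableEquivPiIoc (fun _ => (0 : ℝ))).measurable).const_mul _

/-- Lifted to the torus, v has vanishing Fourier coefficients, hence vanishes almost everywhere
there by completeness; pulling back gives the claim on the box. -/
theorem eq_zero_of_forall_integral_mode_eq_zero {d : ℕ} (v : L2 d)
    (h : ∀ k, ∫ x, v x * modeFun k x ∂(boxMeasure d) = 0) : v = 0 := by
  have hc : (0 : ℝ) < 2 * Real.pi := by positivity
  have hc0 : ENNReal.ofReal (2 * Real.pi) ^ d ≠ 0 := pow_ne_zero _ (by simpa using hc)
  have hctop : ENNReal.ofReal (2 * Real.pi) ^ d ≠ ⊤ := ENNReal.pow_ne_top ENNReal.ofReal_ne_top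
  have hvm : Measurable v := (Lp.stronglyMeasurable v).measurable
  set w := torusLift (v : (Fin d → ℝ) → ℂ) with hw
  have hwm : Measurable w := measurable_torusLift hvm
  have hbox : ∀ᵐ x ∂(boxMeasure d), x ∈ box d := ae_restrict_mem (measurableSet_box d)
  have hcomp : (fun x => w (toTorus d x)) =ᵐ[boxMeasure d] v := by
    filter_upwards [hbox] with x hx using torusLift_toTorus _ hx
  have hmem : MemLp w 2 (torusMeasure d) := by
    have h1 : MemLp (w ∘ toTorus d) 2 (boxMeasure d) := (memLp_congr_ae hcomp).2 (Lp.memLp v)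
    have h2 : MemLp w 2 ((boxMeasure d).map (toTorus d)) :=
      (memLp_map_measure_iff hwm.aestronglyMeasurable (measurable_toTorus d).aemeasurable).2 h1
    have h3 : torusMeasure d = (ENNReal.ofReal (2 * Real.pi) ^ d)⁻¹ •
        (boxMeasure d).map (toTorus d) := by
      rw [map_toTorus, smul_smul, ENNReal.inv_mul_cancel hc0 hctop, one_smul]
    rw [h3]
    exact h2.smul_measure (by simpa using hc0)
  have hcoef : ∀ n : Freq d, ∫ y, UnitAddTorus.mFourier (-n) y * w y ∂(torusMeasure d) = 0 := by
    intro n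
    have h1 : ∫ y, UnitAddTorus.mFourier (-n) y * w y ∂((boxMeasure d).map (toTorus d)) = 0 := by
      have h0 : Measurable fun y => UnitAddTorus.mFourier (-n) y * w y :=
        (UnitAddTorus.mFourier (-n)).continuous.measurable.mul hwm
      rw [integral_map (measurable_toTorus d).aemeasurable h0.aestronglyMeasurable]
      have h2 : (fun x => UnitAddTorus.mFourier (-n) (toTorus d x) * w (toTorus d x))
          =ᵐ[boxMeasure d] fun x => (((2 * Real.pi) ^ ((d : ℝ) / 2) : ℝ) : ℂ) *
            (v x * modeFun (-n) x) := by
        filter_upwards [hcomp] with x hx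
        rw [hx, mFourier_toTorus]
        ring
      rw [integral_congr_ae h2, integral_const_mul, h, mul_zero]
    rw [map_toTorus, integral_smul_measure] at h1
    have h3 : (ENNReal.ofReal (2 * Real.pi) ^ d).toReal ≠ 0 := ENNReal.toReal_ne_zero.2 ⟨hc0, hctop⟩
    exact (smul_eq_zero.1 h1).resolve_left h3
  have hzero : w =ᵐ[torusMeasure d] 0 := by
    have h1 : UnitAddTorus.mFourierBasis.repr (hmem.toLp w) = 0 := by
      ext n
      rw [UnitAddTorus.mFourierBasis_repr]
      refine Eq.trans (integral_congr_ae (μ := torusMeasure d) ?_) (hcoef n)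
      filter_upwards [hmem.coeFn_toLp] with y hy
      exact congrArg (fun z => UnitAddTorus.mFourier (-n) y * z) hy
    have h2 : hmem.toLp w = 0 :=
      UnitAddTorus.mFourierBasis.repr.map_eq_zero_iff.1 h1
    exact (Lp.eq_zero_iff_ae_eq_zero).1 h2 |>.symm.trans hmem.coeFn_toLp |>.symm
  have h4 : ∀ᵐ y ∂((boxMeasure d).map (toTorus d)), w y = 0 := by
    rw [map_toTorus]
    exact Measure.ae_smul_measure hzero _
  have h5 := ae_of_ae_map (measurable_toTorus d).aemeasurable h4
  refine Lp.eq_zero_iff_ae_eq_zero.2 ?_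
  filter_upwards [h5, hcomp] with x h1 h2
  rw [← h2, h1]
  rfl

end AFG

end

noncomputable section

namespace AFG

/-! ### The orthonormal basis of `H¹_p(Ω)` -/

variable {d : ℕ}

theorem conj_modeFun (k : Freq d) (x : Fin d → ℝ) : conj (modeFun k x) = modeFun (-k) x := by
  rw [modeFun, modeFun, map_mul, Complex.conj_ofReal, ← Complex.exp_conj, map_mul, Complex.conj_I,
    Complex.conj_ofReal]
  congr 2
  simp

theorem modeFun_mul (k l : Freq d) (x : Fin d → ℝ) : modeFun k x * modeFun l x =
    (((2 * Real.pi) ^ (-(d : ℝ) / 2) : ℝ) : ℂ) * modeFun (k + l) x := by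
  have : Complex.exp (Complex.I * ((∑ j, ((k + l) j : ℝ) * x j : ℝ) : ℂ)) =
      Complex.exp (Complex.I * ((∑ j, (k j : ℝ) * x j : ℝ) : ℂ)) *
        Complex.exp (Complex.I * ((∑ j, (l j : ℝ) * x j : ℝ) : ℂ)) := by
    rw [← Complex.exp_add, ← mul_add, ← Complex.ofReal_add, ← Finset.sum_add_distrib]
    congr 3
    refine Finset.sum_congr rfl fun j _ => ?_
    rw [← add_mul]
    push_cast [Pi.add_apply]
    rfl
  rw [modeFun, modeFun, modeFun, this]
  ring

/-- For k_j ≠ 0 the mode is, up to the factor i k_j, its own j-th partial derivative, and such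
integrals vanish by periodicity. -/
theorem integral_modeFun_of_ne {k : Freq d} (hk : k ≠ 0) :
    ∫ x, modeFun k x ∂(boxMeasure d) = 0 := by
  obtain ⟨j, hj⟩ := Function.ne_iff.1 hk
  have h := integral_pderiv_eq_zero (isPeriodicTest_modeFun k) j
  simp only [pderivC_modeFun] at h
  rw [integral_const_mul] at h
  refine (mul_eq_zero.1 h).resolve_left (mul_ne_zero Complex.I_ne_zero ?_)
  exact_mod_cast hj

theorem integral_modeFun_mul_neg (k l : Freq d) :
    ∫ x, modeFun k x * modeFun (-l) x ∂(boxMeasure d) = if k = l then 1 else 0 := by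
  simp only [modeFun_mul]
  rw [integral_const_mul]
  split_ifs with h
  · subst h
    have h1 : ∀ x : Fin d → ℝ, modeFun (k + -k) x =
        (((2 * Real.pi) ^ (-(d : ℝ) / 2) : ℝ) : ℂ) := by
      intro x; simp [modeFun]
    simp only [h1]
    rw [integral_const, boxMeasure, measureReal_restrict_apply_univ, box, Measure.real,
      Real.volume_pi_Ioo]
    simp only [sub_zero, Finset.prod_const, Finset.card_univ, Fintype.card_fin, ENNReal.toReal_pow]
    rw [ENNReal.toReal_ofReal (by positivity), Complex.real_smul, ← Complex.ofReal_mul,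
      ← Complex.ofReal_mul, ← Real.rpow_natCast, ← Real.rpow_add (by positivity),
      ← Real.rpow_add (by positivity)]
    have : -(d : ℝ) / 2 + ((d : ℝ) + -(d : ℝ) / 2) = 0 := by ring
    rw [this]
    simp
  · rw [integral_modeFun_of_ne, mul_zero]
    rwa [← sub_eq_add_neg, sub_ne_zero]

theorem coeFn_modeL2 (k : Freq d) : (modeL2 k : (Fin d → ℝ) → ℂ) =ᵐ[boxMeasure d] modeFun k :=
  MemLp.coeFn_toLp _

theorem inner_modeL2 (k : Freq d) (v : L2 d) :
    inner ℂ (modeL2 k) v = ∫ x, v x * modeFun (-k) x ∂(boxMeasure d) := by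
  rw [L2.inner_def]
  refine integral_congr_ae ?_
  filter_upwards [coeFn_modeL2 k] with x hx
  rw [hx, RCLike.inner_apply, conj_modeFun]

/-- Pairing with a continuous function is a continuous functional on `L²(Ω)`. -/
theorem continuous_integral_mul {χ : (Fin d → ℝ) → ℂ} (hχ : Continuous χ) :
    Continuous fun v : L2 d => ∫ x, v x * χ x ∂(boxMeasure d) := by
  have hc : Continuous fun x => conj (χ x) := Complex.continuous_conj.comp hχ
  have h : ∀ v : L2 d, ∫ x, v x * χ x ∂(boxMeasure d) =
      inner ℂ ((memLp_of_continuous hc 2).toLp _) v := by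
    intro v
    rw [L2.inner_def]
    refine integral_congr_ae ?_
    filter_upwards [(memLp_of_continuous hc 2 : MemLp _ 2 (boxMeasure d)).coeFn_toLp] with x hx
    rw [hx, RCLike.inner_apply, Complex.conj_conj]
  simp only [h]
  exact continuous_const.inner continuous_id

/-- The underlying function, as a continuous linear map. -/
def toL2L (d : ℕ) : H1p d →L[ℂ] L2 d := (WithLp.fstL 2 ℂ _ _).comp (H1p d).subtypeL

/-- The weak partial derivative, as a continuous linear map. -/
def gradL (j : Fin d) : H1p d →L[ℂ] L2 d :=
  ((PiLp.proj 2 (fun _ : Fin d => L2 d) j).comp (WithLp.sndL 2 ℂ _ _)).comp (H1p d).subtypeL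

theorem inner_H1p (u v : H1p d) : inner ℂ u v =
    inner ℂ (H1p.toL2 u) (H1p.toL2 v) + ∑ j, inner ℂ (H1p.grad u j) (H1p.grad v j) := by
  rw [Submodule.coe_inner, WithLp.prod_inner_apply, PiLp.inner_apply]
  rfl

theorem norm_sq_H1p (v : H1p d) : ‖v‖ ^ 2 = ‖H1p.toL2 v‖ ^ 2 + ∑ j, ‖H1p.grad v j‖ ^ 2 := by
  have := congrArg Complex.re (inner_H1p v v)
  simp only [Complex.add_re, Complex.re_sum] at this
  simpa [inner_self_eq_norm_sq_to_K, ← Complex.ofReal_pow] using this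

instance : CompleteSpace (H1p d) := by
  have hclosed : IsClosed (H1p d : Set (Pair d)) := ?_
  · exact hclosed.completeSpace_coe
  -- Each test function imposes a condition that is continuous in the L² norms, so weak
  -- differentiability is a closed condition on pairs.
  have : (H1p d : Set (Pair d)) = ⋂ (j : Fin d) (ψ : (Fin d → ℝ) → ℂ) (_ : IsPeriodicTest ψ),
      {p : Pair d | ∫ x, p.fst x * pderivC j ψ x ∂(boxMeasure d) =
        - ∫ x, p.snd j x * ψ x ∂(boxMeasure d)} := by
    ext p
    simp only [Set.mem_iInter]
    rfl
  rw [this]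
  refine isClosed_iInter fun j => isClosed_iInter fun ψ => isClosed_iInter fun hψ => ?_
  refine isClosed_eq ?_ ?_
  · exact (continuous_integral_mul (hψ.continuous_pderiv j)).comp (WithLp.fstL 2 ℂ _ _).continuous
  · exact ((continuous_integral_mul hψ.smooth.continuous).comp
      ((PiLp.proj 2 (fun _ : Fin d => L2 d) j).comp (WithLp.sndL 2 ℂ _ _)).continuous).neg

theorem integral_grad_mul_mode (v : H1p d) (j : Fin d) (k : Freq d) :
    ∫ x, H1p.grad v j x * modeFun (-k) x ∂(boxMeasure d) =
      Complex.I * (k j : ℂ) * ∫ x, H1p.toL2 v x * modeFun (-k) x ∂(boxMeasure d) := by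
  have h := v.2 j _ (isPeriodicTest_modeFun (-k))
  change ∫ x, H1p.toL2 v x * pderivC j (modeFun (-k)) x ∂(boxMeasure d) =
    - ∫ x, H1p.grad v j x * modeFun (-k) x ∂(boxMeasure d) at h
  rw [← neg_eq_iff_eq_neg.2 h, ← integral_const_mul, ← integral_neg]
  refine integral_congr_ae (Eventually.of_forall fun x => ?_)
  simp only [pderivC_modeFun, Pi.neg_apply, Int.cast_neg]
  ring

theorem weight_sq (k : Freq d) : weight k ^ 2 = 1 + ∑ j, (k j : ℝ) ^ 2 := by
  rw [weight, Real.sq_sqrt (by positivity), freqNorm, Real.sq_sqrt (by positivity)]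

theorem weight_pos (k : Freq d) : 0 < weight k := Real.sqrt_pos.2 (by positivity)

/-- Testing the weak derivatives against a mode turns them into factors i k_j, so the gradient terms
contribute |k|² times the same coefficient of v. -/
theorem inner_mode (k : Freq d) (v : H1p d) : inner ℂ (mode k) v =
    (weight k : ℂ) ^ 2 * ∫ x, H1p.toL2 v x * modeFun (-k) x ∂(boxMeasure d) := by
  have h1 : H1p.toL2 (mode k) = modeL2 k := rfl
  have h2 : ∀ j, H1p.grad (mode k) j = (Complex.I * (k j : ℂ)) • modeL2 k := fun j => rfl
  rw [inner_H1p, h1, inner_modeL2]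
  simp only [h2, inner_smul_left, inner_modeL2, integral_grad_mul_mode]
  rw [← Complex.ofReal_pow, weight_sq]
  push_cast
  rw [add_mul, one_mul, Finset.sum_mul]
  congr 1
  refine Finset.sum_congr rfl fun j _ => ?_
  simp only [map_mul, Complex.conj_I, map_intCast]
  linear_combination (-(k j : ℂ) ^ 2 * ∫ x, H1p.toL2 v x * modeFun (-k) x ∂(boxMeasure d)) *
    Complex.I_sq

theorem inner_mode_mode (k l : Freq d) : inner ℂ (mode k) (mode l) =
    if k = l then (weight k : ℂ) ^ 2 else 0 := by
  have h1 : H1p.toL2 (mode l) = modeL2 l := rfl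
  have h2 : ∫ x, H1p.toL2 (mode l) x * modeFun (-k) x ∂(boxMeasure d) =
      ∫ x, modeFun l x * modeFun (-k) x ∂(boxMeasure d) := by
    rw [h1]
    refine integral_congr_ae ?_
    filter_upwards [coeFn_modeL2 l] with x hx
    rw [hx]
  rw [inner_mode, h2, integral_modeFun_mul_neg]
  by_cases h : k = l
  · simp [h]
  · simp [h, Ne.symm h]

/-- The normalized basis functions `φ_k / c_k`. -/
def unitMode (k : Freq d) : H1p d := (weight k : ℂ)⁻¹ • mode k

theorem weight_ne_zero (k : Freq d) : (weight k : ℂ) ≠ 0 := by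
  exact_mod_cast (weight_pos k).ne'

theorem orthonormal_unitMode : Orthonormal ℂ (unitMode (d := d)) := by
  rw [orthonormal_iff_ite]
  intro k l
  rw [unitMode, unitMode, inner_smul_left (𝕜 := ℂ) (E := H1p d),
    inner_smul_right (𝕜 := ℂ) (E := H1p d), inner_mode_mode]
  have := weight_ne_zero k
  split_ifs with h
  · subst h
    rw [map_inv₀, Complex.conj_ofReal]
    field_simp
  · simp

theorem eq_zero_of_inner_unitMode {v : H1p d} (h : ∀ k, inner ℂ (unitMode k) v = 0) : v = 0 := by
  have h0 : ∀ k, ∫ x, H1p.toL2 v x * modeFun k x ∂(boxMeasure d) = 0 := by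
    intro k
    have h1 := h (-k)
    rw [unitMode, inner_smul_left (𝕜 := ℂ) (E := H1p d), inner_mode, neg_neg] at h1
    have h2 := weight_ne_zero (-k)
    have h3 : conj ((weight (-k) : ℂ)⁻¹) ≠ 0 := by simpa using h2
    exact (mul_eq_zero.1 ((mul_eq_zero.1 h1).resolve_left h3)).resolve_left (pow_ne_zero 2 h2)
  have h1 : H1p.toL2 v = 0 := eq_zero_of_forall_integral_mode_eq_zero _ h0
  have h2 : ∀ j, H1p.grad v j = 0 := fun j => eq_zero_of_forall_integral_mode_eq_zero _ fun k => by
    have := integral_grad_mul_mode v j (-k)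
    rwa [neg_neg, h0, mul_zero] at this
  have h3 := norm_sq_H1p v
  simp only [h1, h2, norm_zero] at h3
  simpa using h3

/-- The Hilbert basis `φ_k / c_k` of `H¹_p(Ω)`. -/
def modeBasis (d : ℕ) : HilbertBasis (Freq d) ℂ (H1p d) :=
  HilbertBasis.mkOfOrthogonalEqBot orthonormal_unitMode <| by
    rw [Submodule.eq_bot_iff]
    intro v hv
    refine eq_zero_of_inner_unitMode fun k => ?_
    exact (Submodule.mem_orthogonal _ _).1 hv _ (Submodule.subset_span ⟨k, rfl⟩)

theorem modeBasis_apply (k : Freq d) : modeBasis d k = unitMode k := by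
  rw [modeBasis, HilbertBasis.coe_mkOfOrthogonalEqBot]

/-! ### The operator of the elliptic problem -/

/-- The conditions on a single coefficient. -/
structure IsBddCoeff (m M : ℝ) (ρ : (Fin d → ℝ) → ℝ) : Prop where
  meas : Measurable ρ
  bound : ∀ x ∈ box d, m ≤ ρ x ∧ ρ x ≤ M

theorem ae_mem_box : ∀ᵐ x ∂(boxMeasure d), x ∈ box d := ae_restrict_mem (measurableSet_box d)

namespace IsBddCoeff

variable {m M : ℝ} {ρ : (Fin d → ℝ) → ℝ}

theorem ae_norm_le (h : IsBddCoeff m M ρ) :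
    ∀ᵐ x ∂(boxMeasure d), ‖(ρ x : ℂ)‖ ≤ max |m| |M| := by
  filter_upwards [ae_mem_box] with x hx
  rw [Complex.norm_real, Real.norm_eq_abs]
  exact abs_le_max_abs_abs (h.bound x hx).1 (h.bound x hx).2

theorem memLp_mul (h : IsBddCoeff m M ρ) (v : L2 d) :
    MemLp (fun x => (ρ x : ℂ) * v x) 2 (boxMeasure d) := by
  refine (Lp.memLp v).of_le_mul (c := max |m| |M|) ?_ ?_
  · exact (Complex.measurable_ofReal.comp h.meas).aestronglyMeasurable.mul
      (Lp.aestronglyMeasurable v)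
  · filter_upwards [h.ae_norm_le] with x hx
    rw [norm_mul]
    gcongr

/-- Multiplication by a bounded coefficient on `L²(Ω)`. -/
def mulL (h : IsBddCoeff m M ρ) : L2 d →L[ℂ] L2 d :=
  LinearMap.mkContinuous
    { toFun := fun v => (h.memLp_mul v).toLp _
      map_add' := fun u v => by
        refine Lp.ext ?_
        filter_upwards [(h.memLp_mul (u + v)).coeFn_toLp, (h.memLp_mul u).coeFn_toLp,
          (h.memLp_mul v).coeFn_toLp, Lp.coeFn_add u v,
          Lp.coeFn_add ((h.memLp_mul u).toLp _) ((h.memLp_mul v).toLp _)] with x h1 h2 h3 h4 h5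
        rw [h1, h5, Pi.add_apply, h2, h3, h4, Pi.add_apply, mul_add]
      map_smul' := fun c v => by
        refine Lp.ext ?_
        filter_upwards [(h.memLp_mul (c • v)).coeFn_toLp, (h.memLp_mul v).coeFn_toLp,
          Lp.coeFn_smul c v, Lp.coeFn_smul c ((h.memLp_mul v).toLp _)] with x h1 h2 h3 h4
        rw [RingHom.id_apply, h1, h4, Pi.smul_apply, h2, h3, Pi.smul_apply, smul_eq_mul,
          smul_eq_mul]
        ring } (max |m| |M|) fun v => by
      refine Lp.norm_le_mul_norm_of_ae_le_mul ?_
      filter_upwards [(h.memLp_mul v).coeFn_toLp, h.ae_norm_le] with x h1 h2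
      change ‖((h.memLp_mul v).toLp _ : L2 d) x‖ ≤ _
      rw [h1, norm_mul]
      gcongr

theorem coeFn_mulL (h : IsBddCoeff m M ρ) (v : L2 d) :
    (h.mulL v : (Fin d → ℝ) → ℂ) =ᵐ[boxMeasure d] fun x => (ρ x : ℂ) * v x :=
  (h.memLp_mul v).coeFn_toLp

theorem inner_mulL (h : IsBddCoeff m M ρ) (u v : L2 d) : inner ℂ v (h.mulL u) =
    ∫ x, (ρ x : ℂ) * (u x * conj (v x)) ∂(boxMeasure d) := by
  rw [L2.inner_def]
  refine integral_congr_ae ?_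
  filter_upwards [h.coeFn_mulL u] with x hx
  rw [hx, RCLike.inner_apply, mul_assoc]

theorem integrable (h : IsBddCoeff m M ρ) (u v : L2 d) :
    Integrable (fun x => (ρ x : ℂ) * (u x * conj (v x))) (boxMeasure d) := by
  refine (L2.integrable_inner (𝕜 := ℂ) v (h.mulL u)).congr ?_
  filter_upwards [h.coeFn_mulL u] with x hx
  rw [hx, RCLike.inner_apply, mul_assoc]

theorem re_inner_mulL_self (h : IsBddCoeff m M ρ) (v : L2 d) :
    m * ‖v‖ ^ 2 ≤ (inner ℂ v (h.mulL v)).re ∧ (inner ℂ v (h.mulL v)).re ≤ M * ‖v‖ ^ 2 := by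
  have e : ∀ x, (ρ x : ℂ) * (v x * conj (v x)) = ((ρ x * ‖v x‖ ^ 2 : ℝ) : ℂ) := by
    intro x
    rw [Complex.mul_conj, Complex.normSq_eq_norm_sq]
    push_cast
    rfl
  have hre : (inner ℂ v (h.mulL v)).re = ∫ x, ρ x * ‖v x‖ ^ 2 ∂(boxMeasure d) := by
    rw [inner_mulL]
    simp only [e]
    rw [integral_complex_ofReal, Complex.ofReal_re]
  have hint : Integrable (fun x => ρ x * ‖v x‖ ^ 2) (boxMeasure d) := by
    have := (h.integrable v v).re
    simp only [e] at this
    exact this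
  have hsq : Integrable (fun x => ‖v x‖ ^ 2) (boxMeasure d) := by
    simpa using (Lp.memLp v).integrable_norm_pow two_ne_zero
  have hnorm : ‖v‖ ^ 2 = ∫ x, ‖v x‖ ^ 2 ∂(boxMeasure d) := by
    have h1 : (inner ℂ v v : ℂ) = ∫ x, ((‖v x‖ ^ 2 : ℝ) : ℂ) ∂(boxMeasure d) := by
      rw [L2.inner_def]
      refine integral_congr_ae (Eventually.of_forall fun x => ?_)
      simp only [inner_self_eq_norm_sq_to_K]
      push_cast
      rfl
    rw [inner_self_eq_norm_sq_to_K, integral_complex_ofReal] at h1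
    exact Complex.ofReal_injective (by rw [Complex.ofReal_pow]; exact h1)
  rw [hre, hnorm, ← integral_const_mul, ← integral_const_mul]
  constructor
  · refine integral_mono_ae (hsq.const_mul _) hint ?_
    filter_upwards [ae_mem_box] with x hx
    exact mul_le_mul_of_nonneg_right (h.bound x hx).1 (by positivity)
  · refine integral_mono_ae hint (hsq.const_mul _) ?_
    filter_upwards [ae_mem_box] with x hx
    exact mul_le_mul_of_nonneg_right (h.bound x hx).2 (by positivity)

theorem inner_mulL_conj (h : IsBddCoeff m M ρ) (u v : L2 d) :
    inner ℂ (h.mulL u) v = inner ℂ u (h.mulL v) := by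
  rw [← inner_conj_symm, inner_mulL, inner_mulL, ← integral_conj]
  refine integral_congr_ae (Eventually.of_forall fun x => ?_)
  simp only [map_mul, Complex.conj_ofReal, Complex.conj_conj]
  ring

end IsBddCoeff

theorem exists_sum_adjoint_comp {ι E F : Type*} [Fintype ι] [NormedAddCommGroup E]
    [InnerProductSpace ℂ E] [CompleteSpace E] [NormedAddCommGroup F] [InnerProductSpace ℂ F]
    [CompleteSpace F] (G : ι → E →L[ℂ] F) (N : ι → F →L[ℂ] F) :
    ∃ S : E →L[ℂ] E, ∀ u v, inner ℂ v (S u) = ∑ i, inner ℂ (G i v) (N i (G i u)) := by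
  refine ⟨∑ i, (ContinuousLinearMap.adjoint (G i)).comp ((N i).comp (G i)), fun u v => ?_⟩
  simp only [sum_apply, ContinuousLinearMap.comp_apply, inner_sum,
    ContinuousLinearMap.adjoint_inner_right]

/-- The bounded self-adjoint coercive operator on `H¹_p(Ω)` that represents the form. -/
theorem exists_form_operator {νl νu σl σu : ℝ} {ν σ : (Fin d → ℝ) → ℝ}
    (h : IsCoeff νl νu σl σu ν σ) : ∃ S : H1p d →L[ℂ] H1p d,
      (∀ u v, form ν σ u v = inner ℂ v (S u)) ∧ (∀ u v, inner ℂ (S u) v = inner ℂ u (S v)) ∧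
      (∀ v, min νl σl * ‖v‖ ^ 2 ≤ (inner ℂ v (S v)).re) ∧
      ∀ v, (inner ℂ v (S v)).re ≤ max νu σu * ‖v‖ ^ 2 := by
  have hν : IsBddCoeff νl νu ν := ⟨h.meas_ν, h.bound_ν⟩
  have hσ : IsBddCoeff σl σu σ := ⟨h.meas_σ, h.bound_σ⟩
  -- The index `none` stands for the function itself with coefficient σ, and `some j` for ∂_j with
  -- coefficient ν.
  obtain ⟨S, hS₀⟩ := exists_sum_adjoint_comp (E := H1p d) (F := L2 d)
    (fun i : Option (Fin d) => i.elim (toL2L d) gradL) fun i => i.elim hσ.mulL fun _ => hν.mulL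
  have hS : ∀ u v, inner ℂ v (S u) = ∑ j, inner ℂ (H1p.grad v j) (hν.mulL (H1p.grad u j)) +
      inner ℂ (H1p.toL2 v) (hσ.mulL (H1p.toL2 u)) := by
    intro u v
    rw [hS₀, Fintype.sum_option, add_comm]
    rfl
  have hS' : ∀ u v, inner ℂ (S u) v = inner ℂ u (S v) := by
    intro u v
    rw [← inner_conj_symm (𝕜 := ℂ) (E := H1p d), hS, hS, map_add, map_sum]
    simp only [inner_conj_symm, IsBddCoeff.inner_mulL_conj]
  refine ⟨S, fun u v => ?_, hS', fun v => ?_, fun v => ?_⟩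
  · rw [hS, form, hσ.inner_mulL]
    simp only [hν.inner_mulL, Finset.mul_sum]
    rw [integral_finsetSum _ fun j _ => hν.integrable _ _]
  · rw [hS, Complex.add_re, Complex.re_sum, norm_sq_H1p, mul_add, Finset.mul_sum, add_comm]
    refine add_le_add (Finset.sum_le_sum fun j _ => ?_) ?_
    · exact (mul_le_mul_of_nonneg_right (min_le_left _ _) (by positivity)).trans
        (hν.re_inner_mulL_self _).1
    · exact (mul_le_mul_of_nonneg_right (min_le_right _ _) (by positivity)).trans
        (hσ.re_inner_mulL_self _).1
  · rw [hS, Complex.add_re, Complex.re_sum, norm_sq_H1p, mul_add, Finset.mul_sum, add_comm]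
    refine add_le_add ?_ (Finset.sum_le_sum fun j _ => ?_)
    · exact (hσ.re_inner_mulL_self _).2.trans
        (mul_le_mul_of_nonneg_right (le_max_right _ _) (by positivity))
    · exact (hν.re_inner_mulL_self _).2.trans
        (mul_le_mul_of_nonneg_right (le_max_left _ _) (by positivity))

end AFG

end

noncomputable section

namespace AFG

/-! ### Coercive symmetric operators on a Hilbert space -/

section Hilbert

variable {H : Type*} [NormedAddCommGroup H] [InnerProductSpace ℂ H]

/-- A symmetric operator with `m ≤ T ≤ M` in the sense of quadratic forms. -/
structure IsBetween (m M : ℝ) (T : H →L[ℂ] H) : Prop where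
  symm : ∀ u v, inner ℂ (T u) v = inner ℂ u (T v)
  lower : ∀ v, m * ‖v‖ ^ 2 ≤ (inner ℂ v (T v)).re
  upper : ∀ v, (inner ℂ v (T v)).re ≤ M * ‖v‖ ^ 2

theorem re_inner_self_eq (v : H) : (inner ℂ v v : ℂ).re = ‖v‖ ^ 2 := by
  rw [inner_self_eq_norm_sq_to_K, ← Complex.ofReal_re (‖v‖ ^ 2)]
  push_cast
  rfl

theorem re_inner_comm (u v : H) : (inner ℂ u v).re = (inner ℂ v u : ℂ).re := by
  rw [← inner_conj_symm, Complex.conj_re]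

theorem re_inner_le (u v : H) : (inner ℂ u v : ℂ).re ≤ ‖u‖ * ‖v‖ :=
  (Complex.re_le_norm _).trans (norm_inner_le_norm _ _)

namespace IsBetween

variable {m M : ℝ} {T : H →L[ℂ] H}

theorem re_symm (h : IsBetween m M T) (u v : H) :
    (inner ℂ u (T v)).re = (inner ℂ v (T u) : ℂ).re := by
  rw [← h.symm, re_inner_comm]

theorem sub_smul (h : IsBetween m M T) (c : ℝ) : IsBetween (m - c) (M - c) (T - (c : ℂ) • 1) := by
  have e : ∀ v, (inner ℂ v ((T - (c : ℂ) • 1) v)).re = (inner ℂ v (T v)).re - c * ‖v‖ ^ 2 := by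
    intro v
    rw [sub_apply, smul_apply, one_apply_eq_self, inner_sub_right,
      inner_smul_right, Complex.sub_re, Complex.re_ofReal_mul, re_inner_self_eq]
  refine ⟨fun u v => ?_, fun v => ?_, fun v => ?_⟩
  · rw [sub_apply, sub_apply, inner_sub_left, inner_sub_right, h.symm]
    simp only [smul_apply, one_apply_eq_self, inner_smul_left, inner_smul_right,
      Complex.conj_ofReal]
  · rw [e, sub_mul]
    linarith [h.lower v]
  · rw [e, sub_mul]
    linarith [h.upper v]

theorem neg (h : IsBetween m M T) : IsBetween (-M) (-m) (-T) := by
  refine ⟨fun u v => ?_, fun v => ?_, fun v => ?_⟩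
  · simp [h.symm]
  · simpa using h.upper v
  · simpa using h.lower v

theorem re_expand (h : IsBetween m M T) (u v : H) (t : ℝ) :
    (inner ℂ (u + (t : ℂ) • v) (T (u + (t : ℂ) • v))).re = (inner ℂ u (T u)).re +
      2 * t * (inner ℂ u (T v)).re + t ^ 2 * (inner ℂ v (T v)).re := by
  simp only [map_add, map_smul, inner_add_left, inner_add_right, inner_smul_left, inner_smul_right,
    Complex.add_re, Complex.conj_ofReal, Complex.re_ofReal_mul]
  rw [h.re_symm v u]
  ring

theorem re_inner_sq_le (h : IsBetween m M T) (hm : 0 ≤ m) (u v : H) :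
    (inner ℂ u (T v)).re ^ 2 ≤ (inner ℂ u (T u)).re * (inner ℂ v (T v)).re := by
  have hd := discrim_le_zero (a := (inner ℂ v (T v) : ℂ).re) (b := 2 * (inner ℂ u (T v) : ℂ).re)
    (c := (inner ℂ u (T u) : ℂ).re) fun t => by
      have h1 := h.re_expand u v t
      have h2 := (mul_nonneg hm (sq_nonneg _)).trans (h.lower (u + (t : ℂ) • v))
      rw [h1] at h2
      linarith
  rw [discrim] at hd
  linarith

/-- The operator inequality T² ≤ M T, obtained from nonnegativity of the form at v - M⁻¹ T v. -/
theorem norm_sq_le (h : IsBetween 0 M T) (hM : 0 < M) (v : H) :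
    ‖T v‖ ^ 2 ≤ M * (inner ℂ v (T v)).re := by
  have h1 := h.re_expand v (T v) (-M⁻¹)
  have h2 := h.lower (v + ((-M⁻¹ : ℝ) : ℂ) • T v)
  have h3 := h.upper (T v)
  rw [h1, zero_mul] at h2
  have h4 : (inner ℂ v (T (T v)) : ℂ).re = ‖T v‖ ^ 2 := by
    rw [← h.symm, re_inner_self_eq]
  rw [h4] at h2
  have h5 : (-M⁻¹) ^ 2 * (inner ℂ (T v) (T (T v)) : ℂ).re ≤ M⁻¹ * ‖T v‖ ^ 2 := by
    calc _ ≤ (-M⁻¹) ^ 2 * (M * ‖T v‖ ^ 2) := by gcongr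
      _ = _ := by field_simp
  have h6 : M⁻¹ * ‖T v‖ ^ 2 ≤ (inner ℂ v (T v) : ℂ).re := by linarith
  rwa [inv_mul_le_iff₀ hM] at h6

theorem norm_one_sub_smul_lt (h : IsBetween m M T) (hm : 0 < m) :
    ∃ t : ℝ, 0 < t ∧ ‖1 - (t : ℂ) • T‖ < 1 := by
  -- Any K > 0 with K ≥ ‖T‖ and K ≥ m would do. The choice t = m/K² minimizes 1 - 2tm + t²K², with
  -- value 1 - (m/K)².
  set K := ‖T‖ + m with hK
  have hK0 : 0 < K := by positivity
  set t := m / K ^ 2 with ht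
  have ht0 : 0 < t := by positivity
  have hmK : (m / K) ^ 2 ≤ 1 := by
    apply pow_le_one₀ (by positivity)
    rw [div_le_one hK0, hK]
    linarith [norm_nonneg T]
  refine ⟨t, ht0, ?_⟩
  have hbound : ‖1 - (t : ℂ) • T‖ ≤ Real.sqrt (1 - (m / K) ^ 2) := by
    refine ContinuousLinearMap.opNorm_le_bound _ (Real.sqrt_nonneg _) fun v => ?_
    refine abs_le_of_sq_le_sq' ?_ (by positivity) |>.2
    rw [mul_pow, Real.sq_sqrt (by linarith)]
    have e : ‖(1 - (t : ℂ) • T) v‖ ^ 2 =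
        ‖v‖ ^ 2 - 2 * t * (inner ℂ v (T v)).re + t ^ 2 * ‖T v‖ ^ 2 := by
      rw [sub_apply, smul_apply, one_apply_eq_self, ← re_inner_self_eq, inner_sub_left,
        inner_sub_right, inner_sub_right, inner_smul_left, inner_smul_left, inner_smul_right,
        inner_smul_right]
      simp only [Complex.sub_re, Complex.conj_ofReal, Complex.re_ofReal_mul, re_inner_self_eq]
      rw [re_inner_comm (T v) v]
      ring
    have h1 := h.lower v
    have h2 : ‖T v‖ ^ 2 ≤ K ^ 2 * ‖v‖ ^ 2 := by
      rw [← mul_pow]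
      gcongr
      exact (T.le_opNorm v).trans (by gcongr; linarith)
    rw [e]
    have h3 : t ^ 2 * ‖T v‖ ^ 2 ≤ t ^ 2 * (K ^ 2 * ‖v‖ ^ 2) := by gcongr
    have h4 : t * (m * ‖v‖ ^ 2) ≤ t * (inner ℂ v (T v) : ℂ).re := by gcongr
    have h5 : t ^ 2 * (K ^ 2 * ‖v‖ ^ 2) = (m / K) ^ 2 * ‖v‖ ^ 2 := by
      rw [ht]; field_simp
    have h6 : t * (m * ‖v‖ ^ 2) = (m / K) ^ 2 * ‖v‖ ^ 2 := by
      rw [ht]; field_simp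
    linarith
  refine hbound.trans_lt ?_
  rw [Real.sqrt_lt' one_pos]
  have : 0 < (m / K) ^ 2 := by positivity
  linarith

theorem exists_inverse [CompleteSpace H] (h : IsBetween m M T) (hm : 0 < m) :
    ∃ X : H →L[ℂ] H, T * X = 1 ∧ X * T = 1 := by
  obtain ⟨t, ht, hlt⟩ := h.norm_one_sub_smul_lt hm
  have h1 := isUnit_one_sub_of_norm_lt_one hlt
  rw [sub_sub_cancel] at h1
  obtain ⟨u, hu⟩ := h1
  refine ⟨(t : ℂ) • (↑u⁻¹ : H →L[ℂ] H), ?_, ?_⟩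
  · rw [mul_smul_comm, ← smul_mul_assoc, ← hu, Units.mul_inv]
  · rw [smul_mul_assoc, ← mul_smul_comm, ← hu, Units.inv_mul]

theorem inverse (h : IsBetween m M T) (hm : 0 < m) (hM : 0 < M) {X : H →L[ℂ] H}
    (hTX : T * X = 1) : IsBetween M⁻¹ m⁻¹ X := by
  have hTX' : ∀ v, T (X v) = v := fun v => by
    have := congrArg (fun L : H →L[ℂ] H => L v) hTX
    simpa using this
  have h0 : IsBetween 0 M T :=
    ⟨h.symm, fun v => by
      rw [zero_mul]; exact (mul_nonneg hm.le (sq_nonneg _)).trans (h.lower v), h.upper⟩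
  refine ⟨fun u v => ?_, fun v => ?_, fun v => ?_⟩
  · conv_lhs => rw [← hTX' v]
    conv_rhs => rw [← hTX' u]
    rw [h.symm]
  · have := h0.norm_sq_le hM (X v)
    rw [hTX', re_inner_comm] at this
    rwa [inv_mul_le_iff₀ hM]
  · have h1 := h.lower (X v)
    rw [hTX', re_inner_comm] at h1
    have h2 := re_inner_le v (X v)
    have h3 : m * ‖X v‖ ≤ ‖v‖ := by
      rcases (norm_nonneg (X v)).eq_or_lt with h0 | h0
      · rw [← h0]; simp
      · have : m * ‖X v‖ * ‖X v‖ ≤ ‖v‖ * ‖X v‖ := by nlinarith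
        exact le_of_mul_le_mul_right this h0
    rw [le_inv_mul_iff₀ hm]
    nlinarith [norm_nonneg v]

theorem eq_smul_one (h : IsBetween m m T) : T = (m : ℂ) • 1 := by
  have h1 := h.sub_smul m
  rw [sub_self] at h1
  have h2 : IsBetween 0 1 (T - (m : ℂ) • 1) := ⟨h1.symm, h1.lower, fun v => by
    have := h1.upper v
    rw [zero_mul] at this
    exact this.trans (by positivity)⟩
  rw [← sub_eq_zero]
  ext v
  have h3 := h2.norm_sq_le one_pos v
  have h4 := h1.upper v
  rw [zero_mul] at h4
  have : ‖(T - (m : ℂ) • 1) v‖ ^ 2 ≤ 0 := by linarith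
  have := pow_eq_zero_iff (two_ne_zero) |>.1 (le_antisymm this (sq_nonneg _))
  simpa using this

end IsBetween

/-- The energy norm of a symmetric operator. -/
def opEnergy (T : H →L[ℂ] H) (v : H) : ℝ := Real.sqrt (inner ℂ v (T v)).re

namespace IsBetween

variable {m M : ℝ} {T : H →L[ℂ] H}

theorem _root_.AFG.opEnergy_nonneg (T : H →L[ℂ] H) (v : H) : 0 ≤ opEnergy T v :=
  Real.sqrt_nonneg _

theorem re_nonneg (h : IsBetween m M T) (hm : 0 ≤ m) (v : H) : 0 ≤ (inner ℂ v (T v)).re :=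
  (mul_nonneg hm (sq_nonneg _)).trans (h.lower v)

theorem opEnergy_sq (h : IsBetween m M T) (hm : 0 ≤ m) (v : H) :
    opEnergy T v ^ 2 = (inner ℂ v (T v)).re := Real.sq_sqrt (h.re_nonneg hm v)

theorem opEnergy_add_le (h : IsBetween m M T) (hm : 0 ≤ m) (u v : H) :
    opEnergy T (u + v) ≤ opEnergy T u + opEnergy T v := by
  refine Real.sqrt_le_iff.2 ⟨add_nonneg (opEnergy_nonneg _ _) (opEnergy_nonneg _ _), ?_⟩
  have h1 := h.re_expand u v 1
  rw [Complex.ofReal_one, one_smul] at h1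
  rw [h1, add_sq, h.opEnergy_sq hm, h.opEnergy_sq hm]
  have h2 : (inner ℂ u (T v) : ℂ).re ≤ opEnergy T u * opEnergy T v := by
    refine (le_abs_self _).trans (abs_le_of_sq_le_sq ?_
      (mul_nonneg (opEnergy_nonneg _ _) (opEnergy_nonneg _ _)))
    rw [mul_pow, h.opEnergy_sq hm, h.opEnergy_sq hm]
    exact h.re_inner_sq_le hm u v
  linarith

theorem opEnergy_le (h : IsBetween m M T) (v : H) : opEnergy T v ≤ Real.sqrt M * ‖v‖ := by
  rw [← Real.sqrt_sq (norm_nonneg v), ← Real.sqrt_mul' _ (sq_nonneg _)]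
  exact Real.sqrt_le_sqrt (h.upper v)

theorem le_opEnergy (h : IsBetween m M T) (v : H) : Real.sqrt m * ‖v‖ ≤ opEnergy T v := by
  rw [← Real.sqrt_sq (norm_nonneg v), ← Real.sqrt_mul' _ (sq_nonneg _)]
  exact Real.sqrt_le_sqrt (h.lower v)

theorem norm_apply_le (h : IsBetween m M T) (hm : 0 ≤ m) (hM : 0 < M) (v : H) :
    ‖T v‖ ≤ Real.sqrt M * opEnergy T v := by
  have h0 : IsBetween 0 M T :=
    ⟨h.symm, fun v => by rw [zero_mul]; exact h.re_nonneg hm v, h.upper⟩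
  refine abs_le_of_sq_le_sq' ?_ (mul_nonneg (Real.sqrt_nonneg _) (opEnergy_nonneg _ _)) |>.2
  rw [mul_pow, Real.sq_sqrt hM.le, h.opEnergy_sq hm]
  exact h0.norm_sq_le hM v

end IsBetween

/-- The quotient by which the quadratic form of `X` on the unmarked part of a residual improves
the product of the extreme bounds. -/
def improvement (m M τ : ℝ) : ℝ :=
  max (1 / 2) (max (1 - (M - m) * τ / (64 * M)) (m / (m + (M - m) * τ / 4)))

theorem improvement_pos (m M τ : ℝ) : 0 < improvement m M τ :=
  lt_max_of_lt_left (by norm_num)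

theorem improvement_lt_one {m M τ : ℝ} (hm : 0 < m) (hmM : m < M) (hτ : 0 < τ) :
    improvement m M τ < 1 := by
  have h1 : 0 < (M - m) * τ := mul_pos (by linarith) hτ
  have hM : 0 < M := by linarith
  refine max_lt (by norm_num) (max_lt ?_ ?_)
  · have : 0 < (M - m) * τ / (64 * M) := by positivity
    linarith
  · rw [div_lt_one (by positivity)]
    linarith

/-- The bound without the factor chains three estimates: X ≤ M at q, ‖q‖² ≤ τ‖r‖², and m ≤ X at r.
They cannot all be sharp, because q near the top of the spectrum and r near the bottom would be
nearly orthogonal. The three terms of the maximum are the gains from whichever estimate is not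
sharp. -/
theorem IsBetween.re_inner_le_improvement {m M τ : ℝ} {X : H →L[ℂ] H} (h : IsBetween m M X)
    (hm : 0 < m) (hmM : m < M) (hτ : 0 < τ) {r q : H} (hq : ‖q‖ ^ 2 ≤ τ * ‖r‖ ^ 2)
    (hrq : (inner ℂ r q).re = ‖q‖ ^ 2) :
    (inner ℂ q (X q)).re ≤ improvement m M τ * (M / m * τ * (inner ℂ r (X r)).re) := by
  have hM : 0 < M := by linarith
  set b := M - m with hb
  have hb0 : 0 < b := by linarith
  set R := ‖r‖ ^ 2 with hR
  set x := ‖q‖ ^ 2 with hx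
  have hR0 : 0 ≤ R := sq_nonneg _
  have hx0 : 0 ≤ x := sq_nonneg _
  have hlow : m * R ≤ (inner ℂ r (X r)).re := h.lower r
  have hup : (inner ℂ q (X q)).re ≤ M * x := h.upper q
  set η := improvement m M τ with hη
  have hη1 : 1 / 2 ≤ η := le_max_left _ _
  have hη2 : 1 - b * τ / (64 * M) ≤ η := (le_max_left _ _).trans (le_max_right _ _)
  have hη3 : m / (m + b * τ / 4) ≤ η := (le_max_right _ _).trans (le_max_right _ _)
  have hη0 : 0 < η := improvement_pos _ _ _
  have hbase : M * τ * R ≤ M / m * τ * (inner ℂ r (X r)).re := by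
    calc M * τ * R = M / m * τ * (m * R) := by field_simp
      _ ≤ _ := by gcongr
  rcases le_total x (τ * R / 2) with hcase | hcase
  · calc (inner ℂ q (X q)).re ≤ M * (τ * R / 2) := hup.trans (by gcongr)
      _ = 1 / 2 * (M * τ * R) := by ring
      _ ≤ _ := by gcongr
  -- The slack in the estimate X ≤ M at q. If it is large, this alone is the gain; if small, q is
  -- almost an eigenvector for M.
  set g := M * x - (inner ℂ q (X q)).re with hg
  rcases le_total (b * τ ^ 2 / 64 * R) g with hcase' | hcase'
  · calc (inner ℂ q (X q)).re = M * x - g := by rw [hg]; ring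
      _ ≤ M * (τ * R) - b * τ ^ 2 / 64 * R := by gcongr
      _ = (1 - b * τ / (64 * M)) * (M * τ * R) := by field_simp
      _ ≤ η * (M * τ * R) := by gcongr
      _ ≤ _ := by gcongr
  · have hY := h.sub_smul m
    rw [sub_self] at hY
    have hZ := (h.sub_smul M).neg
    rw [sub_self, neg_zero, neg_sub] at hZ
    set z := (-(X - (M : ℂ) • 1)) q with hz
    have hzq : z = (M : ℂ) • q - X q := by simp [hz]
    have hgz : (inner ℂ q z).re = g := by
      rw [hzq, inner_sub_right, inner_smul_right, Complex.sub_re, Complex.re_ofReal_mul,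
        re_inner_self_eq]
    have hznorm : ‖z‖ ≤ b * τ / 8 * ‖r‖ := by
      refine abs_le_of_sq_le_sq' ?_ (by positivity) |>.2
      have := hZ.norm_sq_le hb0 q
      rw [← hz, hgz] at this
      calc ‖z‖ ^ 2 ≤ b * g := this
        _ ≤ b * (b * τ ^ 2 / 64 * R) := by gcongr
        _ = _ := by rw [hR]; ring
    have hrz : (inner ℂ r z).re ≤ b * τ / 8 * R := by
      calc (inner ℂ r z).re ≤ ‖r‖ * ‖z‖ := re_inner_le r z
        _ ≤ ‖r‖ * (b * τ / 8 * ‖r‖) := by gcongr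
        _ = _ := by rw [hR]; ring
    have hYq : (X - (m : ℂ) • 1) q = (b : ℂ) • q - z := by
      rw [hzq, hb]
      simp [_root_.sub_smul]
    -- With (X - m)q = (M-m)q - z and z small, the nonnegative form of X - m at r - q bounds ⟨r, X
    -- r⟩ from below. The hypothesis ⟨r,q⟩ = ‖q‖² > τ‖r‖²/2, up to equality, yields the excess
    -- (M-m)τ/4 over m.
    have hexp := hY.re_expand r q (-1)
    have hpos := hY.lower (r + ((-1 : ℝ) : ℂ) • q)
    rw [zero_mul, hexp] at hpos
    have e1 : (inner ℂ r ((X - (m : ℂ) • 1) q)).re = b * x - (inner ℂ r z).re := by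
      rw [hYq, inner_sub_right, inner_smul_right, Complex.sub_re, Complex.re_ofReal_mul, hrq]
    have e2 : (inner ℂ q ((X - (m : ℂ) • 1) q)).re = b * x - g := by
      rw [hYq, inner_sub_right, inner_smul_right, Complex.sub_re, Complex.re_ofReal_mul,
        re_inner_self_eq, hgz]
    have e3 : (inner ℂ r ((X - (m : ℂ) • 1) r)).re = (inner ℂ r (X r)).re - m * R := by
      rw [sub_apply, smul_apply, one_apply_eq_self, inner_sub_right,
        inner_smul_right, Complex.sub_re, Complex.re_ofReal_mul, re_inner_self_eq]
    rw [e1, e2, e3] at hpos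
    have hg0 : 0 ≤ g := by linarith
    have hfin : (m + b * τ / 4) * R ≤ (inner ℂ r (X r)).re := by nlinarith
    calc (inner ℂ q (X q)).re ≤ M * (τ * R) := hup.trans (by gcongr)
      _ = m / (m + b * τ / 4) * (M / m * τ * ((m + b * τ / 4) * R)) := by field_simp
      _ ≤ η * (M / m * τ * (inner ℂ r (X r)).re) := by gcongr

end Hilbert

end AFG

end

noncomputable section

namespace AFG

/-! ### The error reduction estimate -/

theorem rhoBar_nonneg (α β θ : ℝ) : 0 ≤ rhoBar α β θ :=
  mul_nonneg (Real.sqrt_nonneg _) (Real.sqrt_nonneg _)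

theorem rhoBar_sq {α β θ : ℝ} (hα : 0 < α) (hβ : 0 < β) (hθ : 0 ≤ 1 - θ ^ 2) :
    rhoBar α β θ ^ 2 = β / α * (1 - θ ^ 2) := by
  rw [rhoBar, mul_pow, Real.sq_sqrt (by positivity), Real.sq_sqrt hθ]

/-- Explains the threshold: a truncation error of this size costs, in energy, the same factor as the
unmarked residual. -/
theorem mul_threshold {α β θ : ℝ} (hα : 0 < α) (hβ : 0 < β) (hθ : 0 ≤ 1 - θ ^ 2) :
    β * threshold α β θ = rhoBar α β θ := by
  have h1 : 0 ≤ β * threshold α β θ := mul_nonneg hβ.le (Real.sqrt_nonneg _)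
  rw [← sq_eq_sq₀ h1 (rhoBar_nonneg _ _ _), rhoBar_sq hα hβ hθ, mul_pow, threshold,
    Real.sq_sqrt (by positivity)]
  field_simp

section Hilbert

variable {H : Type*} [NormedAddCommGroup H] [InnerProductSpace ℂ H]
variable {α β θ : ℝ} {A X : H →L[ℂ] H}

theorem apply_apply_of_mul_eq_one {S T : H →L[ℂ] H} (h : S * T = 1) (v : H) : S (T v) = v := by
  have := congrArg (fun L : H →L[ℂ] H => L v) h
  simpa using this

theorem re_inner_inverse_eq (h : IsBetween α β A) (hα : 0 ≤ α) (hXA : X * A = 1) (e : H) :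
    (inner ℂ (A e) (X (A e))).re = opEnergy A e ^ 2 := by
  rw [apply_apply_of_mul_eq_one hXA, re_inner_comm, h.opEnergy_sq hα]

theorem opEnergy_inverse_sq (h : IsBetween α β A) (hα : 0 ≤ α) (hAX : A * X = 1) (q : H) :
    opEnergy A (X q) ^ 2 = (inner ℂ q (X q)).re := by
  rw [h.opEnergy_sq hα, apply_apply_of_mul_eq_one hAX, re_inner_comm]

/-- The energy of X q is ⟨q, X q⟩ ≤ α⁻¹‖q‖², and ‖A e‖² is at most β times the squared energy of e;
together they give the condition number in ρ̄. -/
theorem opEnergy_inverse_le (h : IsBetween α β A) (hα : 0 < α) (hβ : 0 < β) (hAX : A * X = 1)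
    (hθ : 0 ≤ 1 - θ ^ 2) {e q : H} (hq : ‖q‖ ^ 2 ≤ (1 - θ ^ 2) * ‖A e‖ ^ 2) :
    opEnergy A (X q) ≤ rhoBar α β θ * opEnergy A e := by
  refine abs_le_of_sq_le_sq' ?_ (mul_nonneg (rhoBar_nonneg _ _ _) (opEnergy_nonneg _ _)) |>.2
  rw [opEnergy_inverse_sq h hα.le hAX, mul_pow, rhoBar_sq hα hβ hθ]
  have h1 := (h.inverse hα hβ hAX).upper q
  have h2 : ‖A e‖ ^ 2 ≤ β * opEnergy A e ^ 2 := by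
    have := h.norm_apply_le hα.le hβ e
    calc ‖A e‖ ^ 2 ≤ (Real.sqrt β * opEnergy A e) ^ 2 := by gcongr
      _ = _ := by rw [mul_pow, Real.sq_sqrt hβ.le]
  calc _ ≤ α⁻¹ * ‖q‖ ^ 2 := h1
    _ ≤ α⁻¹ * ((1 - θ ^ 2) * (β * opEnergy A e ^ 2)) := by
      gcongr
      exact hq.trans (by gcongr)
    _ = _ := by ring

theorem opEnergy_inverse_le_improvement (h : IsBetween α β A) (hα : 0 < α) (hαβ : α < β)
    (hAX : A * X = 1) (hXA : X * A = 1) (hθ : 0 < 1 - θ ^ 2) {e q : H}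
    (hq : ‖q‖ ^ 2 ≤ (1 - θ ^ 2) * ‖A e‖ ^ 2) (hrq : (inner ℂ (A e) q).re = ‖q‖ ^ 2) :
    opEnergy A (X q) ≤
      Real.sqrt (improvement β⁻¹ α⁻¹ (1 - θ ^ 2)) * rhoBar α β θ * opEnergy A e := by
  have hβ : 0 < β := by linarith
  refine abs_le_of_sq_le_sq' ?_ (mul_nonneg (mul_nonneg (Real.sqrt_nonneg _)
    (rhoBar_nonneg _ _ _)) (opEnergy_nonneg _ _)) |>.2
  rw [opEnergy_inverse_sq h hα.le hAX, mul_pow, mul_pow, rhoBar_sq hα hβ hθ.le,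
    Real.sq_sqrt (improvement_pos _ _ _).le]
  have h1 := (h.inverse hα hβ hAX).re_inner_le_improvement (by positivity)
    ((inv_lt_inv₀ hβ hα).2 hαβ) hθ hq hrq
  rw [re_inner_inverse_eq h hα.le hXA] at h1
  refine h1.trans (le_of_eq ?_)
  field_simp

theorem opEnergy_perturbation_le (h : IsBetween α β A) (hα : 0 ≤ α) (hβ : 0 < β) {e t : H} {ε : ℝ}
    (hε : 0 ≤ ε) (ht : ‖t‖ ≤ ε * ‖A e‖) : opEnergy A t ≤ β * ε * opEnergy A e := by
  calc opEnergy A t ≤ Real.sqrt β * (ε * ‖A e‖) := (h.opEnergy_le t).trans (by gcongr)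
    _ ≤ Real.sqrt β * (ε * (Real.sqrt β * opEnergy A e)) := by
      gcongr
      exact h.norm_apply_le hα hβ e
    _ = Real.sqrt β * Real.sqrt β * ε * opEnergy A e := by ring
    _ = _ := by rw [Real.mul_self_sqrt hβ.le]

/-- Best approximation by Galerkin solutions in the energy norm. -/
theorem opEnergy_galerkin_le (h : IsBetween α β A) (hα : 0 ≤ α) {K : Submodule ℂ H} {u w v : H}
    (hw : w ∈ K) (hv : v ∈ K) (hort : ∀ z ∈ K, inner ℂ z (A (u - w)) = 0) :
    opEnergy A (u - w) ≤ opEnergy A (u - v) := by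
  refine Real.sqrt_le_sqrt ?_
  have h1 := h.re_expand (u - w) (w - v) 1
  rw [Complex.ofReal_one, one_smul, sub_add_sub_cancel, h.re_symm (u - w) (w - v),
    hort _ (K.sub_mem hw hv), Complex.zero_re] at h1
  rw [h1]
  linarith [h.re_nonneg hα (w - v)]

/-- Existence of Galerkin solutions. -/
theorem exists_galerkin (h : IsBetween α β A) (hα : 0 < α) (K : Submodule ℂ H)
    [FiniteDimensional ℂ K] (F : H) : ∃ w ∈ K, ∀ v ∈ K, inner ℂ v (A w) = inner ℂ v F := by
  have : CompleteSpace K := FiniteDimensional.complete ℂ K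
  let T : K →L[ℂ] K := K.orthogonalProjectionOnto.comp (A.comp K.subtypeL)
  have e : ∀ (u : K) (x : H), inner ℂ u (K.orthogonalProjectionOnto x) = inner ℂ (u : H) x :=
    fun u x => by simp
  have eT : ∀ u v : K, inner ℂ u (T v) = inner ℂ (u : H) (A (v : H)) := fun u v => e u _
  have hT : IsBetween α β T := by
    refine ⟨fun u v => ?_, fun v => ?_, fun v => ?_⟩
    · rw [eT, ← inner_conj_symm, eT, inner_conj_symm, h.symm]
    · rw [eT]; exact h.lower (v : H)
    · rw [eT]; exact h.upper (v : H)
  obtain ⟨X, hTX, -⟩ := hT.exists_inverse hα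
  refine ⟨X (K.orthogonalProjectionOnto F), Submodule.coe_mem _, fun v hv => ?_⟩
  have h1 := eT ⟨v, hv⟩ (X (K.orthogonalProjectionOnto F))
  rw [apply_apply_of_mul_eq_one hTX, e] at h1
  exact h1.symm

theorem exists_functional (R : H) : ∃ r : H →L⋆[ℂ] ℂ, ∀ v, r v = inner ℂ v R :=
  ⟨innerSLFlip ℂ R, fun v => by simp⟩

theorem exists_riesz [CompleteSpace H] (r : H →L⋆[ℂ] ℂ) : ∃ R : H, ∀ v, r v = inner ℂ v R := by
  let L : H →L[ℂ] ℂ :=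
    { toFun := fun v => conj (r v)
      map_add' := fun u v => by simp
      map_smul' := fun c v => by simp
      cont := Complex.continuous_conj.comp r.continuous }
  refine ⟨(InnerProductSpace.toDual ℂ H).symm L, fun v => ?_⟩
  rw [← inner_conj_symm, InnerProductSpace.toDual_symm_apply]
  simp [L]

theorem norm_functional {r : H →L⋆[ℂ] ℂ} {R : H} (h : ∀ v, r v = inner ℂ v R) : ‖r‖ = ‖R‖ := by
  refine le_antisymm (r.opNorm_le_bound (norm_nonneg _) fun v => ?_) ?_
  · rw [h, mul_comm]
    exact norm_inner_le_norm v R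
  · have h1 := r.le_opNorm R
    rw [h, inner_self_eq_norm_sq_to_K] at h1
    rcases (norm_nonneg R).eq_or_lt with h0 | h0
    · rw [← h0]; exact norm_nonneg _
    · have : ‖R‖ * ‖R‖ ≤ ‖r‖ * ‖R‖ := by
        simpa [sq] using h1
      exact le_of_mul_le_mul_right this h0

end Hilbert

/-! ### Bulk chasing in `ℓ²` -/

variable {d : ℕ}

/-- The restriction of a sequence to a finite set of frequencies. -/
def proj (D : Finset (Freq d)) (x : Ell2 d) : Ell2 d := ∑ k ∈ D, lp.single 2 k (x k)

theorem norm_proj_sq (D : Finset (Freq d)) (x : Ell2 d) :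
    ‖proj D x‖ ^ 2 = ∑ k ∈ D, ‖x k‖ ^ 2 := by
  have := lp.norm_sum_single (p := 2) (by norm_num) (fun k => x k) D
  simpa [proj] using this

theorem norm_proj_le (D : Finset (Freq d)) (x : Ell2 d) : ‖proj D x‖ ≤ ‖x‖ := by
  refine abs_le_of_sq_le_sq' ?_ (norm_nonneg _) |>.2
  rw [norm_proj_sq]
  exact sum_le_hasSum D (fun _ _ => by positivity) (hasSum_norm_sq x)

theorem re_inner_proj (D : Finset (Freq d)) (x : Ell2 d) :
    (inner ℂ x (proj D x)).re = ‖proj D x‖ ^ 2 := by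
  rw [norm_proj_sq, proj, inner_sum, Complex.re_sum]
  refine Finset.sum_congr rfl fun k _ => ?_
  rw [lp.inner_single_right, re_inner_self_eq]

theorem norm_sub_proj_sq (D : Finset (Freq d)) (x : Ell2 d) :
    ‖x - proj D x‖ ^ 2 = ‖x‖ ^ 2 - ‖proj D x‖ ^ 2 := by
  rw [← re_inner_self_eq, inner_sub_left, inner_sub_right, inner_sub_right]
  simp only [Complex.sub_re, re_inner_self_eq, re_inner_proj]
  rw [re_inner_comm, re_inner_proj]
  ring

theorem apply_proj (T : Ell2 d →L[ℂ] Ell2 d) (D : Finset (Freq d)) (x : Ell2 d) (l : Freq d) :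
    T (proj D x) l = ∑ k ∈ D, ent T l k * x k := by
  classical
  have h1 : ∀ k, (proj D x : Freq d → ℂ) k = if k ∈ D then x k else 0 := by
    intro k
    rw [proj, lp.coeFn_sum]
    simp [Finset.sum_apply, Pi.single_apply]
  refine (hasSum_ent_mul T (proj D x) l).unique ?_
  have h2 : HasSum (fun k => ent T l k * proj D x k) (∑ k ∈ D, ent T l k * proj D x k) :=
    hasSum_sum_of_ne_finset_zero fun k hk => by rw [h1, if_neg hk, mul_zero]
  convert h2 using 1
  refine Finset.sum_congr rfl fun k hk => ?_
  rw [h1, if_pos hk]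

/-- The weight of the truncation tolerance in the sharper contraction estimate. -/
def sharpFactor (α β θ : ℝ) : ℝ :=
  if α < β then 1 - Real.sqrt (improvement β⁻¹ α⁻¹ (1 - θ ^ 2)) else 1

theorem sharpFactor_pos {α β θ : ℝ} (hα : 0 < α) (hθ : 0 < 1 - θ ^ 2) :
    0 < sharpFactor α β θ := by
  rw [sharpFactor]
  split_ifs with h
  · have hβ : 0 < β := by linarith
    have := improvement_lt_one (m := β⁻¹) (by positivity) ((inv_lt_inv₀ hβ hα).2 h) hθ
    have : Real.sqrt (improvement β⁻¹ α⁻¹ (1 - θ ^ 2)) < 1 := by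
      rwa [Real.sqrt_lt' one_pos, one_pow]
    linarith
  · exact one_pos

theorem sharpFactor_le_one (α β θ : ℝ) : sharpFactor α β θ ≤ 1 := by
  rw [sharpFactor]
  split_ifs
  · linarith [Real.sqrt_nonneg (improvement β⁻¹ α⁻¹ (1 - θ ^ 2))]
  · exact le_rfl

/-- The correction that is available in the enriched set, with the two estimates for its error. -/
theorem exists_correction {α β θ : ℝ} {A X : Ell2 d →L[ℂ] Ell2 d} (h : IsBetween α β A)
    (hα : 0 < α) (hαβ : α ≤ β) (hAX : A * X = 1) (hXA : X * A = 1) (hθ : 0 < 1 - θ ^ 2)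
    (hθ0 : 0 ≤ θ) {J : ℕ} {ε : ℝ} (hε : OpNormLe (ent X - trunc (ent X) J) ε)
    {e : Ell2 d} {D : Finset (Freq d)} (hD : θ * ‖A e‖ ≤ ‖proj D (A e)‖) :
    ∃ w : Ell2 d, (∀ l ∉ enrich D J, w l = 0) ∧
      (ε ≤ threshold α β θ → opEnergy A (e - w) ≤ 2 * rhoBar α β θ * opEnergy A e) ∧
      (ε ≤ sharpFactor α β θ * threshold α β θ →
        opEnergy A (e - w) ≤ rhoBar α β θ * opEnergy A e) := by
  have hβ : 0 < β := by linarith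
  obtain ⟨T, hT, hTε⟩ := hε
  rw [represents_iff] at hT
  set r := A e with hr
  set p := proj D r with hp
  set q := r - p with hqdef
  have hε0 : 0 ≤ ε := (norm_nonneg T).trans hTε
  have hq : ‖q‖ ^ 2 ≤ (1 - θ ^ 2) * ‖r‖ ^ 2 := by
    rw [hqdef, hp, norm_sub_proj_sq]
    have : (θ * ‖r‖) ^ 2 ≤ ‖proj D r‖ ^ 2 := by gcongr
    linarith
  have hrq : (inner ℂ r q).re = ‖q‖ ^ 2 := by
    rw [hqdef, hp, norm_sub_proj_sq, inner_sub_right, Complex.sub_re, re_inner_self_eq,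
      re_inner_proj]
  have hTp : ‖T p‖ ≤ ε * ‖r‖ :=
    (T.le_opNorm p).trans (mul_le_mul hTε (norm_proj_le D r) (norm_nonneg _) hε0)
  -- Here T is the discarded part of X, so X p - T p is the banded inverse applied to the marked
  -- residual. Its support in the enriched set is exactly the band condition.
  have hsplit : e - (X p - T p) = X q + T p := by
    have : X r = e := apply_apply_of_mul_eq_one hXA e
    rw [hqdef, map_sub, this]
    abel
  have hbasic := opEnergy_inverse_le h hα hβ hAX hθ.le hq
  have hpert := opEnergy_perturbation_le h hα.le hβ hε0 hTp
  have hsum := h.opEnergy_add_le hα.le (X q) (T p)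
  have hE : 0 ≤ opEnergy A e := opEnergy_nonneg _ _
  refine ⟨X p - T p, fun l hl => ?_, fun hε => ?_, fun hε => ?_⟩
  · rw [lp.coeFn_sub, Pi.sub_apply, hp, apply_proj, apply_proj, ← Finset.sum_sub_distrib]
    refine Finset.sum_eq_zero fun k hk => ?_
    have : ¬ freqNorm (l - k) ≤ J := fun hlk => hl ⟨k, hk, hlk⟩
    rw [hT]
    simp [trunc, this]
  · rw [hsplit]
    have : β * ε ≤ rhoBar α β θ := by
      rw [← mul_threshold hα hβ hθ.le]
      gcongr
    nlinarith
  · rw [hsplit]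
    rw [sharpFactor] at hε
    split_ifs at hε with hlt
    · have hsharp := opEnergy_inverse_le_improvement h hα hlt hAX hXA hθ hq hrq
      have : β * ε ≤ (1 - Real.sqrt (improvement β⁻¹ α⁻¹ (1 - θ ^ 2))) * rhoBar α β θ := by
        rw [← mul_threshold hα hβ hθ.le, mul_left_comm]
        gcongr
      nlinarith
    -- No gain is available here and none is needed: X is a scalar, hence diagonal, and truncation
    -- at any J ≥ 0 loses nothing.
    · have hab : α = β := le_antisymm hαβ (not_lt.1 hlt)
      subst hab
      have hT0 : T = 0 := by
        apply ent_injective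
        rw [hT]
        have hX := (h.inverse hα hβ hAX).eq_smul_one
        funext l k
        rw [hX, Pi.sub_apply, Pi.sub_apply, trunc, ent_smul, ent_one]
        by_cases hlk : l = k
        · subst hlk
          simp [ent]
        · simp [hlk, ent]
      rw [hT0, zero_apply, add_zero]
      exact hbasic

/-! ### Transfer to `ℓ²` by an orthonormal basis -/

section Transfer

variable {E : Type*} [NormedAddCommGroup E] [InnerProductSpace ℂ E]
variable (b : HilbertBasis (Freq d) ℂ E)

/-- The operator on `ℓ²` that corresponds to an operator on a Hilbert space with a basis. -/
def conjOp (T : E →L[ℂ] E) : Ell2 d →L[ℂ] Ell2 d :=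
  (b.repr.toContinuousLinearEquiv : E →L[ℂ] Ell2 d).comp
    (T.comp (b.repr.symm.toContinuousLinearEquiv : Ell2 d →L[ℂ] E))

theorem conjOp_apply (T : E →L[ℂ] E) (x : Ell2 d) : conjOp b T x = b.repr (T (b.repr.symm x)) :=
  rfl

theorem conjOp_repr (T : E →L[ℂ] E) (v : E) : conjOp b T (b.repr v) = b.repr (T v) := by
  rw [conjOp_apply, LinearIsometryEquiv.symm_apply_apply]

theorem ent_conjOp (T : E →L[ℂ] E) (l k : Freq d) :
    ent (conjOp b T) l k = inner ℂ (b l) (T (b k)) := by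
  rw [ent, conjOp_apply, b.repr_symm_single, b.repr_apply_apply]

theorem opEnergy_conjOp (T : E →L[ℂ] E) (v : E) :
    opEnergy (conjOp b T) (b.repr v) = opEnergy T v := by
  rw [opEnergy, conjOp_repr, LinearIsometryEquiv.inner_map_map, opEnergy]

theorem IsBetween.conjOp {α β : ℝ} {T : E →L[ℂ] E} (h : IsBetween α β T) :
    IsBetween α β (conjOp b T) := by
  have key : ∀ x y : Ell2 d, inner ℂ x (AFG.conjOp b T y) =
      inner ℂ (b.repr.symm x) (T (b.repr.symm y)) := by
    intro x y
    rw [conjOp_apply, ← LinearIsometryEquiv.inner_map_map b.repr.symm,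
      LinearIsometryEquiv.symm_apply_apply]
  refine ⟨fun u v => ?_, fun v => ?_, fun v => ?_⟩
  · rw [← inner_conj_symm, key, key, inner_conj_symm, h.symm]
  · rw [key, ← b.repr.symm.norm_map v]
    exact h.lower _
  · rw [key, ← b.repr.symm.norm_map v]
    exact h.upper _

theorem repr_symm_mem_span {Λ : Finset (Freq d)} {w : Ell2 d} (hw : ∀ l ∉ Λ, w l = 0) :
    b.repr.symm w ∈ Submodule.span ℂ (b '' (Λ : Set (Freq d))) := by
  have h1 := b.hasSum_repr_symm w
  have h2 : HasSum (fun i => w i • b i) (∑ i ∈ Λ, w i • b i) :=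
    hasSum_sum_of_ne_finset_zero fun l hl => by rw [hw l hl, zero_smul]
  rw [h1.unique h2]
  exact Submodule.sum_mem _ fun k hk =>
    Submodule.smul_mem _ _ (Submodule.subset_span ⟨k, hk, rfl⟩)

end Transfer

end AFG

end

noncomputable section

namespace AFG

variable {d : ℕ}

/-! ### Bulk chasing sets and enrichment -/

theorem exists_le_norm_proj {θ : ℝ} (hθ0 : 0 ≤ θ) (hθ : θ < 1) (x : Ell2 d) :
    ∃ D : Finset (Freq d), θ * ‖x‖ ≤ ‖proj D x‖ := by
  rcases (norm_nonneg x).eq_or_lt with h | h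
  · exact ⟨∅, by rw [← h, mul_zero]; exact norm_nonneg _⟩
  · have h1 : (θ * ‖x‖) ^ 2 < ‖x‖ ^ 2 := by
      have : θ * ‖x‖ < ‖x‖ := by nlinarith
      gcongr
    obtain ⟨D, hD⟩ := ((hasSum_norm_sq x).eventually (lt_mem_nhds h1)).exists
    refine ⟨D, abs_le_of_sq_le_sq' ?_ (norm_nonneg _) |>.2⟩
    rw [norm_proj_sq]
    exact hD.le

theorem finite_enrich (D : Finset (Freq d)) (J : ℕ) : (enrich D J).Finite := by
  have : enrich D J ⊆ ⋃ l ∈ D, (fun k => k + l) '' {k | freqNorm k ≤ J} := by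
    rintro k ⟨l, hl, hk⟩
    exact mem_biUnion hl ⟨k - l, hk, by simp⟩
  exact (D.finite_toSet.biUnion fun l _ => (finite_ball _).image _).subset this

/-! ### Functionals and their coefficients -/

theorem dualCoeff_eq {r : Dual d} {R : H1p d} (h : ∀ v, r v = inner ℂ v R) (k : Freq d) :
    dualCoeff r k = (modeBasis d).repr R k := by
  rw [HilbertBasis.repr_apply_apply, modeBasis_apply, unitMode, dualCoeff, h,
    inner_smul_left (𝕜 := ℂ) (E := H1p d)]
  simp [div_eq_inv_mul]

theorem projNorm_eq {r : Dual d} {R : H1p d} (h : ∀ v, r v = inner ℂ v R)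
    (D : Finset (Freq d)) : projNorm r D = ‖proj D ((modeBasis d).repr R)‖ := by
  rw [← Real.sqrt_sq (norm_nonneg (proj _ _)), norm_proj_sq, projNorm]
  simp only [dualCoeff_eq h]

theorem dual_norm_eq {r : Dual d} {R : H1p d} (h : ∀ v, r v = inner ℂ v R) :
    ‖r‖ = ‖(modeBasis d).repr R‖ := by
  rw [norm_functional (H := H1p d) h]
  exact ((modeBasis d).repr.norm_map R).symm

theorem exists_isDorfler {θ : ℝ} (hθ0 : 0 ≤ θ) (hθ : θ < 1) (r : Dual d) :
    ∃ D, IsDorfler r θ D := by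
  obtain ⟨R, hR⟩ := exists_riesz (H := H1p d) r
  have hne : ({D | θ * ‖r‖ ≤ projNorm r D} : Set (Finset (Freq d))).Nonempty := by
    obtain ⟨D, hD⟩ := exists_le_norm_proj hθ0 hθ ((modeBasis d).repr R)
    exact ⟨D, by rwa [mem_ofPred_eq, dual_norm_eq hR, projNorm_eq hR]⟩
  refine ⟨Function.argminOn Finset.card _ hne, Function.argminOn_mem Finset.card _ hne,
    fun D' hD' => Function.argminOn_le Finset.card _ hD'⟩

theorem trialSpace_mono {Λ Λ' : Finset (Freq d)} (h : Λ ⊆ Λ') : trialSpace Λ ≤ trialSpace Λ' :=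
  Submodule.span_mono (image_mono (by exact_mod_cast h))

theorem modeBasis_mem_trialSpace {Λ : Finset (Freq d)} {k : Freq d} (hk : k ∈ Λ) :
    modeBasis d k ∈ trialSpace Λ := by
  rw [modeBasis_apply, unitMode]
  exact Submodule.smul_mem _ _ (Submodule.subset_span ⟨k, hk, rfl⟩)

instance (Λ : Finset (Freq d)) : FiniteDimensional ℂ (trialSpace Λ) :=
  FiniteDimensional.span_of_finite ℂ (Λ.finite_toSet.image _)

/-! ### The elliptic form as an operator -/

/-- `S` is the operator of the elliptic form, and lies between `α` and `β`. -/
structure IsFormOperator (α β : ℝ) (ν σ : (Fin d → ℝ) → ℝ) (S : H1p d →L[ℂ] H1p d) : Prop where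
  between : IsBetween (H := H1p d) α β S
  form_eq : ∀ u v, form ν σ u v = inner ℂ v (S u)

namespace IsFormOperator

variable {α β : ℝ} {ν σ : (Fin d → ℝ) → ℝ} {S : H1p d →L[ℂ] H1p d}

theorem energy_eq (h : IsFormOperator α β ν σ S) (v : H1p d) : energy ν σ v = opEnergy (H := H1p d) S v := by
  rw [energy, h.form_eq, opEnergy]

theorem form_sub (h : IsFormOperator α β ν σ S) (u w v : H1p d) :
    form ν σ (u - w) v = form ν σ u v - form ν σ w v := by
  rw [h.form_eq, h.form_eq, h.form_eq, map_sub]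
  exact inner_sub_right (𝕜 := ℂ) (E := H1p d) _ _ _

theorem ent_conjOp (h : IsFormOperator α β ν σ S) :
    ent (conjOp (modeBasis d) S) = stiffness ν σ := by
  funext l k
  rw [AFG.ent_conjOp (E := H1p d), modeBasis_apply, modeBasis_apply, unitMode, unitMode, map_smul,
    inner_smul_left (𝕜 := ℂ) (E := H1p d), inner_smul_right (𝕜 := ℂ) (E := H1p d), ← h.form_eq,
    stiffness]
  simp [div_eq_inv_mul]
  ring

theorem exists_step (h : IsFormOperator α β ν σ S) (hα : 0 < α) {θ : ℝ} (hθ0 : 0 ≤ θ)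
    (hθ : θ < 1) (f : Dual d) (J : ℕ) (s : State d) : ∃ s', Step ν σ f θ J s s' := by
  classical
  obtain ⟨D, hD⟩ := exists_isDorfler hθ0 hθ s.r
  obtain ⟨F, hF⟩ := exists_riesz (H := H1p d) f
  let Λ := s.Λ ∪ (finite_enrich D J).toFinset
  obtain ⟨w, hw, hw'⟩ := exists_galerkin (H := H1p d) h.between hα (trialSpace Λ) F
  obtain ⟨r, hr⟩ := exists_functional (H := H1p d) (F - S w)
  refine ⟨⟨Λ, w, r⟩, ⟨D, hD, by simp [Λ]⟩, ⟨hw, fun v hv => ?_⟩, fun v => ?_⟩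
  · rw [h.form_eq, hF]
    exact hw' v hv
  · rw [h.form_eq, hF]
    exact (hr v).trans (inner_sub_right (𝕜 := ℂ) (E := H1p d) _ _ _)

end IsFormOperator

/-! ### Runs of the algorithm -/

/-- The properties of the iterates that the algorithm maintains. -/
structure IsIterate (ν σ : (Fin d → ℝ) → ℝ) (u : H1p d) (s : State d) : Prop where
  mem : s.u ∈ trialSpace s.Λ
  residual : ∀ v, s.r v = form ν σ (u - s.u) v

variable {α β : ℝ} {ν σ : (Fin d → ℝ) → ℝ} {S : H1p d →L[ℂ] H1p d} {f : Dual d} {u : H1p d}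
  {θ : ℝ} {J : ℕ}

theorem Step.isIterate (h : IsFormOperator α β ν σ S) (hu : IsWeakSolution ν σ f u)
    {s s' : State d} (hs : Step ν σ f θ J s s') : IsIterate ν σ u s' :=
  ⟨hs.2.1.1, fun v => by rw [hs.2.2 v, h.form_sub, hu v]⟩

theorem IsRun.isIterate (h : IsFormOperator α β ν σ S) (hu : IsWeakSolution ν σ f u)
    {tol : ℝ} {N : ℕ∞} {s : ℕ → State d} (hs : IsRun ν σ f θ J tol N s) {n : ℕ}
    (hn : (n : ℕ∞) ≤ N) : IsIterate ν σ u (s n) := by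
  cases n with
  | zero =>
    rw [hs.init]
    exact ⟨Submodule.zero_mem _, fun v => by rw [sub_zero, hu v]⟩
  | succ n =>
    exact (hs.step n (lt_of_lt_of_le (by exact_mod_cast n.lt_succ_self) hn)).isIterate h hu

/-- The Galerkin solution is the best approximation in energy, so it is at least as good as the old
iterate plus the correction, which lies in the new trial space. -/
theorem Step.energy_le (h : IsFormOperator α β ν σ S) (hα : 0 < α) (hαβ : α ≤ β)
    (hu : IsWeakSolution ν σ f u) (hθ : 0 < 1 - θ ^ 2) (hθ0 : 0 ≤ θ)
    {X : Ell2 d →L[ℂ] Ell2 d} (hAX : conjOp (modeBasis d) S * X = 1)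
    (hXA : X * conjOp (modeBasis d) S = 1) {ε : ℝ} (hε : OpNormLe (ent X - trunc (ent X) J) ε)
    {s s' : State d} (hi : IsIterate ν σ u s) (hs : Step ν σ f θ J s s') :
    (ε ≤ threshold α β θ →
      energy ν σ (u - s'.u) ≤ 2 * rhoBar α β θ * energy ν σ (u - s.u)) ∧
    (ε ≤ sharpFactor α β θ * threshold α β θ →
      energy ν σ (u - s'.u) ≤ rhoBar α β θ * energy ν σ (u - s.u)) := by
  obtain ⟨D, hD, hΛ⟩ := hs.1
  have hr : ∀ v, s.r v = inner ℂ v (S (u - s.u)) := fun v => by rw [hi.residual, h.form_eq]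
  have hD1 := hD.1
  rw [dual_norm_eq hr, projNorm_eq hr, ← conjOp_repr (E := H1p d)] at hD1
  obtain ⟨w, hw, hw1, hw2⟩ := exists_correction (h.between.conjOp (modeBasis d)) hα hαβ hAX hXA hθ hθ0 hε hD1
  have hsub : ∀ l ∉ s'.Λ, w l = 0 := fun l hl => hw l fun hl' => hl <| by
    have : l ∈ (s'.Λ : Set (Freq d)) := by rw [hΛ]; exact Or.inr hl'
    exact this
  have hw' : (modeBasis d).repr.symm w ∈ trialSpace s'.Λ := by
    refine Submodule.span_le.2 ?_ (repr_symm_mem_span (modeBasis d) hsub)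
    rintro _ ⟨k, hk, rfl⟩
    exact modeBasis_mem_trialSpace hk
  have hmono : s.Λ ⊆ s'.Λ := by
    intro k hk
    have : k ∈ (s'.Λ : Set (Freq d)) := by rw [hΛ]; exact Or.inl hk
    exact this
  have hv := Submodule.add_mem _ (trialSpace_mono hmono hi.mem) hw'
  have hort : ∀ z ∈ trialSpace s'.Λ, inner ℂ z (S (u - s'.u)) = 0 := fun z hz => by
    rw [← h.form_eq, h.form_sub, hu z, hs.2.1.2 z hz, sub_self]
  have hle := opEnergy_galerkin_le (H := H1p d) h.between hα.le hs.2.1.1 hv hort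
  have e1 : (modeBasis d).repr (u - (s.u + (modeBasis d).repr.symm w)) =
      (modeBasis d).repr (u - s.u) - w := by
    rw [← sub_sub]
    rw [map_sub (modeBasis d).repr (u - s.u), LinearIsometryEquiv.apply_symm_apply]
  rw [← opEnergy_conjOp (E := H1p d) (modeBasis d) S (u - (s.u + _)), e1] at hle
  rw [h.energy_eq, h.energy_eq]
  rw [opEnergy_conjOp (E := H1p d)] at hw1 hw2
  exact ⟨fun hε => hle.trans (hw1 hε), fun hε => hle.trans (hw2 hε)⟩

theorem energy_le_pow {ρ : ℝ} (hρ : 0 ≤ ρ) {s : ℕ → State d} {N : ℕ∞}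
    (hs : ∀ n : ℕ, (n : ℕ∞) < N →
      energy ν σ (u - (s (n + 1)).u) ≤ ρ * energy ν σ (u - (s n).u)) {n : ℕ}
    (hn : (n : ℕ∞) ≤ N) : energy ν σ (u - (s n).u) ≤ ρ ^ n * energy ν σ (u - (s 0).u) := by
  induction n with
  | zero => simp
  | succ n ih =>
    have hlt : (n : ℕ∞) < N := lt_of_lt_of_le (by exact_mod_cast n.lt_succ_self) hn
    calc _ ≤ ρ * energy ν σ (u - (s n).u) := hs n hlt
      _ ≤ ρ * (ρ ^ n * energy ν σ (u - (s 0).u)) := by gcongr; exact ih hlt.le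
      _ = _ := by ring

/-- A contraction of the energy error controls everything else, because residual norm, energy error
and V-norm error are equivalent up to powers of α and β. -/
theorem convergesWithFactor_of_step (h : IsFormOperator α β ν σ S) (hα : 0 < α) (hβ : 0 < β)
    (hu : IsWeakSolution ν σ f u) (hθ0 : 0 ≤ θ) (hθ : θ < 1) {ρ : ℝ} (hρ0 : 0 ≤ ρ) (hρ : ρ < 1)
    (hstep : ∀ s s' : State d, IsIterate ν σ u s → Step ν σ f θ J s s' →
      energy ν σ (u - s'.u) ≤ ρ * energy ν σ (u - s.u)) :
    ConvergesWithFactor ν σ f u θ J ρ := by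
  have hcon : ∀ (tol : ℝ) (N : ℕ∞) (s : ℕ → State d), IsRun ν σ f θ J tol N s →
      ∀ n : ℕ, (n : ℕ∞) < N → energy ν σ (u - (s (n + 1)).u) ≤ ρ * energy ν σ (u - (s n).u) :=
    fun tol N s hs n hn => hstep _ _ (hs.isIterate h hu hn.le) (hs.step n hn)
  have hpow : ∀ (tol : ℝ) (N : ℕ∞) (s : ℕ → State d), IsRun ν σ f θ J tol N s →
      ∀ n : ℕ, (n : ℕ∞) ≤ N → opEnergy (H := H1p d) S (u - (s n).u) ≤ ρ ^ n * opEnergy (H := H1p d) S u := by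
    intro tol N s hs n hn
    have := energy_le_pow hρ0 (hcon tol N s hs) hn
    rwa [hs.init, sub_zero, h.energy_eq, h.energy_eq] at this
  have hlim : ∀ c : ℝ, Tendsto (fun n : ℕ => c * (ρ ^ n * opEnergy (H := H1p d) S u)) atTop (𝓝 0) := by
    intro c
    simpa using ((tendsto_pow_atTop_nhds_zero_of_lt_one hρ0 hρ).mul_const _).const_mul c
  refine ⟨h.exists_step hα hθ0 hθ f J, fun tol N s _ hs => hcon tol N s hs, fun tol htol => ?_,
    fun s hs => ?_, fun N s hs _ hN => ?_⟩
  -- The index must be at least 1: the first pass is made without testing the residual, so at index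
  -- 0 there is no tolerance condition to contradict.
  · obtain ⟨n, hn, hn1⟩ := (((hlim (Real.sqrt β)).eventually (gt_mem_nhds htol)).and
      (eventually_ge_atTop 1)).exists
    refine ⟨n, fun N s hs => not_lt.1 fun hlt => ?_⟩
    have h1 := hs.continue_of_lt n hlt (by lia)
    have hr : ∀ v, (s n).r v = inner ℂ v (S (u - (s n).u)) := fun v => by
      rw [(hs.isIterate h hu hlt.le).residual, h.form_eq]
    rw [norm_functional (H := H1p d) hr] at h1
    have h2 := h.between.norm_apply_le hα.le hβ (u - (s n).u)
    have h3 := mul_le_mul_of_nonneg_left (hpow tol N s hs n hlt.le) (Real.sqrt_nonneg β)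
    exact absurd (h1.trans_le (h2.trans h3)) (not_lt.2 hn.le)
  · rw [tendsto_iff_norm_sub_tendsto_zero]
    refine squeeze_zero (fun _ => norm_nonneg _) (fun n => ?_) (hlim (Real.sqrt α)⁻¹)
    rw [norm_sub_rev, le_inv_mul_iff₀ (Real.sqrt_pos.2 hα)]
    exact (h.between.le_opEnergy _).trans (hpow 0 ⊤ s hs n le_top)
  · have hr : ∀ v, (s N).r v = inner ℂ v (S (u - (s N).u)) := fun v => by
      rw [(hs.isIterate h hu le_rfl).residual, h.form_eq]
    rw [norm_functional (H := H1p d) hr] at hN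
    have h0 : S (u - (s N).u) = 0 := norm_le_zero_iff.1 hN
    have h1 : opEnergy (H := H1p d) S (u - (s N).u) = 0 := by
      unfold opEnergy
      rw [h0, inner_zero_right (𝕜 := ℂ) (E := H1p d)]
      simp
    have h2 := h.between.le_opEnergy (u - (s N).u)
    rw [h1] at h2
    have h3 : ‖u - (s N).u‖ ≤ 0 := nonpos_of_mul_nonpos_right h2 (Real.sqrt_pos.2 hα)
    exact (sub_eq_zero.1 (norm_le_zero_iff.1 h3)).symm

/-! ### The choice of the enrichment radius -/

theorem exists_isLeast_of_tendsto {g : ℕ → ℝ} (hg : Tendsto g atTop (𝓝 0)) (C : ℝ) {τ : ℝ}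
    (hτ : 0 < τ) : ∃ J, IsLeast {J : ℕ | C * g J ≤ τ} J := by
  have h1 : Tendsto (fun J => C * g J) atTop (𝓝 0) := by simpa using hg.const_mul C
  have hne : {J : ℕ | C * g J ≤ τ}.Nonempty := (h1.eventually (ge_mem_nhds hτ)).exists
  exact ⟨sInf _, Nat.sInf_mem hne, fun _ h => Nat.sInf_le h⟩

theorem threshold_pos (hα : 0 < α) (hβ : 0 < β) (hθ : 0 < 1 - θ ^ 2) : 0 < threshold α β θ :=
  Real.sqrt_pos.2 (by positivity)

theorem aggressiveConvergence (h : IsFormOperator α β ν σ S) (hα : 0 < α) (hαβ : α ≤ β)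
    (hu : IsWeakSolution ν σ f u) (hθ0 : 0 ≤ θ) (hθ : θ < 1) {X : Ell2 d →L[ℂ] Ell2 d}
    (hAX : conjOp (modeBasis d) S * X = 1) (hXA : X * conjOp (modeBasis d) S = 1) {g : ℕ → ℝ}
    (hg : Tendsto g atTop (𝓝 0)) (hC : ∃ C, IsTruncConst (ent X) g C) :
    AggressiveConvergence ν σ f u θ (ent X) g (threshold α β θ) (2 * rhoBar α β θ) ∧
    AggressiveConvergence ν σ f u θ (ent X) g (sharpFactor α β θ * threshold α β θ)
      (rhoBar α β θ) := by
  have hβ : 0 < β := by linarith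
  have hθ2 : 0 < 1 - θ ^ 2 := by nlinarith
  have hT := threshold_pos hα hβ hθ2
  have hρ := rhoBar_nonneg α β θ
  refine ⟨⟨hC, fun C hC => ?_⟩, ⟨hC, fun C hC => ?_⟩⟩
  · obtain ⟨J, hJ⟩ := exists_isLeast_of_tendsto hg C hT
    exact ⟨J, hJ, fun hlt => convergesWithFactor_of_step h hα hβ hu hθ0 hθ (by positivity) hlt
      fun s s' hi hs => (hs.energy_le h hα hαβ hu hθ2 hθ0 hAX hXA (hC.2 J) hi).1 hJ.1⟩
  · obtain ⟨J, hJ⟩ := exists_isLeast_of_tendsto hg C (mul_pos (sharpFactor_pos hα hθ2) hT)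
    exact ⟨J, hJ, fun hlt => convergesWithFactor_of_step h hα hβ hu hθ0 hθ hρ hlt
      fun s s' hi hs => (hs.energy_le h hα hαβ hu hθ2 hθ0 hAX hXA (hC.2 J) hi).2 hJ.1⟩

theorem tendsto_rhoBar (α β : ℝ) : Tendsto (rhoBar α β) (𝓝[<] 1) (𝓝 0) := by
  have hc : Continuous (rhoBar α β) := by unfold rhoBar; fun_prop
  have : rhoBar α β 1 = 0 := by simp [rhoBar]
  rw [← this]
  exact hc.continuousAt.tendsto.mono_left nhdsWithin_le_nhds

end AFG

end

/-! ### Assembly of the theorem. -/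

theorem mainTheorem2 (νl νu σl σu : ℝ) (hνl : 0 < νl) (hν : νl ≤ νu) (hσl : 0 < σl)
    (hσ : σl ≤ σu) :
    Tendsto (fun θ => AFG.rhoBar (min νl σl) (max νu σu) θ) (𝓝[<] 1) (𝓝 0) ∧
    ∀ θ : ℝ, 0 < θ → θ < 1 → ∃ δ : ℝ, 0 < δ ∧ δ ≤ 1 ∧
      ∀ (d : ℕ) (_ : 1 ≤ d) (ν σ : (Fin d → ℝ) → ℝ) (_ : AFG.IsCoeff νl νu σl σu ν σ)
        (f : AFG.Dual d) (u : AFG.H1p d) (_ : AFG.IsWeakSolution ν σ f u),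
        ∃ B : AFG.BiMatrix d, AFG.IsInverseMatrix (AFG.stiffness ν σ) B ∧
          -- algebraic case
          (∀ η : ℝ, (d : ℝ) < η → AFG.AlgClass η (AFG.stiffness ν σ) →
            AFG.AlgClass η B ∧
            AFG.AggressiveConvergence ν σ f u θ B (AFG.algRate d η)
              (AFG.threshold (min νl σl) (max νu σu) θ)
              (2 * AFG.rhoBar (min νl σl) (max νu σu) θ) ∧
            AFG.AggressiveConvergence ν σ f u θ B (AFG.algRate d η)
              (δ * AFG.threshold (min νl σl) (max νu σu) θ)
              (AFG.rhoBar (min νl σl) (max νu σu) θ)) ∧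
          -- exponential case
          (∀ η : ℝ, 0 < η → AFG.ExpClass η (AFG.stiffness ν σ) →
            (∃ η' : ℝ, 0 < η' ∧ η' ≤ η ∧ AFG.ExpClass η' B) ∧
            (d = 1 → ∀ c m : ℝ, 0 < m → (∀ l, m ≤ (AFG.stiffness ν σ l l).re) →
              AFG.ExpBound η c (AFG.stiffness ν σ) →
              c < (Real.exp η - 1) / 2 * m →
              ∃ η' : ℝ, 0 < η' ∧ η' ≤ η ∧
                Real.exp (-η') ^ 2 -
                  (Real.exp (2 * η) + 2 * (c / m) + 1) / (Real.exp η * (c / m + 1)) *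
                    Real.exp (-η') + 1 = 0 ∧
                AFG.ExpClass η' B) ∧
            ∀ η' : ℝ, 0 < η' → AFG.ExpClass η' B →
              AFG.AggressiveConvergence ν σ f u θ B (AFG.expRate d η')
                (AFG.threshold (min νl σl) (max νu σu) θ)
                (2 * AFG.rhoBar (min νl σl) (max νu σu) θ) ∧
              AFG.AggressiveConvergence ν σ f u θ B (AFG.expRate d η')
                (δ * AFG.threshold (min νl σl) (max νu σu) θ)
                (AFG.rhoBar (min νl σl) (max νu σu) θ)) := by

  have hα : 0 < min νl σl := lt_min hνl hσl
  have hαβ : min νl σl ≤ max νu σu := (min_le_left _ _).trans (hν.trans (le_max_left _ _))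
  refine ⟨AFG.tendsto_rhoBar _ _, fun θ hθ0 hθ => ?_⟩
  -- This δ is fixed before the dimension, the coefficients and f, since the improvement involves
  -- only the spectral bounds and θ.
  refine ⟨AFG.sharpFactor (min νl σl) (max νu σu) θ, AFG.sharpFactor_pos hα (by nlinarith),
    AFG.sharpFactor_le_one _ _ _, fun d hd ν σ hcoeff f u hu => ?_⟩
  obtain ⟨S, hS, hsymm, hlower, hupper⟩ := AFG.exists_form_operator hcoeff
  have h : AFG.IsFormOperator (min νl σl) (max νu σu) ν σ S := ⟨⟨hsymm, hlower, hupper⟩, hS⟩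
  have hA := h.between.conjOp (AFG.modeBasis d)
  obtain ⟨X, hAX, hXA⟩ := hA.exists_inverse hα
  -- The same contraction 1 - tA serves for the inverse in both decay classes.
  obtain ⟨t, ht, hQ⟩ := hA.norm_one_sub_smul_lt hα
  rw [← h.ent_conjOp]
  refine ⟨AFG.ent X, ⟨_, X, AFG.represents_ent _, AFG.represents_ent X, hAX, hXA⟩,
    fun η hη hcls => ?_, fun η hη hcls => ⟨AFG.expClass_inverse hd hη hAX ht hQ hcls, ?_, ?_⟩⟩
  · have hX := AFG.algClass_inverse hd hη hAX ht hQ hcls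
    exact ⟨hX, AFG.aggressiveConvergence h hα hαβ hu hθ0.le hθ hAX hXA (AFG.tendsto_algRate hη)
      (hX.exists_isTruncConst hd hη)⟩
  · rintro rfl c m hm hdiag hbound hc
    exact AFG.expClass_inverse_one hη hm hAX hdiag hbound hc
  · intro η' hη' hX
    exact AFG.aggressiveConvergence h hα hαβ hu hθ0.le hθ hAX hXA
      (AFG.summable_expRate d hη').tendsto_atTop_zero (hX.exists_isTruncConst hd hη')
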